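/- For $\theta=(\mu,\sigma^2,\lambda)\in\mathbb{R}\times\mathbb{R}^+\times\mathbb{R}$ let $f_{SN}(x;\theta)=\frac{2}{\sigma}\,\phi\big(\frac{x-\mu}{\sigma}\big)\Phi\big(\lambda\frac{x-\mu}{\sigma}\big)$ be the skew normal density, where $\phi,\Phi$ are the standard normal density and distribution function. A parameter $\Psi$ with $p$ components consists of proportions $\pi_k\ge 0$ with $\sum_{k=1}^p\pi_k=1$ and of $\mu_k\in\mathbb{R}$, $\sigma_k>0$, $\lambda_k\in\mathbb{R}$ ($1\le k\le p$); put $\theta_k=(\mu_k,\sigma_k^2,\lambda_k)$, $f(x;\Psi)=\sum_{k=1}^p\pi_k f_{SN}(x;\theta_k)$, and let $\Psi(\theta)=\sum_{k=1}^p\pi_k I(\theta_k\le\theta)$ (coordinatewise order) be the distribution function of the mixing distribution. Define $$D(\Psi,\Psi')=\int_{\mathbb{R}\times\mathbb{R}^+\times\mathbb{R}}|\Psi(\theta)-\Psi'(\theta)|\,e^{-|\theta|}\,d\theta,\qquad |\theta|=|\mu|+\sigma^2+|\lambda|.$$ Let $X_1,X_2,\dots$ be i.i.d. with density $f(\cdot\,;\Psi_0)$,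 where $\Psi_0$ has $p_0$ components, and suppose that $\Psi_0$ is identifiable in the sense that no two components $(\mu,\sigma^2,\lambda)$ and $(\mu,\sigma^2,-\lambda)$ of $\Psi_0$ both have positive proportion (in particular no component with positive proportion has $\lambda=0$). Let the penalized log-likelihood be $$p\ell_n(\Psi)=\sum_{i=1}^n\log f(X_i;\Psi)+\sum_k p_n(\sigma_k)+\sum_k p_n(\lambda_k),$$ the penalty sums running over the components of $\Psi$, where the penalty functions $p_n(\sigma)$ and $p_n(\lambda)$ may depend on the sample and almost surely satisfy: * C1: $p_n(\sigma)=o(n)$ for every $\sigma>0$, and $\sup_{\sigma>0}\max\{0,p_n(\sigma)\}=o(n)$; * C2: for all large $n$, $p_n(\sigma)\le(\log n)^2\log\sigma$ whenever $0<\sigma<n^{-1}\log n$; * C3: for all large $n$, $p_n(\lambda)$ is continuous in $\lambda$, attains its maximum at $\lambda=0$ with $p_n(0)=0$, and tends to $-\infty$ as $|\lambda|\to\infty$; moreover $p_n(\lambda)=o(n)$ for every $\lambda$. Let $p_0<p<\infty$. Then, almost surely, for every real $c$ and every sequence $(\Psi_n)$ of $p$-component parameters (possibly depending on the sample) with $p\ell_n(\Psi_n)-p\ell_n(\Psi_0)\ge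 c$ for all large $n$, one has $D(\Psi_n,\Psi_0)\to 0$ as $n\to\infty$. Consequently the penalized maximum likelihood estimator of order $p$ is strongly consistent: almost surely, $D(\tilde\Psi_n,\Psi_0)\to 0$ whenever, for all large $n$, $\tilde\Psi_n$ maximizes $p\ell_n$ over all $p$-component parameters. -/

import Mathlib

open MeasureTheory ProbabilityTheory Filter Topology Asymptotics

noncomputable section

/-- The skew normal density `f_SN(x; μ, σ², l) = (2/σ) φ((x - μ)/σ) Φ(l (x - μ)/σ)`, where `φ` and
`Φ` are the density and the distribution function of the standard normal law (used for `σ > 0`). -/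
def skewNormalPDF (μ σ l x : ℝ) : ℝ :=
  2 / σ * gaussianPDFReal 0 1 ((x - μ) / σ) * cdf (gaussianReal 0 1) (l * ((x - μ) / σ))

/-- The parameter `Ψ` of a skew normal mixture with `p` components: mixing proportions `w k`,
locations `μ k`, scales `σ k` and shapes `l k`. Proportions may vanish and components may
coincide. -/
structure MixParam (p : ℕ) where
  w : Fin p → ℝ
  μ : Fin p → ℝ
  σ : Fin p → ℝ
  l : Fin p → ℝ
  w_nonneg : ∀ k, 0 ≤ w k
  w_sum : ∑ k, w k = 1
  σ_pos : ∀ k, 0 < σ k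

namespace MixParam

variable {p q : ℕ}

/-- The mixture density `f(x; Ψ) = ∑ₖ wₖ f_SN(x; θₖ)`. -/
def pdf (Ψ : MixParam p) (x : ℝ) : ℝ :=
  ∑ k, Ψ.w k * skewNormalPDF (Ψ.μ k) (Ψ.σ k) (Ψ.l k) x

/-- The law on `ℝ` with density `f(x; Ψ)`. -/
def law (Ψ : MixParam p) : Measure ℝ :=
  volume.withDensity fun x => ENNReal.ofReal (Ψ.pdf x)

open Classical in
/-- The distribution function `Ψ(θ) = ∑ₖ wₖ I(θₖ ≤ θ)` of the mixing distribution, where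
`θ = (μ, σ², l)` and `≤` is coordinatewise. -/
def mixCDF (Ψ : MixParam p) (θ : ℝ × ℝ × ℝ) : ℝ :=
  ∑ k, if Ψ.μ k ≤ θ.1 ∧ Ψ.σ k ^ 2 ≤ θ.2.1 ∧ Ψ.l k ≤ θ.2.2 then Ψ.w k else 0

/-- The distance `D(Ψ, Ψ') = ∫ |Ψ(θ) - Ψ'(θ)| exp(-|θ|) dθ` over `θ = (μ, σ², l)` in `ℝ × ℝ⁺ × ℝ`,
with `|θ| = |μ| + σ² + |l|`. -/
def dist (Ψ : MixParam p) (Ψ' : MixParam q) : ℝ :=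
  ∫ θ in {θ : ℝ × ℝ × ℝ | 0 < θ.2.1},
    |Ψ.mixCDF θ - Ψ'.mixCDF θ| * Real.exp (-(|θ.1| + θ.2.1 + |θ.2.2|))

/-- No two components `(μ, σ, l)` and `(μ, σ, -l)` both carry positive mass. The case `k = j` says
that no component of positive mass has shape `0`. (Since `Φ(t) + Φ(-t) = 1`, the equal mixture of
such a pair is the normal density whatever `l` is, so a mixing distribution without this property
is not determined by its mixture density.) -/
def NoMirrorPair (Ψ : MixParam p) : Prop :=
  ∀ k j, 0 < Ψ.w k → 0 < Ψ.w j → ¬ (Ψ.μ k = Ψ.μ j ∧ Ψ.σ k = Ψ.σ j ∧ Ψ.l k = -Ψ.l j)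

/-- The log-likelihood `ℓₙ(Ψ)` of the first `n` terms of the sample `x`. -/
def logLik (Ψ : MixParam p) (n : ℕ) (x : ℕ → ℝ) : ℝ :=
  ∑ i ∈ Finset.range n, Real.log (Ψ.pdf (x i))

/-- The penalized log-likelihood `ℓₙ(Ψ) + ∑ₖ pₙ(σₖ) + ∑ₖ pₙ(lₖ)`, with penalties `a` and `b` for
scales and shapes. -/
def penLogLik (Ψ : MixParam p) (n : ℕ) (x : ℕ → ℝ) (a b : ℝ → ℝ) : ℝ :=
  Ψ.logLik n x + ((∑ k, a (Ψ.σ k)) + ∑ k, b (Ψ.l k))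

/-- `Ψ` is a penalized maximum likelihood estimate among the mixtures with `p` components. -/
def IsPMLE (Ψ : MixParam p) (n : ℕ) (x : ℕ → ℝ) (a b : ℝ → ℝ) : Prop :=
  ∀ Ψ' : MixParam p, Ψ'.penLogLik n x a b ≤ Ψ.penLogLik n x a b

end MixParam

/-- `pₙ(σ) = o(n)` for every `σ > 0`, and `sup_{σ > 0} max {0, pₙ(σ)} = o(n)` (in particular the
supremum is finite for large `n`). -/
def CondC1 (a : ℕ → ℝ → ℝ) : Prop :=
  (∀ s : ℝ, 0 < s → (fun n => a n s) =o[atTop] fun n : ℕ => (n : ℝ)) ∧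
  ∀ ε : ℝ, 0 < ε → ∀ᶠ n : ℕ in atTop, ∀ s : ℝ, 0 < s → max 0 (a n s) ≤ ε * n

/-- `pₙ(σ) ≤ (log n)² log σ` whenever `n` is large and `0 < σ < n⁻¹ log n`. -/
def CondC2 (a : ℕ → ℝ → ℝ) : Prop :=
  ∀ᶠ n : ℕ in atTop, ∀ s : ℝ, 0 < s → s < (n : ℝ)⁻¹ * Real.log n →
    a n s ≤ Real.log n ^ 2 * Real.log s

/-- For large `n`, the shape penalty is continuous, maximal at `0` with value `0`, and tends to
`-∞` as `|l| → ∞`. -/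
def CondC3 (b : ℕ → ℝ → ℝ) : Prop :=
  ∀ᶠ n : ℕ in atTop, Continuous (b n) ∧ (∀ l, b n l ≤ b n 0) ∧
    Tendsto (b n) (cocompact ℝ) atBot ∧ b n 0 = 0

end

noncomputable section

/-! The argument is a Wald-type compactness proof in which all probability is collected beforehand.
`MixParam.ae_isTypicalSample` puts three properties on almost every sample: convergent frequencies
of countably many cells, small averages of `1 + x²` over the tails, and a bound `C (n r + log n)` on
the number of points in every window of radius `r`. From there on everything is deterministic, so
the competing sequence may depend on the sample in any way. By compactness of `[0,1]` and of the
extended line, every subsequence has a further one along which all weights, locations, scales and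
shapes converge, possibly to infinite values or to scale `0`.

With `u = f(x; Ψₙ) / f(x; Ψ₀)`, the inequality `4 u ≤ (1 + u)²` gives `log u ≤ 2 log (1 + u) - 2 log
2`, a bound by a function that stays bounded below. A component whose scale `s` tends to `0` is cut
out of `u` on the window `|x - μ| ≤ √s`; the removed part is paid for by the window counts together
with C1 and C2 (`windowCount_mul_log_add_penalty_le`). What remains converges to the ratio `v = G /
f₀` for a subdensity `G`, and `eventually_average_le_integral_of_cells` passes to the limit: `∫ 2
log (1 + v) f₀ ≥ 2 log 2` (`MixParamTendsto.two_mul_log_two_le_integral`). Since `∫ v f₀ ≤ 1`, the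
equality case of concavity of the logarithm forces `v = 1` almost everywhere
(`MixParamTendsto.ae_limit_eq_pdf`).

Finally `G = f₀` has to determine the mixing distribution. To the right of its location a skew
normal density is a Gaussian term plus, for finite nonzero shape, a multiple of `exp (-A (x - μ)²)
R(β (x - μ))`, with `R` the Mills ratio. Such functions are linearly independent
(`gaussian_mul_millsRatio_linearIndependent`), and opposite shapes enter with opposite signs, so
only the difference of the masses at `l` and `-l` is determined. In the absence of mirror pairs,
nonnegativity then makes the limit weights dominate the true ones; both total `1`, so they agree and
no mass escapes (`MixParamTendsto.weights_of_ae_eq`). Convergence of `D` is dominated convergence.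
-/

/-! ### The standard normal density and distribution function. -/

lemma gaussianPDFReal_zero_one (x : ℝ) :
    gaussianPDFReal 0 1 x = (√(2 * Real.pi))⁻¹ * Real.exp (-x ^ 2 / 2) := by
  simp [gaussianPDFReal]

lemma continuous_gaussianPDFReal_zero_one : Continuous (gaussianPDFReal 0 1) := by
  have : gaussianPDFReal 0 1 = fun x => (√(2 * Real.pi))⁻¹ * Real.exp (-x ^ 2 / 2) := by
    ext x; exact gaussianPDFReal_zero_one x
  rw [this]; fun_prop

lemma two_mul_gaussianPDFReal_zero_one_le (x : ℝ) :
    2 * gaussianPDFReal 0 1 x ≤ Real.exp (-x ^ 2 / 2) := by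
  have h2 : (2 : ℝ) ≤ √(2 * Real.pi) :=
    Real.le_sqrt_of_sq_le (by nlinarith [Real.pi_gt_three])
  rw [gaussianPDFReal_zero_one, ← mul_assoc, ← div_eq_mul_inv]
  exact mul_le_of_le_one_left (Real.exp_nonneg _) ((div_le_one (by linarith)).2 h2)

lemma inv_mul_gaussianPDFReal_div {σ : ℝ} (hσ : 0 < σ) (μ x : ℝ) :
    1 / σ * gaussianPDFReal 0 1 ((x - μ) / σ) = gaussianPDFReal μ (σ ^ 2).toNNReal x := by
  rw [gaussianPDFReal_zero_one, gaussianPDFReal, Real.coe_toNNReal _ (sq_nonneg σ),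
    Real.sqrt_mul (by positivity : (0 : ℝ) ≤ 2 * Real.pi), Real.sqrt_sq hσ.le]
  have : -((x - μ) / σ) ^ 2 / 2 = -(x - μ) ^ 2 / (2 * σ ^ 2) := by field_simp
  rw [this]
  field_simp

lemma cdf_std_eq_integral (s : ℝ) :
    cdf (gaussianReal 0 1) s = ∫ x in Set.Iic s, gaussianPDFReal 0 1 x := by
  rw [cdf_eq_real, measureReal_def, gaussianReal_apply_eq_integral 0 one_ne_zero,
    ENNReal.toReal_ofReal (integral_nonneg fun x => gaussianPDFReal_nonneg _ _ _)]

lemma continuous_cdf_std : Continuous (cdf (gaussianReal 0 1)) := by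
  have : (fun s => cdf (gaussianReal 0 1) s) =
      fun s => cdf (gaussianReal 0 1) 0 + ∫ x in (0 : ℝ)..s, gaussianPDFReal 0 1 x := by
    ext s
    have hi := integrable_gaussianPDFReal 0 1
    rw [cdf_std_eq_integral, cdf_std_eq_integral,
      ← intervalIntegral.integral_Iic_sub_Iic hi.integrableOn hi.integrableOn]
    ring
  change Continuous (fun s => cdf (gaussianReal 0 1) s)
  rw [this]
  exact continuous_const.add (intervalIntegral.continuous_primitive
    (fun a b => (integrable_gaussianPDFReal 0 1).intervalIntegrable) 0)

lemma cdf_std_neg (s : ℝ) : cdf (gaussianReal 0 1) (-s) = 1 - cdf (gaussianReal 0 1) s := by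
  have h : (gaussianReal 0 1).real (Set.Iic (-s)) = (gaussianReal 0 1).real (Set.Ici s) := by
    have h1 : (gaussianReal 0 1).map (fun x => -x) = gaussianReal 0 1 := by
      rw [gaussianReal_map_neg, neg_zero]
    conv_rhs => rw [← h1]
    rw [map_measureReal_apply measurable_neg measurableSet_Ici]
    congr 1
    ext x
    simp
  have := nullSingletonClass_gaussianReal (μ := 0) (v := 1) one_ne_zero
  rw [cdf_eq_real, cdf_eq_real, h, measureReal_congr (Ioi_ae_eq_Ici (a := s)).symm,
    ← Set.compl_Iic, probReal_compl_eq_one_sub measurableSet_Iic]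

/-- The Mills ratio `∫₀^∞ exp(-zu - u²/2) du` of the standard normal law. -/
def millsRatio (z : ℝ) : ℝ := ∫ u in Set.Ioi (0 : ℝ), Real.exp (-z * u - u ^ 2 / 2)

/-- Substitute `x = s + u` in the tail integral and factor out `exp (-s²/2)`. -/
lemma one_sub_cdf_std (s : ℝ) : 1 - cdf (gaussianReal 0 1) s =
    (√(2 * Real.pi))⁻¹ * Real.exp (-s ^ 2 / 2) * millsRatio s := by
  have hi := integrable_gaussianPDFReal 0 1
  have h1 : 1 - cdf (gaussianReal 0 1) s = ∫ x in Set.Ioi s, gaussianPDFReal 0 1 x := by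
    rw [cdf_std_eq_integral, ← integral_gaussianPDFReal_eq_one 0 (one_ne_zero),
      ← intervalIntegral.integral_Iic_add_Ioi hi.integrableOn hi.integrableOn (b := s)]
    ring
  rw [h1, millsRatio, ← integral_const_mul]
  have h2 := (measurePreserving_add_right volume s).setIntegral_preimage_emb
    (measurableEmbedding_addRight s) (gaussianPDFReal 0 1) (Set.Ioi s)
  rw [Set.preimage_add_const_Ioi, sub_self] at h2
  rw [← h2]
  refine integral_congr_ae (Eventually.of_forall fun u => ?_)
  simp only [gaussianPDFReal_zero_one]
  rw [mul_assoc, ← Real.exp_add]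
  ring_nf

/-- The mass of the unit interval `(s - 1, s]` alone suffices, since `x²/2 ≤ s² + 1` there. This
crude bound later gives `1 / f₀` at most the growth of `exp (C (1 + x²))`. -/
lemma exp_le_cdf_std (s : ℝ) :
    (√(2 * Real.pi))⁻¹ * Real.exp (-s ^ 2 - 1) ≤ cdf (gaussianReal 0 1) s := by
  have hi := integrable_gaussianPDFReal 0 1
  rw [cdf_std_eq_integral]
  calc (√(2 * Real.pi))⁻¹ * Real.exp (-s ^ 2 - 1)
      = ∫ x in Set.Ioc (s - 1) s, (√(2 * Real.pi))⁻¹ * Real.exp (-s ^ 2 - 1) := by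
        simp
    _ ≤ ∫ x in Set.Ioc (s - 1) s, gaussianPDFReal 0 1 x := by
        refine setIntegral_mono_on (integrableOn_const (by simp)) hi.integrableOn
          measurableSet_Ioc fun x hx => ?_
        rw [gaussianPDFReal_zero_one]
        refine mul_le_mul_of_nonneg_left (Real.exp_le_exp.2 ?_) (by positivity)
        nlinarith [hx.1, hx.2, mul_nonneg (sub_nonneg.2 hx.2) (sub_nonneg.2 hx.1.le),
          sq_nonneg (s - 1), sq_nonneg (s + 1), sq_nonneg (2 * s - x)]
    _ ≤ _ := by
        refine setIntegral_mono_set hi.integrableOn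
          (Eventually.of_forall fun x => gaussianPDFReal_nonneg _ _ _) ?_
        exact (Set.Ioc_subset_Iic_self).eventuallyLE

lemma cdf_std_pos (s : ℝ) : 0 < cdf (gaussianReal 0 1) s :=
  lt_of_lt_of_le (by positivity) (exp_le_cdf_std s)

/-! ### Skew normal densities with shape in the extended line. -/

/-- The standard normal distribution function on the extended line. -/
def extCDF (z : EReal) : ℝ :=
  if z = ⊤ then 1 else if z = ⊥ then 0 else cdf (gaussianReal 0 1) z.toReal

@[simp] lemma extCDF_coe (s : ℝ) : extCDF s = cdf (gaussianReal 0 1) s := by simp [extCDF]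
@[simp] lemma extCDF_top : extCDF ⊤ = 1 := by simp [extCDF]
@[simp] lemma extCDF_bot : extCDF ⊥ = 0 := by simp [extCDF]

lemma extCDF_nonneg (z : EReal) : 0 ≤ extCDF z := by
  induction z <;> simp [cdf_nonneg]

lemma extCDF_le_one (z : EReal) : extCDF z ≤ 1 := by
  induction z <;> simp [cdf_le_one]

lemma extCDF_neg (z : EReal) : extCDF (-z) = 1 - extCDF z := by
  induction z
  · simp
  · rw [← EReal.coe_neg, extCDF_coe, extCDF_coe, cdf_std_neg]
  · simp

lemma monotone_extCDF : Monotone extCDF := by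
  intro y z h
  induction y
  · simpa using extCDF_nonneg z
  · induction z
    · simp at h
    · simpa using monotone_cdf _ (EReal.coe_le_coe_iff.1 h)
    · simpa using cdf_le_one _ _
  · simp [top_le_iff.1 h]

lemma continuous_extCDF : Continuous extCDF := by
  rw [continuous_iff_continuousAt]
  have htop : ContinuousAt extCDF ⊤ := by
    rw [ContinuousAt, extCDF_top, tendsto_order]
    refine ⟨fun a ha => ?_, fun a ha => Eventually.of_forall fun z => (extCDF_le_one z).trans_lt ha⟩
    obtain ⟨M, hM⟩ := (((tendsto_order.1 (tendsto_cdf_atTop (gaussianReal 0 1))).1 a ha)).exists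
    filter_upwards [Ioi_mem_nhds (EReal.coe_lt_top M)] with z hz
    exact hM.trans_le (by simpa using monotone_extCDF (le_of_lt hz))
  intro z
  induction z
  · have h1 : extCDF = fun z => 1 - extCDF (-z) := by ext z; rw [extCDF_neg]; ring
    rw [h1]
    refine continuousAt_const.sub (ContinuousAt.comp (g := extCDF)
      (f := fun z => -z) ?_ continuous_neg.continuousAt)
    simpa using htop
  · rename_i r
    rw [ContinuousAt, EReal.nhds_coe, tendsto_map'_iff]
    simpa [Function.comp_def] using continuous_cdf_std.tendsto r
  · exact htop

/-- The skew normal density with shape parameter in the extended line; shapes `±∞` give the two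
half-normal densities. -/
def extSkewNormalPDF (μ σ : ℝ) (l : EReal) (x : ℝ) : ℝ :=
  2 / σ * gaussianPDFReal 0 1 ((x - μ) / σ) * extCDF (l * ((x - μ) / σ : ℝ))

lemma extSkewNormalPDF_coe (μ σ l x : ℝ) :
    extSkewNormalPDF μ σ l x = skewNormalPDF μ σ l x := by
  rw [extSkewNormalPDF, skewNormalPDF, ← EReal.coe_mul, extCDF_coe]

lemma extSkewNormalPDF_nonneg {σ : ℝ} (hσ : 0 < σ) (μ : ℝ) (l : EReal) (x : ℝ) :
    0 ≤ extSkewNormalPDF μ σ l x :=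
  mul_nonneg (mul_nonneg (by positivity) (gaussianPDFReal_nonneg _ _ _)) (extCDF_nonneg _)

lemma extSkewNormalPDF_le {σ : ℝ} (hσ : 0 < σ) (μ : ℝ) (l : EReal) (x : ℝ) :
    extSkewNormalPDF μ σ l x ≤ 1 / σ * Real.exp (-((x - μ) / σ) ^ 2 / 2) := by
  have h0 : 0 ≤ 2 / σ * gaussianPDFReal 0 1 ((x - μ) / σ) :=
    mul_nonneg (by positivity) (gaussianPDFReal_nonneg _ _ _)
  refine (mul_le_of_le_one_right h0 (extCDF_le_one _)).trans ?_
  have := mul_le_mul_of_nonneg_left (two_mul_gaussianPDFReal_zero_one_le ((x - μ) / σ))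
    (by positivity : 0 ≤ 1 / σ)
  calc _ = 1 / σ * (2 * gaussianPDFReal 0 1 ((x - μ) / σ)) := by ring
    _ ≤ _ := this

lemma extSkewNormalPDF_le_inv {σ : ℝ} (hσ : 0 < σ) (μ : ℝ) (l : EReal) (x : ℝ) :
    extSkewNormalPDF μ σ l x ≤ 1 / σ := by
  refine (extSkewNormalPDF_le hσ μ l x).trans (mul_le_of_le_one_right (by positivity) ?_)
  exact Real.exp_le_one_iff.2 (by nlinarith [sq_nonneg ((x - μ) / σ)])

lemma measurable_extSkewNormalPDF (μ σ : ℝ) (l : EReal) : Measurable (extSkewNormalPDF μ σ l) := by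
  unfold extSkewNormalPDF
  refine Measurable.mul (Measurable.mul measurable_const
    ((measurable_gaussianPDFReal 0 1).comp (by fun_prop))) ?_
  refine continuous_extCDF.measurable.comp ?_
  have : Measurable fun x : ℝ => (((x - μ) / σ : ℝ) : EReal) :=
    measurable_coe_real_ereal.comp (by fun_prop)
  exact measurable_const.mul this

/-- Reflection at `μ` turns `Φ(z)` into `1 - Φ(z)`, also for infinite shapes. Hence the total mass
is `1` for every shape, and the density is at most twice a Gaussian one. -/
lemma extSkewNormalPDF_add_reflect {σ : ℝ} (hσ : 0 < σ) (μ : ℝ) (l : EReal) (x : ℝ) :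
    extSkewNormalPDF μ σ l x + extSkewNormalPDF μ σ l (2 * μ - x) =
      2 * gaussianPDFReal μ (σ ^ 2).toNNReal x := by
  have h1 : (2 * μ - x - μ) / σ = -((x - μ) / σ) := by ring
  have h2 : gaussianPDFReal 0 1 (-((x - μ) / σ)) = gaussianPDFReal 0 1 ((x - μ) / σ) := by
    simp [gaussianPDFReal_zero_one]
  rw [extSkewNormalPDF, extSkewNormalPDF, h1, EReal.coe_neg, mul_neg, extCDF_neg, h2,
    ← inv_mul_gaussianPDFReal_div hσ]
  ring

lemma lintegral_extSkewNormalPDF {σ : ℝ} (hσ : 0 < σ) (μ : ℝ) (l : EReal) :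
    ∫⁻ x, ENNReal.ofReal (extSkewNormalPDF μ σ l x) = 1 := by
  have hm : Measurable fun x => ENNReal.ofReal (extSkewNormalPDF μ σ l x) :=
    (measurable_extSkewNormalPDF μ σ l).ennreal_ofReal
  have h1 : ∫⁻ x, ENNReal.ofReal (extSkewNormalPDF μ σ l (2 * μ - x)) =
      ∫⁻ x, ENNReal.ofReal (extSkewNormalPDF μ σ l x) :=
    lintegral_sub_left_eq_self (μ := volume)
      (fun x => ENNReal.ofReal (extSkewNormalPDF μ σ l x)) (2 * μ)
  have h2 : 2 * ∫⁻ x, ENNReal.ofReal (extSkewNormalPDF μ σ l x) = 2 := by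
    conv_lhs => rw [two_mul]
    nth_rw 2 [← h1]
    rw [← lintegral_add_left hm]
    have hv : (σ ^ 2).toNNReal ≠ 0 := by
      simpa using hσ.ne'
    calc _ = ∫⁻ x, 2 * ENNReal.ofReal (gaussianPDFReal μ (σ ^ 2).toNNReal x) := by
          refine lintegral_congr fun x => ?_
          rw [← ENNReal.ofReal_add (extSkewNormalPDF_nonneg hσ _ _ _)
            (extSkewNormalPDF_nonneg hσ _ _ _), extSkewNormalPDF_add_reflect hσ,
            ENNReal.ofReal_mul zero_le_two, ENNReal.ofReal_ofNat]
      _ = 2 := by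
          rw [lintegral_const_mul _ (measurable_gaussianPDFReal _ _).ennreal_ofReal,
            lintegral_gaussianPDFReal_eq_one μ hv, mul_one]
  have h3 : (2 : ENNReal) * ∫⁻ x, ENNReal.ofReal (extSkewNormalPDF μ σ l x) = 2 * 1 := by
    rw [h2, mul_one]
  exact (ENNReal.mul_right_inj two_ne_zero ENNReal.ofNat_ne_top).1 h3

/-- Joint continuity of the skew normal density, away from a jump at the location. -/
lemma tendsto_extSkewNormalPDF {α : Type*} {F : Filter α} {m s x : α → ℝ} {l : α → EReal}
    {μ σ y : ℝ} {L : EReal} (hσ : 0 < σ) (hm : Tendsto m F (𝓝 μ)) (hs : Tendsto s F (𝓝 σ))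
    (hl : Tendsto l F (𝓝 L)) (hx : Tendsto x F (𝓝 y)) (hy : y ≠ μ) :
    Tendsto (fun i => extSkewNormalPDF (m i) (s i) (l i) (x i)) F
      (𝓝 (extSkewNormalPDF μ σ L y)) := by
  have ht : Tendsto (fun i => (x i - m i) / s i) F (𝓝 ((y - μ) / σ)) :=
    (hx.sub hm).div hs hσ.ne'
  have ht0 : (y - μ) / σ ≠ 0 := div_ne_zero (sub_ne_zero.2 hy) hσ.ne'
  refine ((tendsto_const_nhds.div hs hσ.ne').mul
    ((continuous_gaussianPDFReal_zero_one.tendsto _).comp ht)).mul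
    ((continuous_extCDF.tendsto _).comp ?_)
  have hte : Tendsto (fun i => (((x i - m i) / s i : ℝ) : EReal)) F
      (𝓝 (((y - μ) / σ : ℝ) : EReal)) := (continuous_coe_real_ereal.tendsto _).comp ht
  -- Multiplication on the extended line is discontinuous only at `0 · ±∞`, which `y ≠ μ` excludes.
  have hc := EReal.continuousAt_mul (p := (L, (((y - μ) / σ : ℝ) : EReal)))
    (by right; simp) (by right; simp)
    (by right; simpa using ht0) (by right; simpa using ht0)
  exact hc.tendsto.comp (hl.prodMk_nhds hte)

/-! ### Asymptotic expansion of the Mills ratio. -/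

/-- The Taylor polynomials of `exp (-v)` alternately under- and overestimate it for `v ≥ 0`. -/
lemma exp_neg_sub_taylor_sign (m : ℕ) {v : ℝ} (hv : 0 ≤ v) :
    0 ≤ (-1) ^ m * (Real.exp (-v) - ∑ i ∈ Finset.range m, (-v) ^ i / i.factorial) := by
  induction m generalizing v with
  | zero => simpa using Real.exp_nonneg _
  | succ m ih =>
    set r : ℝ → ℝ := fun v => (-1) ^ (m + 1) *
      (Real.exp (-v) - ∑ i ∈ Finset.range (m + 1), (-v) ^ i / i.factorial) with hr
    -- The signed remainder of order `m + 1` has the one of order `m` as derivative and vanishes at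
    -- `0`.
    have hd : ∀ v, HasDerivAt r ((-1) ^ m *
        (Real.exp (-v) - ∑ i ∈ Finset.range m, (-v) ^ i / i.factorial)) v := by
      intro v
      have h1 : HasDerivAt (fun v : ℝ => ∑ i ∈ Finset.range (m + 1), (-v) ^ i / i.factorial)
          (-∑ i ∈ Finset.range m, (-v) ^ i / i.factorial) v := by
        have h2 : ∀ i ∈ Finset.range (m + 1), HasDerivAt
            (fun v : ℝ => (-v) ^ i / i.factorial) (i * (-v) ^ (i - 1) * (-1) / i.factorial) v :=
          fun i _ => (((hasDerivAt_id v).neg).pow i).div_const _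
        refine (HasDerivAt.fun_sum h2).congr_deriv ?_
        rw [Finset.sum_range_succ', ← Finset.sum_neg_distrib]
        simp only [Nat.cast_zero, zero_mul, zero_div, add_zero]
        refine Finset.sum_congr rfl fun i _ => ?_
        rw [Nat.factorial_succ]
        have : (i.factorial : ℝ) ≠ 0 := by positivity
        push_cast
        field_simp
      have h3 : HasDerivAt (fun v : ℝ => Real.exp (-v)) (-Real.exp (-v)) v := by
        simpa using (hasDerivAt_id v).neg.exp
      refine ((h3.sub h1).const_mul _).congr_deriv ?_
      rw [pow_succ]; ring
    have hmono : MonotoneOn r (Set.Ici 0) := by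
      refine monotoneOn_of_deriv_nonneg (convex_Ici 0)
        (fun v _ => (hd v).continuousAt.continuousWithinAt)
        (fun v _ => (hd v).differentiableAt.differentiableWithinAt) fun v h => ?_
      rw [(hd v).deriv]
      exact ih (by simpa using (interior_subset h))
    have h0 : r 0 = 0 := by
      simp only [hr, Finset.sum_range_succ']
      simp
    have := hmono (Set.mem_Ici.2 le_rfl) hv hv
    rwa [h0] at this

/-- Consecutive remainders have opposite signs, so each is at most the first omitted term in
absolute value. -/
lemma abs_exp_neg_sub_taylor_le (m : ℕ) {v : ℝ} (hv : 0 ≤ v) :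
    |Real.exp (-v) - ∑ i ∈ Finset.range m, (-v) ^ i / i.factorial| ≤ v ^ m / m.factorial := by
  have h1 := exp_neg_sub_taylor_sign m hv
  have h2 := exp_neg_sub_taylor_sign (m + 1) hv
  rw [Finset.sum_range_succ] at h2
  set r := Real.exp (-v) - ∑ i ∈ Finset.range m, (-v) ^ i / i.factorial
  have h3 : |r| = (-1) ^ m * r := by
    rw [← abs_of_nonneg h1, abs_mul, abs_pow]; simp
  have h4 : ((-1 : ℝ) ^ m) * (-v) ^ m = v ^ m := by rw [← mul_pow]; simp
  rw [h3, ← h4]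
  rw [pow_succ, ← sub_sub] at h2
  have : (-1) ^ m * (-1) * (r - (-v) ^ m / m.factorial) =
      (-1) ^ m * (-v) ^ m / m.factorial - (-1) ^ m * r := by ring
  linarith

lemma integral_pow_mul_exp_neg_mul (k : ℕ) {z : ℝ} (hz : 0 < z) :
    IntegrableOn (fun u : ℝ => u ^ k * Real.exp (-z * u)) (Set.Ioi 0) ∧
    ∫ u in Set.Ioi (0 : ℝ), u ^ k * Real.exp (-z * u) = k.factorial * (z⁻¹) ^ (k + 1) := by
  constructor
  · have := integrableOn_rpow_mul_exp_neg_mul_rpow (s := k) (p := 1) (b := z)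
      (by have : (0 : ℝ) ≤ k := Nat.cast_nonneg k
          linarith) zero_lt_one hz
    simpa using this
  · have := Real.integral_rpow_mul_exp_neg_mul_Ioi (a := k + 1) (r := z) (by positivity) hz
    rw [Real.Gamma_nat_eq_factorial] at this
    simp only [add_sub_cancel_right, Real.rpow_natCast, one_div] at this
    rw [mul_comm, ← Real.rpow_natCast z⁻¹]
    push_cast
    rw [← this]
    refine setIntegral_congr_fun measurableSet_Ioi fun u _ => ?_
    simp

/-- The coefficients of the asymptotic expansion of the Mills ratio. -/
def millsCoeff (i : ℕ) : ℝ := (-1) ^ i * ((2 * i).factorial / (2 ^ i * i.factorial))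

lemma millsCoeff_ne_zero (i : ℕ) : millsCoeff i ≠ 0 := by unfold millsCoeff; positivity

lemma integrableOn_millsRatio {z : ℝ} (hz : 0 ≤ z) :
    IntegrableOn (fun u => Real.exp (-z * u - u ^ 2 / 2)) (Set.Ioi 0) := by
  have h1 : Integrable (fun u : ℝ => Real.exp (-(1 / 2) * u ^ 2)) :=
    integrable_exp_neg_mul_sq (by norm_num)
  refine h1.integrableOn.mono' (by fun_prop) ((ae_restrict_iff' measurableSet_Ioi).2
    (Eventually.of_forall fun u hu => ?_))
  rw [Real.norm_of_nonneg (Real.exp_nonneg _)]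
  have hu' : 0 < u := hu
  exact Real.exp_le_exp.2 (by nlinarith [mul_nonneg hz hu'.le])

/-- Expand `exp (-u²/2)` in powers of `u²/2` under the integral and integrate term by term against
`exp (-z u)`; the Taylor error integrates to the same kind of Gamma integral. -/
lemma abs_millsRatio_sub_le (m : ℕ) {z : ℝ} (hz : 0 < z) :
    |millsRatio z - ∑ i ∈ Finset.range m, millsCoeff i * (z⁻¹) ^ (2 * i + 1)| ≤
      (2 * m).factorial / (2 ^ m * m.factorial) * (z⁻¹) ^ (2 * m + 1) := by
  have hint : ∀ i : ℕ, IntegrableOn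
      (fun u : ℝ => (-(u ^ 2 / 2)) ^ i / i.factorial * Real.exp (-z * u)) (Set.Ioi 0) ∧
      ∫ u in Set.Ioi (0 : ℝ), (-(u ^ 2 / 2)) ^ i / i.factorial * Real.exp (-z * u) =
        millsCoeff i * (z⁻¹) ^ (2 * i + 1) := by
    intro i
    have h := integral_pow_mul_exp_neg_mul (2 * i) hz
    have he : (fun u : ℝ => (-(u ^ 2 / 2)) ^ i / i.factorial * Real.exp (-z * u)) =
        fun u => ((-1) ^ i / (2 ^ i * i.factorial)) * (u ^ (2 * i) * Real.exp (-z * u)) := by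
      ext u
      rw [neg_pow, div_pow, ← pow_mul]
      field_simp
    rw [he]
    refine ⟨h.1.const_mul _, ?_⟩
    rw [integral_const_mul, h.2, millsCoeff]
    ring
  have hsum : ∑ i ∈ Finset.range m, millsCoeff i * (z⁻¹) ^ (2 * i + 1) =
      ∫ u in Set.Ioi (0 : ℝ), ∑ i ∈ Finset.range m,
        (-(u ^ 2 / 2)) ^ i / i.factorial * Real.exp (-z * u) := by
    rw [integral_finsetSum _ fun i _ => (hint i).1]
    exact Finset.sum_congr rfl fun i _ => (hint i).2.symm
  rw [hsum, millsRatio, ← integral_sub (integrableOn_millsRatio hz.le)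
    (integrable_finsetSum _ fun i _ => (hint i).1), ← Real.norm_eq_abs]
  have h := integral_pow_mul_exp_neg_mul (2 * m) hz
  have : (2 * m).factorial / (2 ^ m * m.factorial) * (z⁻¹) ^ (2 * m + 1) =
      ∫ u in Set.Ioi (0 : ℝ), 1 / (2 ^ m * m.factorial) * (u ^ (2 * m) * Real.exp (-z * u)) := by
    rw [integral_const_mul, h.2]; ring
  rw [this]
  refine norm_integral_le_of_norm_le (h.1.const_mul _)
    (Eventually.of_forall fun u => ?_)
  have h5 : Real.exp (-z * u - u ^ 2 / 2) = Real.exp (-(u ^ 2 / 2)) * Real.exp (-z * u) := by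
    rw [← Real.exp_add]; ring_nf
  rw [h5, ← Finset.sum_mul, ← sub_mul, norm_mul, Real.norm_of_nonneg (Real.exp_nonneg (-z * u)),
    ← mul_assoc]
  refine mul_le_mul_of_nonneg_right ?_ (Real.exp_nonneg _)
  refine (abs_exp_neg_sub_taylor_le m (by positivity)).trans_eq ?_
  rw [div_pow, ← pow_mul]
  field_simp

lemma tendsto_pow_mul_millsRatio_sub (m : ℕ) :
    Tendsto (fun z => z ^ (2 * m + 1) *
      (millsRatio z - ∑ i ∈ Finset.range m, millsCoeff i * (z⁻¹) ^ (2 * i + 1))) atTop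
      (𝓝 (millsCoeff m)) := by
  set C : ℝ := (2 * (m + 1)).factorial / (2 ^ (m + 1) * (m + 1).factorial)
  rw [tendsto_iff_norm_sub_tendsto_zero]
  have hlim : Tendsto (fun z : ℝ => C * (z⁻¹) ^ 2) atTop (𝓝 0) := by
    simpa using (tendsto_inv_atTop_zero.pow 2).const_mul C
  refine squeeze_zero' (Eventually.of_forall fun _ => norm_nonneg _) ?_ hlim
  filter_upwards [eventually_gt_atTop 0] with z hz
  -- The error bound is used one order higher, so that the term of order `m` is isolated and the
  -- rest is `O(z⁻²)`.
  have h := abs_millsRatio_sub_le (m + 1) hz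
  rw [Finset.sum_range_succ] at h
  have e1 : z ^ (2 * m + 1) * (millsRatio z - ∑ i ∈ Finset.range m,
      millsCoeff i * (z⁻¹) ^ (2 * i + 1)) - millsCoeff m = z ^ (2 * m + 1) * (millsRatio z -
      (∑ i ∈ Finset.range m, millsCoeff i * (z⁻¹) ^ (2 * i + 1) +
        millsCoeff m * (z⁻¹) ^ (2 * m + 1))) := by
    have : z ^ (2 * m + 1) * (z⁻¹) ^ (2 * m + 1) = 1 := by
      rw [← mul_pow, mul_inv_cancel₀ hz.ne', one_pow]
    linear_combination millsCoeff m * this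
  rw [e1, Real.norm_eq_abs, abs_mul, abs_of_pos (by positivity)]
  refine (mul_le_mul_of_nonneg_left h (by positivity)).trans_eq ?_
  have : z ^ (2 * m + 1) * (z⁻¹) ^ (2 * m + 1) = 1 := by
    rw [← mul_pow, mul_inv_cancel₀ hz.ne', one_pow]
  have e2 : (z⁻¹) ^ (2 * (m + 1) + 1) = (z⁻¹) ^ (2 * m + 1) * (z⁻¹) ^ 2 := by ring
  rw [e2]
  linear_combination C * (z⁻¹) ^ 2 * this

lemma millsRatio_pos {z : ℝ} (hz : 0 ≤ z) : 0 < millsRatio z := by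
  have : 0 < ∫ u in Set.Ioi (0 : ℝ), Real.exp (-z * u - u ^ 2 / 2) := by
    refine (setIntegral_pos_iff_support_of_nonneg_ae
      (Eventually.of_forall fun _ => Real.exp_nonneg _) (integrableOn_millsRatio hz)).2 ?_
    have : Function.support (fun u => Real.exp (-z * u - u ^ 2 / 2)) = Set.univ := by
      ext u; simp [Real.exp_ne_zero]
    rw [this]; simp
  exact this

lemma millsRatio_le_zero {z : ℝ} (hz : 0 ≤ z) : millsRatio z ≤ millsRatio 0 := by
  refine setIntegral_mono_on (integrableOn_millsRatio hz) (integrableOn_millsRatio le_rfl)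
    measurableSet_Ioi fun u hu => Real.exp_le_exp.2 ?_
  have hu' : 0 < u := hu
  nlinarith [mul_nonneg hz hu'.le]

lemma tendsto_millsRatio : Tendsto millsRatio atTop (𝓝 0) := by
  have h := (tendsto_pow_mul_millsRatio_sub 0).mul (tendsto_inv_atTop_zero (𝕜 := ℝ))
  rw [mul_zero (millsCoeff 0)] at h
  refine h.congr' ?_
  filter_upwards [eventually_gt_atTop 0] with z hz
  simp
  field_simp

/-! ### Linear independence of Gaussian factors times Mills ratios. -/

/-- A combination of the functions `y ↦ R(βy)`, with `R` the Mills ratio and `β ≥ 0`, that decays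
faster than every power is trivial. -/
lemma millsRatio_comb_eq_zero (B : Finset ℝ) (hB : ∀ β ∈ B, 0 ≤ β) (d : ℝ → ℝ)
    (h : ∀ k : ℕ, Tendsto (fun y => y ^ k * ∑ β ∈ B, d β * millsRatio (β * y)) atTop (𝓝 0)) :
    ∀ β ∈ B, d β = 0 := by
  have hy : ∀ β : ℝ, 0 < β → Tendsto (fun y : ℝ => β * y) atTop atTop :=
    fun β hβ => tendsto_id.const_mul_atTop hβ
  -- the coefficient at `0`
  have h0 : (0 : ℝ) ∈ B → d 0 = 0 := by
    intro h0B
    have h1 : Tendsto (fun y => ∑ β ∈ B, d β * millsRatio (β * y)) atTop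
        (𝓝 (∑ β ∈ B, if β = 0 then d β * millsRatio 0 else 0)) := by
      refine tendsto_finsetSum _ fun β hβ => ?_
      by_cases hb : β = 0
      · simp [hb]
      · rw [if_neg hb]
        simpa using (tendsto_millsRatio.comp
          (hy β (lt_of_le_of_ne (hB β hβ) (Ne.symm hb)))).const_mul (d β)
    have h2 := tendsto_nhds_unique h1 (by simpa using h 0)
    rw [Finset.sum_ite_eq' B 0 (fun β => d β * millsRatio 0), if_pos h0B] at h2
    exact (mul_eq_zero.1 h2).resolve_right (millsRatio_pos le_rfl).ne'
  set B' := B.filter (fun β => 0 < β) with hB'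
  have hpos : ∀ β ∈ B', 0 < β := fun β hβ => (Finset.mem_filter.1 hβ).2
  have hsum : ∀ y, ∑ β ∈ B, d β * millsRatio (β * y) = ∑ β ∈ B', d β * millsRatio (β * y) := by
    intro y
    rw [hB', Finset.sum_filter]
    refine Finset.sum_congr rfl fun β hβ => ?_
    split_ifs with hb
    · rfl
    · have : β = 0 := le_antisymm (not_lt.1 hb) (hB β hβ)
      subst this
      rw [h0 hβ, zero_mul]
  simp only [hsum] at h
  -- Induction on the order of the expansion: once the lower coefficients vanish, multiplying by `y
  -- ^ (2m + 1)` and letting `y → ∞` isolates the coefficient of order `m`.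
  have hS : ∀ m : ℕ, ∑ β ∈ B', d β * (β⁻¹) ^ (2 * m + 1) = 0 := by
    intro m
    induction m using Nat.strong_induction_on with
    | _ m ih =>
    have h1 : Tendsto (fun y : ℝ => ∑ β ∈ B', d β * (β⁻¹) ^ (2 * m + 1) *
        ((β * y) ^ (2 * m + 1) * (millsRatio (β * y) - ∑ i ∈ Finset.range m,
          millsCoeff i * ((β * y)⁻¹) ^ (2 * i + 1)))) atTop
        (𝓝 (∑ β ∈ B', d β * (β⁻¹) ^ (2 * m + 1) * millsCoeff m)) :=
      tendsto_finsetSum _ fun β hβ =>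
        ((tendsto_pow_mul_millsRatio_sub m).comp (hy β (hpos β hβ))).const_mul _
    have h2 : ∀ y : ℝ, ∑ β ∈ B', d β * (β⁻¹) ^ (2 * m + 1) *
        ((β * y) ^ (2 * m + 1) * (millsRatio (β * y) - ∑ i ∈ Finset.range m,
          millsCoeff i * ((β * y)⁻¹) ^ (2 * i + 1))) =
        y ^ (2 * m + 1) * ∑ β ∈ B', d β * millsRatio (β * y) := by
      intro y
      have e1 : ∀ β ∈ B', d β * (β⁻¹) ^ (2 * m + 1) *
          ((β * y) ^ (2 * m + 1) * (millsRatio (β * y) - ∑ i ∈ Finset.range m,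
            millsCoeff i * ((β * y)⁻¹) ^ (2 * i + 1))) =
          y ^ (2 * m + 1) * (d β * millsRatio (β * y)) - ∑ i ∈ Finset.range m,
            y ^ (2 * m + 1) * millsCoeff i * (y⁻¹) ^ (2 * i + 1) *
              (d β * (β⁻¹) ^ (2 * i + 1)) := by
        intro β hβ
        have hb := (hpos β hβ).ne'
        have e2 : (β⁻¹) ^ (2 * m + 1) * (β * y) ^ (2 * m + 1) = y ^ (2 * m + 1) := by
          rw [← mul_pow, inv_mul_cancel_left₀ hb]
        have e3 : ∑ i ∈ Finset.range m, y ^ (2 * m + 1) * millsCoeff i * (y⁻¹) ^ (2 * i + 1) *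
              (d β * (β⁻¹) ^ (2 * i + 1)) = y ^ (2 * m + 1) * d β * ∑ i ∈ Finset.range m,
              millsCoeff i * ((β * y)⁻¹) ^ (2 * i + 1) := by
          rw [Finset.mul_sum]
          refine Finset.sum_congr rfl fun i _ => ?_
          rw [mul_inv, mul_pow]; ring
        rw [e3, ← e2]; ring
      rw [Finset.sum_congr rfl e1, Finset.sum_sub_distrib, Finset.sum_comm, Finset.mul_sum,
        sub_eq_self]
      refine Finset.sum_eq_zero fun i hi => ?_
      rw [← Finset.mul_sum, ih i (Finset.mem_range.1 hi), mul_zero]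
    simp only [h2] at h1
    have h3 := tendsto_nhds_unique h1 (h (2 * m + 1))
    rw [← Finset.sum_mul] at h3
    exact (mul_eq_zero.1 h3).resolve_right (millsCoeff_ne_zero m)
  -- polynomials in `β⁻²` separate the points of `B'`
  have hP : ∀ P : Polynomial ℝ, ∑ β ∈ B', d β * β⁻¹ * P.eval ((β⁻¹) ^ 2) = 0 := by
    intro P
    simp only [Polynomial.eval_eq_sum_range, Finset.mul_sum]
    rw [Finset.sum_comm]
    refine Finset.sum_eq_zero fun i _ => ?_
    rw [← mul_zero (P.coeff i), ← hS i, Finset.mul_sum]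
    refine Finset.sum_congr rfl fun β _ => ?_
    rw [← pow_mul, pow_succ]; ring
  intro β hβ
  by_cases hb : β = 0
  · rw [hb] at hβ ⊢; exact h0 hβ
  have hβ' : β ∈ B' := Finset.mem_filter.2 ⟨hβ, lt_of_le_of_ne (hB β hβ) (Ne.symm hb)⟩
  -- The Lagrange-type polynomial that vanishes at `γ⁻²` for every other `γ` in `B'`.
  have h4 := hP (∏ γ ∈ B'.erase β, (Polynomial.X - Polynomial.C ((γ⁻¹) ^ 2)))
  rw [Finset.sum_eq_single_of_mem β hβ'] at h4
  · rw [Polynomial.eval_prod] at h4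
    rcases mul_eq_zero.1 h4 with h5 | h5
    · exact (mul_eq_zero.1 h5).resolve_right (inv_ne_zero hb)
    · obtain ⟨γ, hγ, h6⟩ := Finset.prod_eq_zero_iff.1 h5
      rw [Finset.mem_erase] at hγ
      simp only [Polynomial.eval_sub, Polynomial.eval_X, Polynomial.eval_C, sub_eq_zero] at h6
      have h7 := (pow_left_inj₀ (inv_nonneg.2 (hpos β hβ').le) (inv_nonneg.2 (hpos γ hγ.2).le)
        two_ne_zero).1 h6
      exact absurd (inv_injective h7).symm hγ.1
  · intro γ hγ hne
    rw [Polynomial.eval_prod, Finset.prod_eq_zero (Finset.mem_erase.2 ⟨hne, hγ⟩), mul_zero]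
    simp

/-- In both cases the exponent is eventually at most `-κ y` with `κ > 0`: either its leading
coefficient is negative, or the squares cancel and the linear term `-2 A δ y` remains. It measures a
Gaussian term relative to a more slowly decaying one. -/
lemma tendsto_pow_mul_exp_quadratic (k : ℕ) {A A₀ δ : ℝ} (hA : 0 < A)
    (h : A₀ < A ∨ A₀ = A ∧ 0 < δ) :
    Tendsto (fun y : ℝ => y ^ k * Real.exp (A₀ * y ^ 2 - A * (y + δ) ^ 2)) atTop (𝓝 0) := by
  obtain ⟨κ, hκ, hle⟩ : ∃ κ : ℝ, 0 < κ ∧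
      ∀ᶠ y : ℝ in atTop, A₀ * y ^ 2 - A * (y + δ) ^ 2 ≤ -(κ * y) := by
    rcases h with h | ⟨rfl, hδ⟩
    · refine ⟨1, one_pos, ?_⟩
      filter_upwards [eventually_ge_atTop ((1 + 2 * A * |δ|) / (A - A₀)), eventually_ge_atTop 0]
        with y hy hy0
      rw [div_le_iff₀ (sub_pos.2 h)] at hy
      nlinarith [mul_le_mul_of_nonneg_right hy hy0, mul_nonneg (mul_nonneg hA.le hy0)
        (by linarith [neg_abs_le δ] : 0 ≤ δ + |δ|), mul_nonneg hA.le (sq_nonneg δ)]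
    · refine ⟨2 * A₀ * δ, by positivity, Eventually.of_forall fun y => ?_⟩
      nlinarith [mul_nonneg hA.le (sq_nonneg δ)]
  have h1 : Tendsto (fun y : ℝ => y ^ k / Real.exp (κ * y)) atTop (𝓝 0) :=
    (isLittleO_pow_exp_pos_mul_atTop k hκ).tendsto_div_nhds_zero
  refine squeeze_zero' ?_ ?_ h1
  · filter_upwards [eventually_ge_atTop 0] with y hy
    positivity
  · filter_upwards [eventually_ge_atTop 0, hle] with y hy h2
    rw [div_eq_mul_inv, ← Real.exp_neg]
    exact mul_le_mul_of_nonneg_left (Real.exp_le_exp.2 h2) (by positivity)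

/-- The functions `x ↦ exp (-A (x - μ)²) R(β (x - μ))`, with `R` the Mills ratio, `A > 0` and
`β ≥ 0`, are linearly independent near `+∞`. -/
lemma gaussian_mul_millsRatio_linearIndependent (s : Finset (ℝ × ℝ × ℝ)) (c : ℝ × ℝ × ℝ → ℝ)
    (hA : ∀ t ∈ s, 0 < t.1) (hβ : ∀ t ∈ s, 0 ≤ t.2.2)
    (h : ∀ᶠ x in atTop, ∑ t ∈ s, c t *
      (Real.exp (-t.1 * (x - t.2.1) ^ 2) * millsRatio (t.2.2 * (x - t.2.1))) = 0) :
    ∀ t ∈ s, c t = 0 := by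
  by_contra! hne
  obtain ⟨t₁, ht₁, hct₁⟩ := hne
  set s' := s.filter (fun t => c t ≠ 0) with hs'
  -- The slowest decay belongs to the least `A` and, among those, to the greatest `μ`; hence the
  -- lexicographic minimum of `(A, -μ)`.
  obtain ⟨t₀, ht₀, hmin⟩ := Finset.exists_min_image s' (fun t => toLex (t.1, -t.2.1))
    ⟨t₁, Finset.mem_filter.2 ⟨ht₁, hct₁⟩⟩
  obtain ⟨A₀, μ₀, β₀⟩ := t₀
  have hs's : ∀ t ∈ s', t ∈ s := fun t ht => (Finset.mem_filter.1 ht).1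
  have hdom : ∀ t ∈ s', ¬ (t.1 = A₀ ∧ t.2.1 = μ₀) →
      A₀ < t.1 ∨ A₀ = t.1 ∧ 0 < μ₀ - t.2.1 := by
    intro t ht hn
    have := hmin t ht
    rw [Prod.Lex.toLex_le_toLex] at this
    rcases this with h1 | ⟨h1, h2⟩
    · exact Or.inl h1
    · refine Or.inr ⟨h1, ?_⟩
      have h3 : t.2.1 ≠ μ₀ := fun h4 => hn ⟨h1.symm, h4⟩
      simp only [neg_le_neg_iff] at h2
      exact sub_pos.2 (lt_of_le_of_ne h2 h3)
  set g := s'.filter (fun t => t.1 = A₀ ∧ t.2.1 = μ₀) with hg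
  set B := g.image (fun t => t.2.2) with hB
  have hmem : ∀ β ∈ B, (A₀, μ₀, β) ∈ s' := by
    intro β hβB
    obtain ⟨⟨a, m, b⟩, ht, rfl⟩ := Finset.mem_image.1 hβB
    obtain ⟨h1, rfl, rfl⟩ := Finset.mem_filter.1 ht
    exact h1
  have hsumg : ∀ y, ∑ β ∈ B, c (A₀, μ₀, β) * millsRatio (β * y) =
      ∑ t ∈ g, c t * millsRatio (t.2.2 * y) := by
    intro y
    rw [hB, Finset.sum_image]
    · refine Finset.sum_congr rfl fun t ht => ?_
      obtain ⟨a, m, b⟩ := t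
      obtain ⟨-, rfl, rfl⟩ := Finset.mem_filter.1 ht
      rfl
    · rintro ⟨a, m, b⟩ h1 ⟨a', m', b'⟩ h2 h3
      obtain ⟨-, rfl, rfl⟩ := Finset.mem_filter.1 h1
      obtain ⟨-, rfl, rfl⟩ := Finset.mem_filter.1 h2
      simp only at h3
      rw [h3]
  have hβ₀ : β₀ ∈ B := Finset.mem_image.2 ⟨(A₀, μ₀, β₀), Finset.mem_filter.2 ⟨ht₀, rfl, rfl⟩, rfl⟩
  refine (Finset.mem_filter.1 ht₀).2 (millsRatio_comb_eq_zero B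
    (fun β hβB => hβ _ (hs's _ (hmem β hβB))) (fun β => c (A₀, μ₀, β)) (fun k => ?_) β₀ hβ₀)
  simp only [hsumg]
  -- the remaining terms are negligible
  have hrest : Tendsto (fun y : ℝ => -∑ t ∈ s'.filter (fun t => ¬ (t.1 = A₀ ∧ t.2.1 = μ₀)),
      c t * (y ^ k * Real.exp (A₀ * y ^ 2 - t.1 * (y + (μ₀ - t.2.1)) ^ 2) *
        millsRatio (t.2.2 * (y + (μ₀ - t.2.1))))) atTop (𝓝 0) := by
    rw [← neg_zero, ← Finset.sum_const_zero
      (s := s'.filter (fun t => ¬ (t.1 = A₀ ∧ t.2.1 = μ₀)))]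
    refine (tendsto_finsetSum _ fun t ht => ?_).neg
    obtain ⟨ht, hn⟩ := Finset.mem_filter.1 ht
    rw [← mul_zero (c t)]
    refine Tendsto.const_mul _ ?_
    refine (tendsto_pow_mul_exp_quadratic k (hA t (hs's t ht))
      (hdom t ht hn)).zero_mul_isBoundedUnder_le ?_
    refine isBoundedUnder_of_eventually_le (a := millsRatio 0) ?_
    filter_upwards [eventually_ge_atTop (-(μ₀ - t.2.1))] with y hy
    have h0 : 0 ≤ t.2.2 * (y + (μ₀ - t.2.1)) := mul_nonneg (hβ t (hs's t ht)) (by linarith)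
    simp only [Function.comp_apply, Real.norm_of_nonneg (millsRatio_pos h0).le]
    exact millsRatio_le_zero h0
  refine hrest.congr' ?_
  have hev : ∀ᶠ y : ℝ in atTop, ∑ t ∈ s', c t * (Real.exp (-t.1 * (y + μ₀ - t.2.1) ^ 2) *
      millsRatio (t.2.2 * (y + μ₀ - t.2.1))) = 0 := by
    have := (tendsto_atTop_add_const_right atTop μ₀ tendsto_id).eventually h
    filter_upwards [this] with y hy
    rw [← hy, hs', Finset.sum_filter]
    refine Finset.sum_congr rfl fun t _ => ?_
    split_ifs with hc
    · rfl
    · rw [not_not] at hc; simp [hc]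
  filter_upwards [hev] with y hy
  have e0 : ∀ t : ℝ × ℝ × ℝ, c t * (y ^ k * Real.exp (A₀ * y ^ 2 - t.1 * (y + (μ₀ - t.2.1)) ^ 2) *
      millsRatio (t.2.2 * (y + (μ₀ - t.2.1)))) = y ^ k * Real.exp (A₀ * y ^ 2) *
      (c t * (Real.exp (-t.1 * (y + μ₀ - t.2.1) ^ 2) *
      millsRatio (t.2.2 * (y + μ₀ - t.2.1)))) := by
    intro t
    have : A₀ * y ^ 2 - t.1 * (y + (μ₀ - t.2.1)) ^ 2 =
      A₀ * y ^ 2 + -t.1 * (y + μ₀ - t.2.1) ^ 2 := by ring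
    rw [this, Real.exp_add, add_sub_assoc]; ring
  have e1 : y ^ k * ∑ t ∈ g, c t * millsRatio (t.2.2 * y) = ∑ t ∈ g,
      c t * (y ^ k * Real.exp (A₀ * y ^ 2 - t.1 * (y + (μ₀ - t.2.1)) ^ 2) *
      millsRatio (t.2.2 * (y + (μ₀ - t.2.1)))) := by
    rw [Finset.mul_sum]
    refine Finset.sum_congr rfl fun t ht => ?_
    obtain ⟨-, h1, h2⟩ := Finset.mem_filter.1 ht
    rw [h1, h2]; simp; ring
  rw [e1, neg_eq_iff_add_eq_zero, add_comm, hg, Finset.sum_filter_add_sum_filter_not]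
  simp only [e0]
  rw [← Finset.mul_sum, hy, mul_zero]

/-- Indexed version of linear independence: several indices may carry the same triple, so only the
sums of coefficients over fibers vanish. -/
lemma gaussian_mul_millsRatio_fiber_sum_eq_zero {ι : Type*} [Fintype ι] (τ : ι → ℝ × ℝ × ℝ)
    (e : ι → ℝ) (hA : ∀ i, 0 < (τ i).1) (hβ : ∀ i, 0 ≤ (τ i).2.2)
    (h : ∀ᶠ x in atTop, ∑ i, e i * (Real.exp (-(τ i).1 * (x - (τ i).2.1) ^ 2) *
      millsRatio ((τ i).2.2 * (x - (τ i).2.1))) = 0) (t : ℝ × ℝ × ℝ) :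
    ∑ i with τ i = t, e i = 0 := by
  classical
  by_cases ht : t ∈ Finset.univ.image τ
  · refine gaussian_mul_millsRatio_linearIndependent (Finset.univ.image τ)
      (fun t => ∑ i with τ i = t, e i) ?_ ?_ ?_ t ht
    · intro t ht
      obtain ⟨i, -, rfl⟩ := Finset.mem_image.1 ht
      exact hA i
    · intro t ht
      obtain ⟨i, -, rfl⟩ := Finset.mem_image.1 ht
      exact hβ i
    · filter_upwards [h] with x hx
      rw [← hx, ← Finset.sum_fiberwise_of_maps_to (s := Finset.univ) (t := Finset.univ.image τ)
        (g := τ) (fun i _ => Finset.mem_image_of_mem τ (Finset.mem_univ i))]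
      refine Finset.sum_congr rfl fun t _ => ?_
      rw [Finset.sum_mul]
      refine Finset.sum_congr rfl fun i hi => ?_
      rw [(Finset.mem_filter.1 hi).2]
  · refine Finset.sum_eq_zero fun i hi => absurd ?_ ht
    rw [← (Finset.mem_filter.1 hi).2]
    exact Finset.mem_image_of_mem τ (Finset.mem_univ i)

/-! ### Vanishing combinations of skew normal densities. -/

lemma cdf_std_zero : cdf (gaussianReal 0 1) 0 = 1 / 2 := by
  have := cdf_std_neg 0
  rw [neg_zero] at this
  linarith

open Classical in
/-- The value that `extCDF (l * t)` approaches as `t → ∞`. -/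
def extCDFLimit (l : EReal) : ℝ := if 0 < l then 1 else if l = 0 then 1 / 2 else 0

open Classical in
/-- The coefficient of the upper tail `1 - Φ(|l| t)` in `extCDF (l * t)`. -/
def extCDFTailCoeff (l : EReal) : ℝ :=
  if l = ⊤ ∨ l = ⊥ ∨ l = 0 then 0 else if 0 < l then -1 else 1

lemma extCDF_mul_eq (l : EReal) {t : ℝ} (ht : 0 < t) :
    extCDF (l * t) = extCDFLimit l +
      extCDFTailCoeff l * (1 - cdf (gaussianReal 0 1) (|l.toReal| * t)) := by
  induction l
  · simp [EReal.bot_mul_coe_of_pos ht, extCDFLimit, extCDFTailCoeff]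
  · rename_i r
    rw [← EReal.coe_mul, extCDF_coe]
    simp only [extCDFLimit, extCDFTailCoeff, EReal.coe_pos, EReal.coe_eq_zero, EReal.coe_ne_top,
      EReal.coe_ne_bot, false_or, EReal.toReal_coe]
    rcases lt_trichotomy r 0 with h | rfl | h
    · rw [if_neg h.not_gt, if_neg h.ne, if_neg h.ne, if_neg h.not_gt, abs_of_neg h, ← cdf_std_neg]
      simp
    · simp [cdf_std_zero]
    · rw [if_pos h, if_neg h.ne', if_pos h, abs_of_pos h]; ring
  · simp [EReal.top_mul_coe_of_pos ht, extCDFLimit, extCDFTailCoeff]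

/-- The pure Gaussian term is written with `R(0 · (x - μ)) / R(0) = 1`, so that both terms belong to
the linearly independent family, with `β = 0` and `β = |l| / σ`. -/
lemma extSkewNormalPDF_eq_millsRatio (μ : ℝ) {σ : ℝ} (hσ : 0 < σ) (l : EReal) {x : ℝ}
    (hx : μ < x) : extSkewNormalPDF μ σ l x =
      (extCDFLimit l * (2 / σ * (√(2 * Real.pi))⁻¹ * (millsRatio 0)⁻¹)) *
        (Real.exp (-(1 / (2 * σ ^ 2)) * (x - μ) ^ 2) * millsRatio (0 * (x - μ))) +
      (extCDFTailCoeff l * (2 / σ * (√(2 * Real.pi))⁻¹ * (√(2 * Real.pi))⁻¹)) *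
        (Real.exp (-((1 + |l.toReal| ^ 2) / (2 * σ ^ 2)) * (x - μ) ^ 2) *
          millsRatio (|l.toReal| / σ * (x - μ))) := by
  have hR := (millsRatio_pos (le_refl 0)).ne'
  rw [extSkewNormalPDF, extCDF_mul_eq l (div_pos (sub_pos.2 hx) hσ), one_sub_cdf_std,
    gaussianPDFReal_zero_one, zero_mul]
  have e1 : -((x - μ) / σ) ^ 2 / 2 = -(1 / (2 * σ ^ 2)) * (x - μ) ^ 2 := by field_simp
  have e2 : -((1 + |l.toReal| ^ 2) / (2 * σ ^ 2)) * (x - μ) ^ 2 =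
      -(1 / (2 * σ ^ 2)) * (x - μ) ^ 2 + -(|l.toReal| * ((x - μ) / σ)) ^ 2 / 2 := by
    field_simp
    ring
  have e3 : |l.toReal| / σ * (x - μ) = |l.toReal| * ((x - μ) / σ) := by ring
  rw [e1, e2, e3, Real.exp_add]
  field_simp

/-- Vanishing combinations of skew normal densities carry, at each location and scale, equal
coefficients on opposite nonzero shapes. -/
lemma fiber_sum_eq_of_sum_extSkewNormalPDF_eq_zero {ι : Type*} [Fintype ι] (c μ σ : ι → ℝ)
    (l : ι → EReal) (hσ : ∀ i, 0 < σ i)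
    (h : ∀ᶠ x in atTop, ∑ i, c i * extSkewNormalPDF (μ i) (σ i) (l i) x = 0)
    (m s r : ℝ) (hs : 0 < s) (hr : r ≠ 0) :
    ∑ i with μ i = m ∧ σ i = s ∧ l i = (r : EReal), c i =
      ∑ i with μ i = m ∧ σ i = s ∧ l i = ((-r : ℝ) : EReal), c i := by
  wlog hr0 : 0 < r generalizing r
  · have := this (-r) (neg_ne_zero.2 hr) (by
      rcases lt_or_gt_of_ne hr with h | h
      · linarith
      · exact absurd h hr0)
    rw [neg_neg] at this
    exact this.symm
  set K := (√(2 * Real.pi))⁻¹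
  have hK : K ≠ 0 := by positivity
  -- Each component contributes two terms, hence the doubled index type. The fiber examined below
  -- has `β = r / s > 0`, which excludes all terms of the first kind.
  let τ : ι ⊕ ι → ℝ × ℝ × ℝ := Sum.elim (fun i => (1 / (2 * σ i ^ 2), μ i, 0))
    (fun i => ((1 + |(l i).toReal| ^ 2) / (2 * σ i ^ 2), μ i, |(l i).toReal| / σ i))
  let e : ι ⊕ ι → ℝ := Sum.elim
    (fun i => c i * (extCDFLimit (l i) * (2 / σ i * K * (millsRatio 0)⁻¹)))
    (fun i => c i * (extCDFTailCoeff (l i) * (2 / σ i * K * K)))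
  have key := gaussian_mul_millsRatio_fiber_sum_eq_zero τ e (by
      rintro (i | i)
      · have := hσ i
        simp only [τ, Sum.elim_inl]; positivity
      · have := hσ i
        simp only [τ, Sum.elim_inr]; positivity) (by
      rintro (i | i)
      · simp [τ]
      · have := hσ i
        simp only [τ, Sum.elim_inr]; positivity) (by
      filter_upwards [h, eventually_all.2 fun i => eventually_gt_atTop (μ i)] with x hx hxμ
      rw [← hx, Fintype.sum_sum_type, ← Finset.sum_add_distrib]
      refine Finset.sum_congr rfl fun i _ => ?_
      rw [extSkewNormalPDF_eq_millsRatio _ (hσ i) _ (hxμ i)]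
      simp only [τ, e, Sum.elim_inl, Sum.elim_inr]
      ring) ((1 + r ^ 2) / (2 * s ^ 2), m, r / s)
  rw [Finset.sum_filter, Fintype.sum_sum_type] at key
  have hrs : r / s ≠ 0 := (div_pos hr0 hs).ne'
  have k1 : ∀ i, τ (Sum.inl i) ≠ ((1 + r ^ 2) / (2 * s ^ 2), m, r / s) := by
    intro i hi
    simp only [τ, Sum.elim_inl, Prod.mk.injEq] at hi
    exact hrs hi.2.2.symm
  have k2 : ∀ i, (if τ (Sum.inr i) = ((1 + r ^ 2) / (2 * s ^ 2), m, r / s) then e (Sum.inr i)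
      else 0) = (2 / s * K * K) *
        ((if μ i = m ∧ σ i = s ∧ l i = ((-r : ℝ) : EReal) then c i else 0) -
          (if μ i = m ∧ σ i = s ∧ l i = (r : EReal) then c i else 0)) := by
    intro i
    have hi := hσ i
    by_cases ht : τ (Sum.inr i) = ((1 + r ^ 2) / (2 * s ^ 2), m, r / s)
    · rw [if_pos ht]
      simp only [τ, Sum.elim_inr, Prod.mk.injEq] at ht
      obtain ⟨h1, h2, h3⟩ := ht
      -- Since `2 A = σ⁻² + β²`, the pair `(A, β)` determines `σ`, and then `|l| = β σ`; only the
      -- sign of `l` is left open.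
      have h4 : σ i = s := by
        have e1 : (1 + |(l i).toReal| ^ 2) / (2 * σ i ^ 2) =
            ((σ i)⁻¹ ^ 2 + (|(l i).toReal| / σ i) ^ 2) / 2 := by field_simp
        have e2 : (1 + r ^ 2) / (2 * s ^ 2) = (s⁻¹ ^ 2 + (r / s) ^ 2) / 2 := by field_simp
        rw [e1, e2, h3] at h1
        have h5 : (σ i)⁻¹ ^ 2 = s⁻¹ ^ 2 := by linarith
        have h6 := (pow_left_inj₀ (inv_nonneg.2 hi.le) (inv_nonneg.2 hs.le) two_ne_zero).1 h5
        exact inv_injective h6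
      have h5 : |(l i).toReal| = r := by
        rw [h4] at h3
        exact (div_left_inj' hs.ne').1 h3
      simp only [h2, h4, true_and, e, Sum.elim_inr]
      generalize hl : l i = L at h5 ⊢
      induction L
      · simp at h5; exact absurd h5.symm hr0.ne'
      · rename_i q
        rw [EReal.toReal_coe] at h5
        simp only [EReal.coe_eq_coe_iff, extCDFTailCoeff, EReal.coe_ne_top, EReal.coe_ne_bot,
          false_or, EReal.coe_eq_zero, EReal.coe_pos]
        rcases abs_eq hr0.le |>.1 h5 with rfl | rfl
        · rw [if_neg hr, if_pos hr0, if_neg (by linarith), if_pos rfl]; ring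
        · rw [if_neg (by linarith), if_neg (by linarith), if_pos rfl, if_neg (by linarith)]; ring
      · simp at h5; exact absurd h5.symm hr0.ne'
    · rw [if_neg ht, if_neg, if_neg]
      · ring
      · rintro ⟨h1, h2, h3⟩
        apply ht
        simp only [τ, Sum.elim_inr, h1, h2, h3, EReal.toReal_coe, abs_of_pos hr0]
      · rintro ⟨h1, h2, h3⟩
        apply ht
        simp only [τ, Sum.elim_inr, h1, h2, h3, EReal.toReal_coe, abs_neg, abs_of_pos hr0]
  simp only [k1, if_false, Finset.sum_const_zero, zero_add, k2, ← Finset.mul_sum,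
    Finset.sum_sub_distrib, ← Finset.sum_filter] at key
  have := (mul_eq_zero.1 key).resolve_left (by positivity)
  linarith

/-! ### A one-sided law of large numbers for continuously convergent functions. -/

/-- If the empirical frequencies of a sample converge on all cells `{y | ⌊my⌋ = c}`, then averages
of functions `h j ≥ 0` that converge continuously to `g` are asymptotically at most `∫ g`, on a
bounded interval on which the `h j` are uniformly bounded. -/
lemma eventually_average_le_integral_of_cells (ν : Measure ℝ) [IsProbabilityMeasure ν]
    (x : ℕ → ℝ)
    (hcell : ∀ (m : ℕ) (c : ℤ), Tendsto (fun n : ℕ =>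
      (∑ i ∈ Finset.range n, if ⌊(m : ℝ) * x i⌋ = c then (1 : ℝ) else 0) / n) atTop
      (𝓝 (ν.real {y | ⌊(m : ℝ) * y⌋ = c})))
    (N : ℕ → ℕ) (hN : Tendsto N atTop atTop) (h : ℕ → ℝ → ℝ) (g : ℝ → ℝ)
    (h0 : ∀ j y, 0 ≤ h j y) (R : ℕ) (B : ℝ)
    (hB : ∀ᶠ j in atTop, ∀ y ∈ Set.Ico (-(R : ℝ)) R, h j y ≤ B)
    (hconv : ∀ᵐ y ∂ν, Tendsto (fun q : ℕ × ℝ => h q.1 q.2) (atTop ×ˢ 𝓝 y) (𝓝 (g y)))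
    (ε : ℝ) (hε : 0 < ε) :
    ∀ᶠ j in atTop, (∑ i ∈ Finset.range (N j),
      if x i ∈ Set.Ico (-(R : ℝ)) R then h j (x i) else 0) / N j ≤
      ∫ y in Set.Ico (-(R : ℝ)) R, g y ∂ν + ε := by
  obtain ⟨j₀, hj₀⟩ := eventually_atTop.1 hB
  set I := Set.Ico (-(R : ℝ)) R with hI
  -- `S m c` is the supremum over a cell of width `1/m` and over all `j ≥ m`. The resulting step
  -- function `G m` majorizes every `h j` with `j ≥ m` on the interval, and continuous convergence
  -- makes `G m` tend to `g` there almost everywhere.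
  let V : ℕ → ℤ → Set ℝ := fun m c => {v | ∃ j y, m ≤ j ∧ y ∈ I ∧ ⌊(m : ℝ) * y⌋ = c ∧ v = h j y}
  let S : ℕ → ℤ → ℝ := fun m c => sSup (V m c)
  let G : ℕ → ℝ → ℝ := fun m y => S m ⌊(m : ℝ) * y⌋
  have hbdd : ∀ m ≥ j₀, ∀ c, BddAbove (V m c) := by
    rintro m hm c
    refine ⟨B, ?_⟩
    rintro v ⟨j, y, hj, hy, -, rfl⟩
    exact hj₀ j (hm.trans hj) y hy
  have hle : ∀ m ≥ j₀, ∀ j ≥ m, ∀ y ∈ I, h j y ≤ G m y := fun m hm j hj y hy =>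
    le_csSup (hbdd m hm _) ⟨j, y, hj, hy, rfl, rfl⟩
  have hG0 : ∀ m y, 0 ≤ G m y := by
    intro m y
    refine Real.sSup_nonneg ?_
    rintro v ⟨j, y, -, -, -, rfl⟩
    exact h0 j y
  have hGB : ∀ m ≥ j₀, ∀ y ∈ I, G m y ≤ B := by
    intro m hm y hy
    refine csSup_le ⟨_, m, y, le_rfl, hy, rfl, rfl⟩ ?_
    rintro v ⟨j, z, hj, hz, -, rfl⟩
    exact hj₀ j (hm.trans hj) z hz
  have hGmeas : ∀ m, Measurable (G m) := fun m =>
    (measurable_from_top (f := S m)).comp (Int.measurable_floor.comp (by fun_prop))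
  have hGlim : ∀ᵐ y ∂ν, y ∈ I → Tendsto (fun m => G m y) atTop (𝓝 (g y)) := by
    filter_upwards [hconv] with y hy hyI
    rw [Metric.tendsto_atTop]
    intro η hη
    have h1 := hy (Metric.ball_mem_nhds (g y) (half_pos hη))
    rw [mem_map, mem_prod_iff] at h1
    obtain ⟨t₁, ht₁, t₂, ht₂, hsub⟩ := h1
    obtain ⟨j₁, hj₁⟩ := mem_atTop_sets.1 ht₁
    obtain ⟨δ, hδ, hball⟩ := Metric.mem_nhds_iff.1 ht₂
    -- For `m ≥ k` the cell of `y` has width less than `δ`.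
    obtain ⟨k, hk⟩ := exists_nat_gt (1 / δ)
    refine ⟨max (max j₀ j₁) k, fun m hm => ?_⟩
    have hm0 : j₀ ≤ m := ((le_max_left _ _).trans (le_max_left _ _)).trans hm
    have hm1 : j₁ ≤ m := ((le_max_right _ _).trans (le_max_left _ _)).trans hm
    have hmk : (k : ℝ) ≤ m := by exact_mod_cast (le_max_right _ _).trans hm
    have hmδ : 1 < m * δ := by
      have := hk.trans_le hmk
      rwa [div_lt_iff₀ hδ] at this
    have hclose : ∀ j z, m ≤ j → ⌊(m : ℝ) * z⌋ = ⌊(m : ℝ) * y⌋ → |h j z - g y| < η / 2 := by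
      intro j z hj hz
      have h2 := Int.abs_sub_lt_one_of_floor_eq_floor hz
      rw [← mul_sub, abs_mul, Nat.abs_cast] at h2
      have h3 : |z - y| < δ := by
        by_contra hcon
        have := mul_le_mul_of_nonneg_left (not_lt.1 hcon) (Nat.cast_nonneg (α := ℝ) m)
        linarith
      have h4 : (j, z) ∈ t₁ ×ˢ t₂ :=
        ⟨hj₁ j (hm1.trans hj), hball (by simpa [Real.dist_eq] using h3)⟩
      have h5 := hsub h4
      simpa [Real.dist_eq] using h5
    have h6 := hle m hm0 m le_rfl y hyI
    have h7 := abs_lt.1 (hclose m y le_rfl rfl)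
    have h8 : G m y ≤ g y + η / 2 := by
      refine csSup_le ⟨_, m, y, le_rfl, hyI, rfl, rfl⟩ ?_
      rintro v ⟨j, z, hj, -, hz, rfl⟩
      linarith [(abs_lt.1 (hclose j z hj hz)).2]
    rw [Real.dist_eq, abs_lt]
    constructor <;> linarith [h7.1]
  have hIlim : Tendsto (fun m => ∫ y in I, G m y ∂ν) atTop (𝓝 (∫ y in I, g y ∂ν)) := by
    refine tendsto_integral_filter_of_dominated_convergence (fun _ => B)
      (Eventually.of_forall fun m => (hGmeas m).aestronglyMeasurable) ?_
      (integrable_const B) ((ae_restrict_iff' measurableSet_Ico).2 hGlim)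
    filter_upwards [eventually_ge_atTop j₀] with m hm
    refine (ae_restrict_iff' measurableSet_Ico).2 (Eventually.of_forall fun y hy => ?_)
    rw [Real.norm_of_nonneg (hG0 m y)]
    exact hGB m hm y hy
  obtain ⟨m, hm0, hm1, hmI⟩ : ∃ m, j₀ ≤ m ∧ 1 ≤ m ∧
      ∫ y in I, G m y ∂ν < ∫ y in I, g y ∂ν + ε / 2 :=
    ((eventually_ge_atTop j₀).and ((eventually_ge_atTop 1).and
      ((tendsto_order.1 hIlim).2 _ (by linarith)))).exists
  -- Because `R` is an integer, the interval is exactly a union of cells.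
  set cells := Finset.Ico (-(R : ℤ) * m) (R * m)
  have hmpos : (0 : ℝ) < m := by exact_mod_cast hm1
  have hstep : ∀ y, (if y ∈ I then G m y else 0) =
      ∑ c ∈ cells, S m c * (if ⌊(m : ℝ) * y⌋ = c then (1 : ℝ) else 0) := by
    intro y
    have hiff : y ∈ I ↔ ⌊(m : ℝ) * y⌋ ∈ cells := by
      rw [Finset.mem_Ico, Int.le_floor, Int.floor_lt, hI, Set.mem_Ico]
      push_cast
      rw [mul_comm (m : ℝ) y, mul_le_mul_iff_left₀ hmpos, mul_lt_mul_iff_left₀ hmpos]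
    simp only [mul_ite, mul_one, mul_zero, Finset.sum_ite_eq]
    simp only [hiff, G]
  have hint : ∫ y in I, G m y ∂ν = ∑ c ∈ cells, S m c * ν.real {y | ⌊(m : ℝ) * y⌋ = c} := by
    have hms : ∀ c : ℤ, MeasurableSet {y : ℝ | ⌊(m : ℝ) * y⌋ = c} := fun c =>
      (Int.measurable_floor.comp (measurable_const.mul measurable_id)) (measurableSet_singleton c)
    rw [← integral_indicator measurableSet_Ico]
    have : (I.indicator fun y => G m y) = fun y =>
        ∑ c ∈ cells, S m c * ({y : ℝ | ⌊(m : ℝ) * y⌋ = c}.indicator (fun _ => (1 : ℝ)) y) := by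
      ext y
      rw [Set.indicator_apply, hstep]
      simp only [Set.indicator_apply, Set.mem_ofPred_eq]
    rw [this, integral_finsetSum _ fun c _ =>
      ((integrable_const (1 : ℝ)).indicator (hms c)).const_mul _]
    refine Finset.sum_congr rfl fun c _ => ?_
    rw [integral_const_mul, integral_indicator_const _ (hms c)]
    simp
  have havg : Tendsto (fun n : ℕ => (∑ i ∈ Finset.range n, if x i ∈ I then G m (x i) else 0) / n)
      atTop (𝓝 (∫ y in I, G m y ∂ν)) := by
    rw [hint]
    have := tendsto_finsetSum cells fun c _ => (hcell m c).const_mul (S m c)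
    refine this.congr fun n => ?_
    simp only [hstep]
    rw [Finset.sum_comm, Finset.sum_div]
    refine Finset.sum_congr rfl fun c _ => ?_
    rw [← Finset.mul_sum, mul_div_assoc]
  have hev := hN.eventually ((tendsto_order.1 havg).2 (∫ y in I, G m y ∂ν + ε / 2) (by linarith))
  filter_upwards [hev, eventually_ge_atTop m] with j hj hjm
  refine le_trans ?_ (hj.le.trans (by linarith))
  refine div_le_div_of_nonneg_right (Finset.sum_le_sum fun i _ => ?_) (Nat.cast_nonneg _)
  split_ifs with hx
  · exact hle m hm0 j hjm _ hx
  · exact le_rfl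

/-! ### Strong laws and uniform bounds on window counts. -/

section
variable {Ω : Type*} [MeasurableSpace Ω] {P : Measure Ω} {X : ℕ → Ω → ℝ} {ν : Measure ℝ}

lemma ae_tendsto_average_comp [IsProbabilityMeasure P] (hindep : iIndepFun X P)
    (hlaw : ∀ i, HasLaw (X i) ν P) {f : ℝ → ℝ} (hf : Measurable f) (hint : Integrable f ν) :
    ∀ᵐ ω ∂P, Tendsto (fun n : ℕ => (∑ i ∈ Finset.range n, f (X i ω)) / n) atTop
      (𝓝 (∫ x, f x ∂ν)) := by
  have h0 : Integrable (fun ω => f (X 0 ω)) P := by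
    have := (integrable_map_measure (μ := P) (f := X 0) (g := f)
      hf.aestronglyMeasurable (hlaw 0).aemeasurable).1
    rw [(hlaw 0).map_eq] at this
    exact this hint
  have h1 := strong_law_ae_real (fun i ω => f (X i ω)) h0
    (fun i j hij => (hindep.indepFun hij).comp hf hf)
    (fun i => IdentDistrib.comp ⟨(hlaw i).aemeasurable, (hlaw 0).aemeasurable,
      (hlaw i).map_eq.trans (hlaw 0).map_eq.symm⟩ hf)
  have h2 : ∫ ω, f (X 0 ω) ∂P = ∫ x, f x ∂ν := by
    rw [← (hlaw 0).map_eq, integral_map (hlaw 0).aemeasurable hf.aestronglyMeasurable]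
  simpa only [h2] using h1

/-- A Chernoff bound for the number of sample points in a set. -/
lemma measureReal_count_ge_le [IsProbabilityMeasure P] [IsProbabilityMeasure ν]
    (hindep : iIndepFun X P)
    (hlaw : ∀ i, HasLaw (X i) ν P) {I : Set ℝ} (hI : MeasurableSet I) (n : ℕ) (t : ℝ) :
    P.real {ω | 2 * n * ν.real I + t ≤
      ∑ i ∈ Finset.range n, I.indicator (fun _ => (1 : ℝ)) (X i ω)} ≤ Real.exp (-t) := by
  set f : ℝ → ℝ := I.indicator (fun _ => (1 : ℝ)) with hf
  have hfm : Measurable f := measurable_const.indicator hI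
  have hf1 : ∀ x, f x ≤ 1 := fun x => by
    rw [hf]; exact Set.indicator_le_self' (fun _ _ => zero_le_one) x
  set Y : ℕ → Ω → ℝ := fun i ω => f (X i ω)
  have hYm : ∀ i, AEMeasurable (Y i) P := fun i => hfm.comp_aemeasurable (hlaw i).aemeasurable
  have hYind : iIndepFun Y P := hindep.comp (fun _ => f) fun _ => hfm
  have hmgf : ∀ i, mgf (Y i) P 1 ≤ Real.exp (2 * ν.real I) := by
    intro i
    have h1 : mgf (Y i) P 1 = ∫ x, Real.exp (f x) ∂ν := by
      rw [mgf, ← (hlaw i).map_eq, integral_map (f := fun x => Real.exp (f x))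
        (hlaw i).aemeasurable (Real.measurable_exp.comp hfm).aestronglyMeasurable]
      simp [Y]
    -- An indicator takes only the values `0` and `1`, so its exponential is affine in it; then `e -
    -- 1 ≤ 2` accounts for the factor `2` in the bound.
    have h2 : (fun x => Real.exp (f x)) = fun x => 1 + (Real.exp 1 - 1) * f x := by
      ext x
      by_cases hx : x ∈ I <;> simp [hf, hx]
    have h3 : ∫ x, f x ∂ν = ν.real I := by
      rw [hf, integral_indicator_const _ hI]; simp
    have hfi : Integrable f ν := (integrable_const (1 : ℝ)).indicator hI
    rw [h1, h2, integral_add (integrable_const _) (hfi.const_mul _), integral_const_mul, h3]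
    simp only [integral_const, probReal_univ, smul_eq_mul, one_mul]
    have h4 : Real.exp 1 - 1 ≤ 2 := by linarith [Real.exp_one_lt_d9]
    have h5 : 0 ≤ ν.real I := measureReal_nonneg
    have h6 := Real.add_one_le_exp (2 * ν.real I)
    nlinarith [mul_le_mul_of_nonneg_right h4 h5]
  have hsum : (fun ω => ∑ i ∈ Finset.range n, I.indicator (fun _ => (1 : ℝ)) (X i ω)) =
      ∑ i ∈ Finset.range n, Y i := by
    ext ω; simp [Y, Finset.sum_apply, hf]
  have hmeasS : AEMeasurable (∑ i ∈ Finset.range n, Y i) P :=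
    Finset.aemeasurable_sum _ fun i _ => hYm i
  have hint : Integrable (fun ω => Real.exp (1 * (∑ i ∈ Finset.range n, Y i) ω)) P := by
    refine Integrable.of_bound (C := Real.exp n)
      ((Real.measurable_exp.comp_aemeasurable (hmeasS.const_mul 1)).aestronglyMeasurable)
      (Eventually.of_forall fun ω => ?_)
    rw [Real.norm_of_nonneg (Real.exp_nonneg _), one_mul]
    refine Real.exp_le_exp.2 ?_
    rw [Finset.sum_apply]
    refine (Finset.sum_le_sum fun i _ => hf1 (X i ω)).trans (by simp)
  have h := measure_ge_le_exp_mul_mgf (μ := P) (X := ∑ i ∈ Finset.range n, Y i)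
    (2 * n * ν.real I + t) zero_le_one hint
  rw [← hsum] at h
  refine h.trans ?_
  rw [hsum, hYind.mgf_sum₀ hYm]
  refine (mul_le_mul_of_nonneg_left (Finset.prod_le_prod (fun i _ => mgf_nonneg)
    fun i _ => hmgf i) (Real.exp_nonneg _)).trans ?_
  rw [Finset.prod_const, Finset.card_range, ← Real.exp_nat_mul, ← Real.exp_add]
  exact Real.exp_le_exp.2 (by ring_nf; rfl)

/-- Borel–Cantelli: there are at most `4 (n + 1)⁴` pairs of grid points, and the Chernoff bound with
`t = 8 log (n + 1)` gives each failure probability at most `(n + 1)⁻⁸`. -/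
lemma ae_eventually_grid_count_lt [IsProbabilityMeasure P] [IsProbabilityMeasure ν]
    (hindep : iIndepFun X P) (hlaw : ∀ i, HasLaw (X i) ν P) :
    ∀ᵐ ω ∂P, ∀ᶠ n : ℕ in atTop, ∀ i ∈ Finset.Icc (-(n : ℤ) ^ 2) (n ^ 2),
      ∀ j ∈ Finset.Icc (-(n : ℤ) ^ 2) (n ^ 2),
      ∑ k ∈ Finset.range n, (Set.Icc ((i : ℝ) / n) (j / n)).indicator (fun _ => (1 : ℝ)) (X k ω) <
        2 * n * ν.real (Set.Icc ((i : ℝ) / n) (j / n)) + 8 * Real.log (n + 1) := by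
  set bad : ℕ → ℤ → ℤ → Set Ω := fun n i j =>
    {ω | 2 * n * ν.real (Set.Icc ((i : ℝ) / n) (j / n)) + 8 * Real.log (n + 1) ≤
      ∑ k ∈ Finset.range n, (Set.Icc ((i : ℝ) / n) (j / n)).indicator (fun _ => (1 : ℝ)) (X k ω)}
  set J : ℕ → Finset ℤ := fun n => Finset.Icc (-(n : ℤ) ^ 2) (n ^ 2)
  have hbad : ∀ n i j, P (bad n i j) ≤ ENNReal.ofReal (1 / ((n : ℝ) + 1) ^ 8) := by
    intro n i j
    have h := measureReal_count_ge_le hindep hlaw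
      (measurableSet_Icc (a := (i : ℝ) / n) (b := (j : ℝ) / n)) n (8 * Real.log (n + 1))
    have hn : (0 : ℝ) < n + 1 := by positivity
    have e : Real.exp (-(8 * Real.log (n + 1))) = 1 / ((n : ℝ) + 1) ^ 8 := by
      rw [Real.exp_neg,
        show (8 : ℝ) * Real.log (n + 1) = ((8 : ℕ) : ℝ) * Real.log (n + 1) by norm_num,
        Real.exp_nat_mul, Real.exp_log hn, one_div]
    rw [e] at h
    rw [← ofReal_measureReal]
    exact ENNReal.ofReal_le_ofReal h
  have hcard : ∀ n, ((J n).card : ℝ) ≤ 2 * ((n : ℝ) + 1) ^ 2 := by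
    intro n
    have : ((J n).card : ℤ) = 2 * (n : ℤ) ^ 2 + 1 := by
      simp only [J, Int.card_Icc]
      rw [Int.toNat_of_nonneg (by linarith [sq_nonneg (n : ℤ)])]
      ring
    have h2 : ((J n).card : ℝ) = 2 * (n : ℝ) ^ 2 + 1 := by exact_mod_cast this
    rw [h2]
    nlinarith [Nat.cast_nonneg (α := ℝ) n]
  have hbound : ∀ n, P (⋃ i ∈ J n, ⋃ j ∈ J n, bad n i j) ≤
      ENNReal.ofReal (4 * (1 / ((n + 1 : ℕ) : ℝ) ^ 2)) := by
    intro n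
    calc P (⋃ i ∈ J n, ⋃ j ∈ J n, bad n i j)
        ≤ ∑ i ∈ J n, ∑ j ∈ J n, ENNReal.ofReal (1 / ((n : ℝ) + 1) ^ 8) :=
          (measure_biUnion_finset_le _ _).trans (Finset.sum_le_sum fun i _ =>
            (measure_biUnion_finset_le _ _).trans (Finset.sum_le_sum fun j _ => hbad n i j))
      _ = ENNReal.ofReal ((J n).card * ((J n).card * (1 / ((n : ℝ) + 1) ^ 8))) := by
          simp only [Finset.sum_const, nsmul_eq_mul]
          rw [ENNReal.ofReal_mul (Nat.cast_nonneg _), ENNReal.ofReal_mul (Nat.cast_nonneg _),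
            ENNReal.ofReal_natCast]
      _ ≤ _ := by
          refine ENNReal.ofReal_le_ofReal ?_
          have hn : (1 : ℝ) ≤ n + 1 := by linarith [Nat.cast_nonneg (α := ℝ) n]
          have h0 : (0 : ℝ) ≤ (J n).card := Nat.cast_nonneg _
          have h1 := hcard n
          push_cast
          rw [← mul_assoc, ← sq, mul_one_div, mul_one_div,
            div_le_div_iff₀ (by positivity) (by positivity)]
          have h2 : ((J n).card : ℝ) ^ 2 ≤ (2 * ((n : ℝ) + 1) ^ 2) ^ 2 := pow_le_pow_left₀ h0 h1 2
          have h3 : ((n : ℝ) + 1) ^ 6 ≤ ((n : ℝ) + 1) ^ 8 := pow_le_pow_right₀ hn (by norm_num)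
          calc ((J n).card : ℝ) ^ 2 * ((n : ℝ) + 1) ^ 2 ≤
              (2 * ((n : ℝ) + 1) ^ 2) ^ 2 * ((n : ℝ) + 1) ^ 2 :=
                mul_le_mul_of_nonneg_right h2 (by positivity)
            _ = 4 * ((n : ℝ) + 1) ^ 6 := by ring
            _ ≤ _ := by linarith
  have hsum : ∑' n, P (⋃ i ∈ J n, ⋃ j ∈ J n, bad n i j) ≠ ⊤ := by
    refine ne_top_of_le_ne_top ?_ (ENNReal.tsum_le_tsum hbound)
    have hs : Summable fun n : ℕ => 4 * (1 / ((n + 1 : ℕ) : ℝ) ^ 2) :=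
      (((summable_nat_add_iff 1).2 (Real.summable_one_div_nat_pow.2 one_lt_two))).mul_left 4
    rw [← ENNReal.ofReal_tsum_of_nonneg (fun n => by positivity) hs]
    exact ENNReal.ofReal_ne_top
  filter_upwards [ae_eventually_notMem hsum] with ω hω
  filter_upwards [hω] with n hn i hi j hj
  simp only [Set.mem_iUnion, not_exists] at hn
  exact not_le.1 (hn i hi j hj)

end

/-- The number of the first `n` sample points at distance at most `r` from `μ`. -/
def windowCount (x : ℕ → ℝ) (n : ℕ) (μ r : ℝ) : ℝ :=
  ((Finset.range n).filter fun i => |x i - μ| ≤ r).card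

/-- Grid counts control the counts of all windows. -/
lemma eventually_windowCount_le {ν : Measure ℝ} {M : ℝ} (hM : 0 ≤ M)
    (hν : ∀ a b : ℝ, a ≤ b → ν.real (Set.Icc a b) ≤ M * (b - a)) (x : ℕ → ℝ)
    (hx : ∀ᶠ n : ℕ in atTop, ∀ k < n, |x k| ≤ n)
    (hgrid : ∀ᶠ n : ℕ in atTop, ∀ i ∈ Finset.Icc (-(n : ℤ) ^ 2) (n ^ 2),
      ∀ j ∈ Finset.Icc (-(n : ℤ) ^ 2) (n ^ 2),
      ∑ k ∈ Finset.range n, (Set.Icc ((i : ℝ) / n) (j / n)).indicator (fun _ => (1 : ℝ)) (x k) <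
        2 * n * ν.real (Set.Icc ((i : ℝ) / n) (j / n)) + 8 * Real.log (n + 1)) :
    ∃ C : ℝ, 0 ≤ C ∧ ∀ᶠ n : ℕ in atTop, ∀ μ r : ℝ, 0 ≤ r →
      windowCount x n μ r ≤ C * (n * r) + C * Real.log n := by
  -- Rounding to the grid enlarges `n` times the window length to at most `2 n r + 2`, giving `2 M
  -- (2 n r + 2)`; the deviation `8 log (n + 1)` is at most `16 log n`, and `1 ≤ log n` absorbs the
  -- constant `4 M`.
  refine ⟨4 * M + 16, by positivity, ?_⟩
  filter_upwards [hx, hgrid, eventually_ge_atTop 3] with n hxn hgn hn3 μ r hr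
  have hn3' : (3 : ℝ) ≤ n := by exact_mod_cast hn3
  have hn0 : (0 : ℝ) < n := by linarith
  have hlog1 : 1 ≤ Real.log n := by
    rw [Real.le_log_iff_exp_le hn0]
    linarith [Real.exp_one_lt_d9]
  have hlog2 : Real.log (n + 1) ≤ 2 * Real.log n := by
    rw [show 2 * Real.log n = Real.log ((n : ℝ) ^ 2) by rw [Real.log_pow]; norm_num]
    exact Real.log_le_log (by linarith) (by nlinarith)
  -- The window is rounded outwards to multiples of `1/n` and clipped to `[-n, n]`, which loses no
  -- sample point.
  set i : ℤ := max ⌊n * (μ - r)⌋ (-(n : ℤ) ^ 2) with hi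
  set j : ℤ := min ⌈n * (μ + r)⌉ ((n : ℤ) ^ 2) with hj
  have hpt : ∀ k < n, |x k - μ| ≤ r → (i : ℝ) ≤ n * x k ∧ n * x k ≤ j := by
    intro k hk hxk
    have h1 := abs_le.1 (hxn k hk)
    have h2 := abs_le.1 hxk
    constructor
    · rw [hi]; push_cast
      refine max_le ((Int.floor_le _).trans ?_) ?_
      · exact mul_le_mul_of_nonneg_left (by linarith) hn0.le
      · nlinarith
    · rw [hj]; push_cast
      refine le_min (le_trans ?_ (Int.le_ceil _)) ?_
      · exact mul_le_mul_of_nonneg_left (by linarith) hn0.le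
      · nlinarith
  have hRHS : 0 ≤ (4 * M + 16) * (n * r) + (4 * M + 16) * Real.log n := by positivity
  by_cases hex : ∃ k < n, |x k - μ| ≤ r
  · obtain ⟨k, hk, hxk⟩ := hex
    have hij : (i : ℝ) ≤ j := (hpt k hk hxk).1.trans (hpt k hk hxk).2
    have hij' : i ≤ j := by exact_mod_cast hij
    have hi2 : -(n : ℤ) ^ 2 ≤ i := le_max_right _ _
    have hj2 : j ≤ (n : ℤ) ^ 2 := min_le_right _ _
    have h1 := hgn i (Finset.mem_Icc.2 ⟨hi2, hij'.trans hj2⟩)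
      j (Finset.mem_Icc.2 ⟨hi2.trans hij', hj2⟩)
    have h2 : windowCount x n μ r ≤ ∑ k ∈ Finset.range n,
        (Set.Icc ((i : ℝ) / n) (j / n)).indicator (fun _ => (1 : ℝ)) (x k) := by
      rw [windowCount, Finset.card_filter]
      push_cast
      refine Finset.sum_le_sum fun k hk => ?_
      split_ifs with h
      · have h3 := hpt k (Finset.mem_range.1 hk) h
        rw [Set.indicator_of_mem]
        rw [Set.mem_Icc, div_le_iff₀ hn0, le_div_iff₀ hn0, mul_comm (x k)]
        exact h3
      · exact Set.indicator_nonneg (fun _ _ => zero_le_one) _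
    have h3 := hν (i / n) (j / n) (div_le_div_of_nonneg_right hij hn0.le)
    have h4 : (j : ℝ) - i ≤ 2 * (n * r) + 2 := by
      have e1 : (j : ℝ) ≤ ⌈n * (μ + r)⌉ := by exact_mod_cast min_le_left _ _
      have e2 : (⌊n * (μ - r)⌋ : ℝ) ≤ i := by exact_mod_cast le_max_left _ _
      have e3 := Int.ceil_lt_add_one (n * (μ + r))
      have e4 := Int.lt_floor_add_one (n * (μ - r))
      nlinarith
    have h5 : 2 * n * ν.real (Set.Icc ((i : ℝ) / n) (j / n)) ≤ 2 * M * (2 * (n * r) + 2) := by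
      calc _ ≤ 2 * n * (M * (j / n - i / n)) := mul_le_mul_of_nonneg_left h3 (by positivity)
        _ = 2 * M * (j - i) := by field_simp
        _ ≤ _ := mul_le_mul_of_nonneg_left h4 (by positivity)
    have h6 : 0 ≤ (n : ℝ) * r := by positivity
    nlinarith [mul_nonneg hM (sub_nonneg.2 hlog1)]
  · push Not at hex
    have : windowCount x n μ r = 0 := by
      rw [windowCount, Finset.filter_false_of_mem]
      · simp
      · intro k hk
        exact not_le.2 (hex k (Finset.mem_range.1 hk))
    rw [this]
    exact hRHS

/-! ### Mixture densities, their laws and typical samples. -/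

lemma skewNormalPDF_pos {σ : ℝ} (hσ : 0 < σ) (μ l x : ℝ) : 0 < skewNormalPDF μ σ l x :=
  mul_pos (mul_pos (by positivity) (gaussianPDFReal_pos _ _ _ one_ne_zero)) (cdf_std_pos _)

lemma continuous_skewNormalPDF (μ σ l : ℝ) : Continuous (skewNormalPDF μ σ l) := by
  unfold skewNormalPDF
  exact (continuous_const.mul (continuous_gaussianPDFReal_zero_one.comp (by fun_prop))).mul
    (continuous_cdf_std.comp (by fun_prop))

lemma skewNormalPDF_le_inv {σ : ℝ} (hσ : 0 < σ) (μ l x : ℝ) : skewNormalPDF μ σ l x ≤ 1 / σ := by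
  rw [← extSkewNormalPDF_coe]; exact extSkewNormalPDF_le_inv hσ _ _ _

/-- The reciprocal of the skew normal density grows at most like `exp (C (1 + x²))`. -/
lemma exists_exp_le_skewNormalPDF {σ : ℝ} (hσ : 0 < σ) (μ l : ℝ) :
    ∃ C : ℝ, 0 ≤ C ∧ ∀ x, Real.exp (-C * (1 + x ^ 2)) ≤ skewNormalPDF μ σ l x := by
  set K : ℝ := 2 / σ * (√(2 * Real.pi))⁻¹ * (√(2 * Real.pi))⁻¹ with hK
  have hKpos : 0 < K := by positivity
  set D : ℝ := (1 / 2 + l ^ 2) / σ ^ 2 with hD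
  have hDpos : 0 ≤ D := by positivity
  refine ⟨|Real.log K| + 1 + 2 * D + 2 * D * μ ^ 2, by positivity, fun x => ?_⟩
  have h1 : K * Real.exp (-(D * (x - μ) ^ 2) - 1) ≤ skewNormalPDF μ σ l x := by
    have h2 := exp_le_cdf_std (l * ((x - μ) / σ))
    rw [skewNormalPDF, gaussianPDFReal_zero_one]
    refine le_trans (le_of_eq ?_) (mul_le_mul_of_nonneg_left h2 (by positivity))
    have : Real.exp (-(D * (x - μ) ^ 2) - 1) = Real.exp (-((x - μ) / σ) ^ 2 / 2) *
        Real.exp (-(l * ((x - μ) / σ)) ^ 2 - 1) := by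
      rw [← Real.exp_add, hD]
      congr 1
      field_simp
      ring
    rw [this, hK]; ring
  refine le_trans ?_ h1
  rw [← Real.exp_log hKpos, ← Real.exp_add, Real.exp_log hKpos]
  refine Real.exp_le_exp.2 ?_
  have h3 := neg_abs_le (Real.log K)
  have h4 : (x - μ) ^ 2 ≤ 2 * x ^ 2 + 2 * μ ^ 2 := by nlinarith [sq_nonneg (x + μ)]
  have h5 := mul_le_mul_of_nonneg_left h4 hDpos
  have h6 : 0 ≤ (|Real.log K| + 1 + 2 * D * μ ^ 2) * x ^ 2 := by positivity
  nlinarith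

lemma integrable_skewNormalPDF_mul_sq {σ : ℝ} (hσ : 0 < σ) (μ l : ℝ) :
    Integrable fun x => skewNormalPDF μ σ l x * (1 + x ^ 2) := by
  have hv : (σ ^ 2).toNNReal ≠ 0 := by simpa using hσ.ne'
  have h1 : Integrable (fun x : ℝ => 1 + x ^ 2) (gaussianReal μ (σ ^ 2).toNNReal) :=
    (integrable_const 1).add (by simpa using (memLp_id_gaussianReal (μ := μ)
      (v := (σ ^ 2).toNNReal) 2).integrable_sq)
  rw [gaussianReal_of_var_ne_zero _ hv, integrable_withDensity_iff_integrable_smul'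
    (measurable_gaussianPDF _ _) (Eventually.of_forall fun _ => gaussianPDF_lt_top)] at h1
  simp only [toReal_gaussianPDF, smul_eq_mul] at h1
  refine (h1.const_mul 2).mono' ((continuous_skewNormalPDF μ σ l).aestronglyMeasurable.mul
    (by fun_prop)) (Eventually.of_forall fun x => ?_)
  have h2 := extSkewNormalPDF_add_reflect hσ μ l x
  have h3 := extSkewNormalPDF_nonneg hσ μ l (2 * μ - x)
  rw [extSkewNormalPDF_coe] at h2
  rw [norm_mul, Real.norm_of_nonneg (skewNormalPDF_pos hσ μ l x).le,
    Real.norm_of_nonneg (by positivity), ← mul_assoc]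
  exact mul_le_mul_of_nonneg_right (by linarith) (by positivity)

namespace MixParam

variable {p : ℕ} (Ψ : MixParam p)

lemma w_le_one (k : Fin p) : Ψ.w k ≤ 1 := by
  rw [← Ψ.w_sum]
  exact Finset.single_le_sum (fun i _ => Ψ.w_nonneg i) (Finset.mem_univ k)

lemma exists_w_pos : ∃ k, 0 < Ψ.w k := by
  by_contra! h
  have h1 := Ψ.w_sum
  rw [Finset.sum_eq_zero fun k _ => le_antisymm (h k) (Ψ.w_nonneg k)] at h1
  exact zero_ne_one h1

lemma pdf_pos (x : ℝ) : 0 < Ψ.pdf x := by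
  obtain ⟨k, hk⟩ := Ψ.exists_w_pos
  exact Finset.sum_pos' (fun i _ => mul_nonneg (Ψ.w_nonneg i)
    (skewNormalPDF_pos (Ψ.σ_pos i) _ _ _).le)
    ⟨k, Finset.mem_univ k, mul_pos hk (skewNormalPDF_pos (Ψ.σ_pos k) _ _ _)⟩

lemma continuous_pdf : Continuous Ψ.pdf :=
  continuous_finsetSum _ fun _ _ => continuous_const.mul (continuous_skewNormalPDF _ _ _)

lemma pdf_le (x : ℝ) : Ψ.pdf x ≤ ∑ k, 1 / Ψ.σ k := by
  refine Finset.sum_le_sum fun k _ => ?_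
  have h := (skewNormalPDF_pos (Ψ.σ_pos k) (Ψ.μ k) (Ψ.l k) x).le
  exact (mul_le_of_le_one_left h (Ψ.w_le_one k)).trans (skewNormalPDF_le_inv (Ψ.σ_pos k) _ _ _)

/-- One component of positive weight already bounds the mixture density from below. -/
lemma exists_inv_pdf_le : ∃ C : ℝ, 0 ≤ C ∧ ∀ x, (Ψ.pdf x)⁻¹ ≤ Real.exp (C * (1 + x ^ 2)) := by
  obtain ⟨k, hk⟩ := Ψ.exists_w_pos
  obtain ⟨C, hC, h⟩ := exists_exp_le_skewNormalPDF (Ψ.σ_pos k) (Ψ.μ k) (Ψ.l k)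
  refine ⟨|Real.log (Ψ.w k)| + C, by positivity, fun x => ?_⟩
  rw [← inv_inv (Real.exp _), ← Real.exp_neg]
  refine inv_anti₀ (Real.exp_pos _) ?_
  calc Real.exp (-((|Real.log (Ψ.w k)| + C) * (1 + x ^ 2)))
      ≤ Real.exp (Real.log (Ψ.w k) + -C * (1 + x ^ 2)) := by
        refine Real.exp_le_exp.2 ?_
        have h1 := neg_abs_le (Real.log (Ψ.w k))
        have h2 : 0 ≤ |Real.log (Ψ.w k)| * x ^ 2 := by positivity
        nlinarith
    _ = Ψ.w k * Real.exp (-C * (1 + x ^ 2)) := by rw [Real.exp_add, Real.exp_log hk]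
    _ ≤ Ψ.w k * skewNormalPDF (Ψ.μ k) (Ψ.σ k) (Ψ.l k) x := mul_le_mul_of_nonneg_left (h x) hk.le
    _ ≤ Ψ.pdf x := Finset.single_le_sum
        (f := fun k => Ψ.w k * skewNormalPDF (Ψ.μ k) (Ψ.σ k) (Ψ.l k) x)
        (fun i _ => mul_nonneg (Ψ.w_nonneg i) (skewNormalPDF_pos (Ψ.σ_pos i) _ _ _).le)
        (Finset.mem_univ k)

/-- `log (1 + B / f(x; Ψ))` grows at most quadratically. -/
lemma exists_log_one_add_div_pdf_le (B : ℝ) (hB : 0 ≤ B) :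
    ∃ C : ℝ, 0 ≤ C ∧ ∀ x, Real.log (1 + B / Ψ.pdf x) ≤ C * (1 + x ^ 2) := by
  obtain ⟨C, hC, h⟩ := Ψ.exists_inv_pdf_le
  have hlog : 0 ≤ Real.log (1 + B) := Real.log_nonneg (by linarith)
  refine ⟨Real.log (1 + B) + C, by positivity, fun x => ?_⟩
  have hp := Ψ.pdf_pos x
  have h1 : 1 ≤ Real.exp (C * (1 + x ^ 2)) := Real.one_le_exp (by positivity)
  have h2 : 1 + B / Ψ.pdf x ≤ (1 + B) * Real.exp (C * (1 + x ^ 2)) := by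
    rw [div_eq_mul_inv]
    have := mul_le_mul_of_nonneg_left (h x) hB
    linarith
  have h0 : 0 < 1 + B / Ψ.pdf x := by positivity
  refine (Real.log_le_log h0 h2).trans ?_
  rw [Real.log_mul (by positivity) (Real.exp_ne_zero _), Real.log_exp]
  nlinarith [mul_nonneg hlog (sq_nonneg x)]

lemma measurable_ofReal_pdf : Measurable fun x => ENNReal.ofReal (Ψ.pdf x) :=
  Ψ.continuous_pdf.measurable.ennreal_ofReal

lemma lintegral_pdf : ∫⁻ x, ENNReal.ofReal (Ψ.pdf x) = 1 := by
  have h1 : ∀ x, ENNReal.ofReal (Ψ.pdf x) = ∑ k, ENNReal.ofReal (Ψ.w k) *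
      ENNReal.ofReal (extSkewNormalPDF (Ψ.μ k) (Ψ.σ k) (Ψ.l k) x) := by
    intro x
    rw [pdf, ENNReal.ofReal_sum_of_nonneg fun i _ =>
      mul_nonneg (Ψ.w_nonneg i) (skewNormalPDF_pos (Ψ.σ_pos i) _ _ _).le]
    refine Finset.sum_congr rfl fun k _ => ?_
    rw [ENNReal.ofReal_mul (Ψ.w_nonneg k), extSkewNormalPDF_coe]
  simp only [h1]
  rw [lintegral_finsetSum _ fun k _ =>
    ((measurable_extSkewNormalPDF _ _ _).ennreal_ofReal).const_mul _]
  have h2 : ∀ k, ∫⁻ x, ENNReal.ofReal (Ψ.w k) *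
      ENNReal.ofReal (extSkewNormalPDF (Ψ.μ k) (Ψ.σ k) (Ψ.l k) x) = ENNReal.ofReal (Ψ.w k) := by
    intro k
    rw [lintegral_const_mul _ (measurable_extSkewNormalPDF _ _ _).ennreal_ofReal,
      lintegral_extSkewNormalPDF (Ψ.σ_pos k), mul_one]
  simp only [h2]
  rw [← ENNReal.ofReal_sum_of_nonneg fun k _ => Ψ.w_nonneg k, Ψ.w_sum, ENNReal.ofReal_one]

instance : IsProbabilityMeasure Ψ.law :=
  ⟨by rw [law, withDensity_apply _ MeasurableSet.univ, setLIntegral_univ, Ψ.lintegral_pdf]⟩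

lemma integrable_law_iff (f : ℝ → ℝ) :
    Integrable f Ψ.law ↔ Integrable (fun x => Ψ.pdf x * f x) := by
  rw [law, integrable_withDensity_iff_integrable_smul' Ψ.measurable_ofReal_pdf
    (Eventually.of_forall fun _ => ENNReal.ofReal_lt_top)]
  simp only [ENNReal.toReal_ofReal (Ψ.pdf_pos _).le, smul_eq_mul]

lemma integral_law (f : ℝ → ℝ) : ∫ x, f x ∂Ψ.law = ∫ x, Ψ.pdf x * f x := by
  rw [law, integral_withDensity_eq_integral_toReal_smul Ψ.measurable_ofReal_pdf
    (Eventually.of_forall fun _ => ENNReal.ofReal_lt_top)]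
  simp only [ENNReal.toReal_ofReal (Ψ.pdf_pos _).le, smul_eq_mul]

lemma ae_law_iff {q : ℝ → Prop} : (∀ᵐ x ∂Ψ.law, q x) ↔ ∀ᵐ x, q x := by
  rw [law, ae_withDensity_iff Ψ.measurable_ofReal_pdf]
  simp [Ψ.pdf_pos]

lemma integrable_one_add_sq_law : Integrable (fun x : ℝ => 1 + x ^ 2) Ψ.law := by
  rw [integrable_law_iff]
  simp only [pdf, Finset.sum_mul, mul_assoc]
  exact integrable_finsetSum _ fun k _ =>
    (integrable_skewNormalPDF_mul_sq (Ψ.σ_pos k) (Ψ.μ k) (Ψ.l k)).const_mul _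

lemma law_real_Icc_le (a b : ℝ) (hab : a ≤ b) :
    Ψ.law.real (Set.Icc a b) ≤ (∑ k, 1 / Ψ.σ k) * (b - a) := by
  have hM : 0 ≤ ∑ k, 1 / Ψ.σ k := Finset.sum_nonneg fun k _ => (one_div_pos.2 (Ψ.σ_pos k)).le
  have h : Ψ.law (Set.Icc a b) ≤ ENNReal.ofReal ((∑ k, 1 / Ψ.σ k) * (b - a)) := by
    rw [law, withDensity_apply _ measurableSet_Icc]
    calc ∫⁻ x in Set.Icc a b, ENNReal.ofReal (Ψ.pdf x)
        ≤ ∫⁻ x in Set.Icc a b, ENNReal.ofReal (∑ k, 1 / Ψ.σ k) :=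
          lintegral_mono fun x => ENNReal.ofReal_le_ofReal (Ψ.pdf_le x)
      _ = _ := by
          rw [setLIntegral_const, Real.volume_Icc, ENNReal.ofReal_mul hM]
  exact ENNReal.toReal_le_of_le_ofReal (mul_nonneg hM (sub_nonneg.2 hab)) h

/-- The almost sure properties of an infinite sample from the law of `Ψ` that the consistency
proof uses. -/
structure IsTypicalSample (x : ℕ → ℝ) : Prop where
  cell : ∀ (m : ℕ) (c : ℤ), Tendsto (fun n : ℕ =>
      (∑ i ∈ Finset.range n, if ⌊(m : ℝ) * x i⌋ = c then (1 : ℝ) else 0) / n) atTop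
      (𝓝 (Ψ.law.real {y | ⌊(m : ℝ) * y⌋ = c}))
  tail : ∀ ε : ℝ, 0 < ε → ∃ R : ℕ, ∀ R' : ℕ, R ≤ R' → ∀ᶠ n : ℕ in atTop,
      ∑ i ∈ Finset.range n, (if (R' : ℝ) ≤ |x i| then 1 + x i ^ 2 else 0) ≤ ε * n
  window : ∃ C : ℝ, 0 ≤ C ∧ ∀ᶠ n : ℕ in atTop, ∀ μ r : ℝ, 0 ≤ r →
      windowCount x n μ r ≤ C * (n * r) + C * Real.log n

/-- Cells and tails involve countably many integrable functions, so the strong law applies to all of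
them at once; the windows follow from the grid counts. -/
lemma ae_isTypicalSample {Ω : Type*} [MeasurableSpace Ω] {P : Measure Ω} [IsProbabilityMeasure P]
    {X : ℕ → Ω → ℝ} (hindep : iIndepFun X P) (hlaw : ∀ i, HasLaw (X i) Ψ.law P) :
    ∀ᵐ ω ∂P, Ψ.IsTypicalSample fun i => X i ω := by
  have hms : ∀ (m : ℕ) (c : ℤ), MeasurableSet {y : ℝ | ⌊(m : ℝ) * y⌋ = c} := fun m c =>
    (Int.measurable_floor.comp (measurable_const.mul measurable_id)) (measurableSet_singleton c)
  have hcell : ∀ᵐ ω ∂P, ∀ (m : ℕ) (c : ℤ), Tendsto (fun n : ℕ => (∑ i ∈ Finset.range n,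
      if ⌊(m : ℝ) * X i ω⌋ = c then (1 : ℝ) else 0) / n) atTop
      (𝓝 (Ψ.law.real {y | ⌊(m : ℝ) * y⌋ = c})) := by
    rw [ae_all_iff]; intro m
    rw [ae_all_iff]; intro c
    have h := ae_tendsto_average_comp hindep hlaw (measurable_const.indicator (hms m c))
      ((integrable_const (1 : ℝ)).indicator (hms m c))
    rw [integral_indicator_const _ (hms m c)] at h
    simpa [Set.indicator_apply] using h
  set T : ℕ → ℝ → ℝ := fun R y => if (R : ℝ) ≤ |y| then 1 + y ^ 2 else 0 with hT
  have hTset : ∀ R : ℕ, MeasurableSet {y : ℝ | (R : ℝ) ≤ |y|} := fun R =>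
    measurableSet_le measurable_const measurable_id.abs
  have hTm : ∀ R, Measurable (T R) := fun R =>
    Measurable.ite (hTset R) (by fun_prop) measurable_const
  have hTle : ∀ R y, ‖T R y‖ ≤ 1 + y ^ 2 := by
    intro R y
    simp only [hT]
    split_ifs
    · rw [Real.norm_of_nonneg (by positivity)]
    · rw [norm_zero]; positivity
  have hTint : ∀ R, Integrable (T R) Ψ.law := fun R =>
    Ψ.integrable_one_add_sq_law.mono' (hTm R).aestronglyMeasurable
      (Eventually.of_forall (hTle R))
  have hT0 : Tendsto (fun R => ∫ y, T R y ∂Ψ.law) atTop (𝓝 0) := by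
    have := tendsto_integral_of_dominated_convergence (μ := Ψ.law) (F := T) (f := fun _ => 0)
      (fun y => 1 + y ^ 2) (fun R => (hTm R).aestronglyMeasurable) Ψ.integrable_one_add_sq_law
      (fun R => Eventually.of_forall (hTle R)) (Eventually.of_forall fun y => by
        obtain ⟨k, hk⟩ := exists_nat_gt |y|
        refine tendsto_const_nhds.congr' ?_
        filter_upwards [eventually_ge_atTop k] with R hR
        have : (k : ℝ) ≤ R := by exact_mod_cast hR
        simp only [hT]
        rw [if_neg (by linarith)])
    simpa using this
  have htail : ∀ᵐ ω ∂P, ∀ R : ℕ, Tendsto (fun n : ℕ => (∑ i ∈ Finset.range n, T R (X i ω)) / n)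
      atTop (𝓝 (∫ y, T R y ∂Ψ.law)) := by
    rw [ae_all_iff]; intro R
    exact ae_tendsto_average_comp hindep hlaw (hTm R) (hTint R)
  filter_upwards [hcell, htail, ae_eventually_grid_count_lt hindep hlaw] with ω h1 h2 h3
  refine ⟨h1, fun ε hε => ?_, ?_⟩
  · obtain ⟨R, hR⟩ := eventually_atTop.1 ((tendsto_order.1 hT0).2 ε hε)
    refine ⟨R, fun R' hR' => ?_⟩
    filter_upwards [(tendsto_order.1 (h2 R')).2 ε (hR R' hR'), eventually_gt_atTop 0] with n hn hn0
    have hn0' : (0 : ℝ) < n := by exact_mod_cast hn0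
    rw [div_lt_iff₀ hn0'] at hn
    exact hn.le
  · refine eventually_windowCount_le
      (Finset.sum_nonneg fun k _ => (one_div_pos.2 (Ψ.σ_pos k)).le) Ψ.law_real_Icc_le _ ?_ h3
    -- Once `n ≥ m`, the strong law for `1 + y²` gives `1 + x_k² ≤ m n ≤ n²` for every `k < n`, so
    -- the first `n` points lie in `[-n, n]`.
    obtain ⟨m, hm⟩ := exists_nat_gt (∫ y, T 0 y ∂Ψ.law)
    filter_upwards [(tendsto_order.1 (h2 0)).2 m hm, eventually_ge_atTop m,
      eventually_gt_atTop 0] with n hn hnm hn0 k hk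
    have hn0' : (0 : ℝ) < n := by exact_mod_cast hn0
    have hnm' : (m : ℝ) ≤ n := by exact_mod_cast hnm
    rw [div_lt_iff₀ hn0'] at hn
    have h4 : T 0 (X k ω) ≤ ∑ i ∈ Finset.range n, T 0 (X i ω) := by
      refine Finset.single_le_sum (f := fun i => T 0 (X i ω)) (fun i _ => ?_)
        (Finset.mem_range.2 hk)
      simp only [hT]
      split_ifs <;> positivity
    have h5 : T 0 (X k ω) = 1 + X k ω ^ 2 := by simp [hT]
    refine abs_le_of_sq_le_sq (a := X k ω) (b := n) ?_ hn0'.le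
    nlinarith

end MixParam

/-! ### Components with vanishing scale. -/

lemma tendsto_inv_mul_exp_neg_inv : Tendsto (fun s : ℝ => 1 / s * Real.exp (-(1 / s) / 2))
    (𝓝[>] 0) (𝓝 0) := by
  have h1 : Tendsto (fun u : ℝ => u ^ 1 / Real.exp (1 / 2 * u)) atTop (𝓝 0) :=
    (isLittleO_pow_exp_pos_mul_atTop 1 (by norm_num : (0 : ℝ) < 1 / 2)).tendsto_div_nhds_zero
  refine (h1.comp tendsto_inv_nhdsGT_zero).congr fun s => ?_
  simp only [Function.comp_apply, pow_one, div_eq_mul_inv (s⁻¹), ← Real.exp_neg, one_div]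
  ring_nf

/-- At distance more than `√s` the squared standardized distance exceeds `1/s`. The resulting bound
tends to `0` with `s`, so a degenerate component matters only inside its window of radius `√s`. -/
lemma skewNormalPDF_le_of_sqrt_lt {m s l y : ℝ} (hs : 0 < s) (hy : √s < |y - m|) :
    skewNormalPDF m s l y ≤ 1 / s * Real.exp (-(1 / s) / 2) := by
  have h := extSkewNormalPDF_le hs m l y
  rw [extSkewNormalPDF_coe] at h
  refine h.trans (mul_le_mul_of_nonneg_left (Real.exp_le_exp.2 ?_) (by positivity))
  have h1 : s ≤ (y - m) ^ 2 := by
    rw [← sq_abs, ← Real.sq_sqrt hs.le]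
    exact pow_le_pow_left₀ (Real.sqrt_nonneg _) hy.le 2
  have h2 : 1 / s ≤ ((y - m) / s) ^ 2 := by
    rw [div_pow, div_le_div_iff₀ hs (by positivity)]
    nlinarith
  exact div_le_div_of_nonneg_right (neg_le_neg h2) zero_le_two

/-- Logarithmic contributions of the sample points near a component with vanishing scale. -/
lemma windowCount_mul_log_add_penalty_le {x : ℕ → ℝ} {C : ℝ} (hC : 0 ≤ C)
    (hw : ∀ᶠ n : ℕ in atTop, ∀ μ r : ℝ, 0 ≤ r →
      windowCount x n μ r ≤ C * (n * r) + C * Real.log n)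
    {a : ℕ → ℝ → ℝ} (h1 : CondC1 a) (h2 : CondC2 a) {N : ℕ → ℕ} (hN : Tendsto N atTop atTop)
    {m s : ℕ → ℝ} (hs : ∀ j, 0 < s j) (hs0 : Tendsto s atTop (𝓝 0)) (ε : ℝ) (hε : 0 < ε) :
    ∀ᶠ j in atTop, 2 * (windowCount x (N j) (m j) √(s j) * Real.log (1 / s j)) +
      a (N j) (s j) ≤ ε * N j := by
  have hNr : Tendsto (fun j => (N j : ℝ)) atTop atTop := tendsto_natCast_atTop_atTop.comp hN
  have hlogN : Tendsto (fun j => Real.log (N j)) atTop atTop := Real.tendsto_log_atTop.comp hNr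
  have hs0' : Tendsto s atTop (𝓝[>] 0) :=
    tendsto_nhdsWithin_iff.2 ⟨hs0, Eventually.of_forall hs⟩
  have e1 : ∀ᶠ j in atTop, 2 * C * (√(s j) * Real.log (1 / s j)) ≤ ε / 3 := by
    have h := (tendsto_log_mul_rpow_nhdsGT_zero (r := 1 / 2) (by norm_num)).comp hs0'
    have h' := (h.neg).const_mul (2 * C)
    rw [neg_zero, mul_zero] at h'
    filter_upwards [(tendsto_order.1 h').2 (ε / 3) (by positivity)] with j hj
    refine le_trans (le_of_eq ?_) hj.le
    rw [one_div, Real.log_inv, Real.sqrt_eq_rpow]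
    simp only [Function.comp_apply]
    ring
  have e2 : ∀ᶠ j in atTop, 4 * C * Real.log (N j) ^ 2 ≤ ε / 3 * N j := by
    have h := (Real.isLittleO_pow_log_id_atTop (n := 2)).comp_tendsto hNr
    have hc : 0 < ε / 3 / (4 * C + 1) := by positivity
    filter_upwards [h.bound hc] with j hj
    simp only [Function.comp_apply, id_eq, Real.norm_eq_abs, abs_pow, sq_abs,
      Nat.abs_cast] at hj
    rw [div_mul_eq_mul_div, le_div_iff₀ (by positivity)] at hj
    nlinarith [sq_nonneg (Real.log (N j))]
  have e3 : ∀ᶠ j in atTop, 2 * (C + C * Real.log (N j)) ≤ Real.log (N j) ^ 2 := by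
    filter_upwards [hlogN.eventually_ge_atTop (4 * C + 1)] with j hj
    nlinarith
  filter_upwards [e1, e2, e3, hN.eventually hw, hN.eventually (h1.2 (ε / 3) (by positivity)),
    hN.eventually h2, hlogN.eventually_ge_atTop 1, hNr.eventually_ge_atTop 1,
    hs0.eventually_lt_const one_pos] with j f1 f2 f3 f4 f5 f6 f7 f8 f9
  have hsj := hs j
  have hlog : 0 < Real.log (1 / s j) := Real.log_pos ((one_lt_div hsj).2 f9)
  have hlogs : Real.log (1 / s j) = -Real.log (s j) := by rw [one_div, Real.log_inv]
  have g := f4 (m j) √(s j) (Real.sqrt_nonneg _)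
  have hN0 : (0 : ℝ) < N j := by linarith
  -- If `N √s < 1`, the window holds `O(log N)` points, and the penalty `(log N)² log s` of C2
  -- outweighs their contribution. Otherwise `log (1/s) ≤ 2 log N`, the contribution is `o(N)` by
  -- the count bound and `√s log (1/s) → 0`, and C1 bounds the penalty.
  by_cases hcase : N j * √(s j) < 1
  · have g1 : 2 * windowCount x (N j) (m j) √(s j) ≤ Real.log (N j) ^ 2 := by nlinarith
    have hsmall : s j < (N j : ℝ)⁻¹ * Real.log (N j) := by
      have q1 : √(s j) < (N j : ℝ)⁻¹ := by
        rw [lt_inv_comm₀ (Real.sqrt_pos.2 hsj) hN0, lt_inv_comm₀ hN0 (Real.sqrt_pos.2 hsj),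
          inv_eq_one_div, lt_div_iff₀ hN0]
        linarith
      have q2 : s j ≤ √(s j) := by
        have := Real.sq_sqrt hsj.le
        have : √(s j) ≤ 1 := Real.sqrt_le_one.2 f9.le
        nlinarith [Real.sqrt_nonneg (s j)]
      have q3 : 0 < (N j : ℝ)⁻¹ := by positivity
      exact q2.trans_lt (q1.trans_le (le_mul_of_one_le_right q3.le f7))
    have g2 := f6 (s j) hsj hsmall
    have g3 := mul_le_mul_of_nonneg_right g1 hlog.le
    rw [hlogs] at g3 ⊢
    have : 0 ≤ ε * N j := by positivity
    linarith
  · have hge : 1 ≤ N j * √(s j) := not_lt.1 hcase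
    have g1 : Real.log (1 / s j) ≤ 2 * Real.log (N j) := by
      have : 1 / s j ≤ (N j : ℝ) ^ 2 := by
        rw [div_le_iff₀ hsj]
        have := Real.sq_sqrt hsj.le
        nlinarith
      have h3 := Real.log_le_log (by positivity) this
      rw [Real.log_pow] at h3
      exact_mod_cast h3
    have g2 := mul_le_mul_of_nonneg_right g hlog.le
    have g3 : C * Real.log (N j) * Real.log (1 / s j) ≤
        C * Real.log (N j) * (2 * Real.log (N j)) :=
      mul_le_mul_of_nonneg_left g1 (by positivity)
    have g4 := mul_le_mul_of_nonneg_right f1 hN0.le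
    have g5 := (le_max_right 0 (a (N j) (s j))).trans (f5 (s j) hsj)
    nlinarith

lemma eventually_windowCount_le_mul {x : ℕ → ℝ} {C : ℝ} (hC : 0 ≤ C)
    (hw : ∀ᶠ n : ℕ in atTop, ∀ μ r : ℝ, 0 ≤ r →
      windowCount x n μ r ≤ C * (n * r) + C * Real.log n)
    {N : ℕ → ℕ} (hN : Tendsto N atTop atTop)
    {m s : ℕ → ℝ} (hs0 : Tendsto s atTop (𝓝 0)) (ε : ℝ) (hε : 0 < ε) :
    ∀ᶠ j in atTop, windowCount x (N j) (m j) √(s j) ≤ ε * N j := by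
  have hNr : Tendsto (fun j => (N j : ℝ)) atTop atTop := tendsto_natCast_atTop_atTop.comp hN
  have e1 : ∀ᶠ j in atTop, C * √(s j) ≤ ε / 2 := by
    have h : Tendsto (fun j => C * √(s j)) atTop (𝓝 0) := by
      have := ((Real.continuous_sqrt.tendsto 0).comp hs0).const_mul C
      simpa using this
    exact h.eventually_le_const (by positivity)
  have e2 : ∀ᶠ j in atTop, C * Real.log (N j) ≤ ε / 2 * N j := by
    have h := Real.isLittleO_log_id_atTop.comp_tendsto hNr
    have hc : 0 < ε / 2 / (C + 1) := by positivity
    filter_upwards [h.bound hc, hNr.eventually_ge_atTop 1] with j hj hj1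
    simp only [Function.comp_apply, id_eq, Real.norm_eq_abs, Nat.abs_cast] at hj
    rw [abs_of_nonneg (Real.log_nonneg hj1), div_mul_eq_mul_div, le_div_iff₀ (by positivity)] at hj
    nlinarith [Real.log_nonneg hj1]
  filter_upwards [e1, e2, hN.eventually hw] with j f1 f2 f3
  have g := f3 (m j) √(s j) (Real.sqrt_nonneg _)
  have := mul_le_mul_of_nonneg_right f1 (Nat.cast_nonneg (α := ℝ) (N j))
  linarith

/-- The extra terms `log (1 + 1/f₀)` are bounded on `|x| < R`, where the window holds `o(N)` points;
for `|x| ≥ R` they grow at most quadratically and fall under the tail property. -/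
lemma MixParam.IsTypicalSample.eventually_sum_window_add_penalty_le {p : ℕ} {Ψ₀ : MixParam p}
    {x : ℕ → ℝ} (hx : Ψ₀.IsTypicalSample x) {a : ℕ → ℝ → ℝ} (h1 : CondC1 a) (h2 : CondC2 a)
    {N : ℕ → ℕ} (hN : Tendsto N atTop atTop) {m s : ℕ → ℝ} (hs : ∀ j, 0 < s j)
    (hs0 : Tendsto s atTop (𝓝 0)) (ε : ℝ) (hε : 0 < ε) :
    ∀ᶠ j in atTop, 2 * ∑ i ∈ Finset.range (N j), (if |x i - m j| ≤ √(s j) then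
      Real.log (1 / s j) + Real.log (1 + 1 / Ψ₀.pdf (x i)) else 0) + a (N j) (s j) ≤
      ε * N j := by
  obtain ⟨C, hC, hw⟩ := hx.window
  obtain ⟨K, hK, hL⟩ := Ψ₀.exists_log_one_add_div_pdf_le 1 zero_le_one
  obtain ⟨R, hR⟩ := hx.tail (ε / 6 / (K + 1)) (by positivity)
  have hKR : 0 ≤ K * (1 + (R : ℝ) ^ 2) := by positivity
  filter_upwards [windowCount_mul_log_add_penalty_le hC hw h1 h2 hN hs hs0 (ε / 3) (by positivity),
    eventually_windowCount_le_mul hC hw hN (m := m) hs0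
      (ε / 6 / (K * (1 + (R : ℝ) ^ 2) + 1)) (by positivity),
    hN.eventually (hR R le_rfl)] with j f1 f2 f3
  have hsum1 : ∑ i ∈ Finset.range (N j), (if |x i - m j| ≤ √(s j) then
      Real.log (1 / s j) + Real.log (1 + 1 / Ψ₀.pdf (x i)) else 0) =
      windowCount x (N j) (m j) √(s j) * Real.log (1 / s j) +
      ∑ i ∈ Finset.range (N j), (if |x i - m j| ≤ √(s j) then
        Real.log (1 + 1 / Ψ₀.pdf (x i)) else 0) := by
    rw [windowCount, ← nsmul_eq_mul, ← Finset.sum_const, Finset.sum_filter,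
      ← Finset.sum_add_distrib]
    refine Finset.sum_congr rfl fun i _ => ?_
    split_ifs <;> simp
  have hsum2 : ∑ i ∈ Finset.range (N j), (if |x i - m j| ≤ √(s j) then
        Real.log (1 + 1 / Ψ₀.pdf (x i)) else 0) ≤
      windowCount x (N j) (m j) √(s j) * (K * (1 + (R : ℝ) ^ 2)) +
      K * ∑ i ∈ Finset.range (N j), (if (R : ℝ) ≤ |x i| then 1 + x i ^ 2 else 0) := by
    rw [windowCount, ← nsmul_eq_mul, ← Finset.sum_const, Finset.sum_filter, Finset.mul_sum,
      ← Finset.sum_add_distrib]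
    refine Finset.sum_le_sum fun i _ => ?_
    have h3 := hL (x i)
    have h4 : 0 ≤ K * (1 + x i ^ 2) := by positivity
    split_ifs with c1 c2
    · linarith
    · have : x i ^ 2 ≤ (R : ℝ) ^ 2 := by
        rw [← sq_abs]; exact pow_le_pow_left₀ (abs_nonneg _) (not_le.1 c2).le 2
      have := mul_le_mul_of_nonneg_left this hK
      linarith
    · linarith
    · simp
  have hNn : (0 : ℝ) ≤ N j := Nat.cast_nonneg _
  have g1 : windowCount x (N j) (m j) √(s j) * (K * (1 + (R : ℝ) ^ 2)) ≤ ε / 6 * N j := by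
    refine (mul_le_mul_of_nonneg_right f2 hKR).trans ?_
    have : K * (1 + (R : ℝ) ^ 2) / (K * (1 + (R : ℝ) ^ 2) + 1) ≤ 1 :=
      (div_le_one (by positivity)).2 (by linarith)
    calc _ = ε / 6 * N j * (K * (1 + (R : ℝ) ^ 2) / (K * (1 + (R : ℝ) ^ 2) + 1)) := by ring
      _ ≤ _ := mul_le_of_le_one_right (by positivity) this
  have g2 : K * ∑ i ∈ Finset.range (N j), (if (R : ℝ) ≤ |x i| then 1 + x i ^ 2 else 0) ≤
      ε / 6 * N j := by
    refine (mul_le_mul_of_nonneg_left f3 hK).trans ?_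
    have : K / (K + 1) ≤ 1 := (div_le_one (by positivity)).2 (by linarith)
    calc _ = ε / 6 * N j * (K / (K + 1)) := by ring
      _ ≤ _ := mul_le_of_le_one_right (by positivity) this
  rw [hsum1]
  linarith

open Classical in
/-- The skew normal density, set to `0` near its location if the limit scale `S` is `0`. -/
def cutSkewNormalPDF (S : EReal) (m s l y : ℝ) : ℝ :=
  if S = 0 ∧ |y - m| ≤ √s then 0 else skewNormalPDF m s l y

open Classical in
/-- The pointwise limit of skew normal densities whose parameters converge in the extended line. -/
def limitSkewNormalPDF (M S L : EReal) (y : ℝ) : ℝ :=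
  if (M ≠ ⊥ ∧ M ≠ ⊤) ∧ (0 < S ∧ S ≠ ⊤) then extSkewNormalPDF M.toReal S.toReal L y else 0

lemma cutSkewNormalPDF_nonneg (S : EReal) {s : ℝ} (hs : 0 < s) (m l y : ℝ) :
    0 ≤ cutSkewNormalPDF S m s l y := by
  unfold cutSkewNormalPDF
  split_ifs
  · exact le_rfl
  · exact (skewNormalPDF_pos hs _ _ _).le

lemma cutSkewNormalPDF_le_inv (S : EReal) {s : ℝ} (hs : 0 < s) (m l y : ℝ) :
    cutSkewNormalPDF S m s l y ≤ 1 / s := by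
  unfold cutSkewNormalPDF
  split_ifs
  · positivity
  · exact skewNormalPDF_le_inv hs _ _ _

lemma cutSkewNormalPDF_zero_le {s : ℝ} (hs : 0 < s) (m l y : ℝ) :
    cutSkewNormalPDF 0 m s l y ≤ 1 / s * Real.exp (-(1 / s) / 2) := by
  unfold cutSkewNormalPDF
  split_ifs with h
  · positivity
  · exact skewNormalPDF_le_of_sqrt_lt hs (not_le.1 fun h' => h ⟨rfl, h'⟩)

section
variable {m s l : ℕ → ℝ} {M S L : EReal}

/-- A positive limit scale keeps the scales away from `0`; for limit scale `0` the cut removes the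
peak. -/
lemma exists_eventually_cutSkewNormalPDF_le (hs : ∀ j, 0 < s j)
    (hS : Tendsto (fun j => (s j : EReal)) atTop (𝓝 S)) :
    ∃ B : ℝ, 0 ≤ B ∧ ∀ᶠ j in atTop, ∀ y, cutSkewNormalPDF S (m j) (s j) (l j) y ≤ B := by
  have hS0 : 0 ≤ S := ge_of_tendsto' hS fun j => by exact_mod_cast (hs j).le
  rcases hS0.eq_or_lt with rfl | hpos
  · rw [← EReal.coe_zero, EReal.tendsto_coe] at hS
    have hs0' : Tendsto s atTop (𝓝[>] 0) :=
      tendsto_nhdsWithin_iff.2 ⟨hS, Eventually.of_forall hs⟩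
    refine ⟨1, zero_le_one, ?_⟩
    filter_upwards [(tendsto_inv_mul_exp_neg_inv.comp hs0').eventually_le_const one_pos] with j hj y
    exact (cutSkewNormalPDF_zero_le (hs j) _ _ _).trans hj
  · obtain ⟨δ, hδ0, hδS⟩ := EReal.lt_iff_exists_real_btwn.1 hpos
    have hδ : 0 < δ := by exact_mod_cast hδ0
    refine ⟨1 / δ, by positivity, ?_⟩
    filter_upwards [(tendsto_order.1 hS).1 _ hδS] with j hj y
    have hj' : δ < s j := by exact_mod_cast hj
    exact (cutSkewNormalPDF_le_inv S (hs j) _ _ _).trans (one_div_le_one_div_of_le hδ hj'.le)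

/-- Convergence along `atTop ×ˢ 𝓝 y` is continuous convergence, as the averaging lemma requires. The
limit is `0` when the scale degenerates or the location escapes; infinite shapes survive as
half-normal densities. -/
lemma tendsto_cutSkewNormalPDF (hs : ∀ j, 0 < s j)
    (hM : Tendsto (fun j => (m j : EReal)) atTop (𝓝 M))
    (hS : Tendsto (fun j => (s j : EReal)) atTop (𝓝 S))
    (hL : Tendsto (fun j => (l j : EReal)) atTop (𝓝 L)) {y : ℝ} (hy : y ≠ M.toReal) :
    Tendsto (fun q : ℕ × ℝ => cutSkewNormalPDF S (m q.1) (s q.1) (l q.1) q.2) (atTop ×ˢ 𝓝 y)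
      (𝓝 (limitSkewNormalPDF M S L y)) := by
  have hS0 : 0 ≤ S := ge_of_tendsto' hS fun j => by exact_mod_cast (hs j).le
  have hfst : Tendsto (fun q : ℕ × ℝ => q.1) (atTop ×ˢ 𝓝 y) atTop := tendsto_fst
  have hsnd : Tendsto (fun q : ℕ × ℝ => q.2) (atTop ×ˢ 𝓝 y) (𝓝 y) := tendsto_snd
  have hnn : ∀ q : ℕ × ℝ, 0 ≤ cutSkewNormalPDF S (m q.1) (s q.1) (l q.1) q.2 :=
    fun q => cutSkewNormalPDF_nonneg S (hs _) _ _ _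
  rcases hS0.eq_or_lt with rfl | hpos
  · rw [limitSkewNormalPDF, if_neg (by simp)]
    rw [← EReal.coe_zero, EReal.tendsto_coe] at hS
    have hs0' : Tendsto s atTop (𝓝[>] 0) :=
      tendsto_nhdsWithin_iff.2 ⟨hS, Eventually.of_forall hs⟩
    exact squeeze_zero hnn (fun q => cutSkewNormalPDF_zero_le (hs _) _ _ _)
      ((tendsto_inv_mul_exp_neg_inv.comp hs0').comp hfst)
  have hcut : ∀ q : ℕ × ℝ, cutSkewNormalPDF S (m q.1) (s q.1) (l q.1) q.2 =
      skewNormalPDF (m q.1) (s q.1) (l q.1) q.2 := fun q => by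
    rw [cutSkewNormalPDF, if_neg fun h => hpos.ne' h.1]
  induction S with
  | bot => simp at hpos
  | top =>
    rw [limitSkewNormalPDF, if_neg (by simp)]
    rw [EReal.tendsto_coe_nhds_top_iff] at hS
    refine squeeze_zero hnn (fun q => cutSkewNormalPDF_le_inv _ (hs _) _ _ _)
      (g := fun q => 1 / s q.1) ?_
    simpa [Function.comp_def] using tendsto_inv_atTop_zero.comp (hS.comp hfst)
  | coe σ =>
    have hσ : 0 < σ := by exact_mod_cast hpos
    rw [EReal.tendsto_coe] at hS
    have hS' := hS.comp hfst
    simp only [hcut]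
    have hesc : Tendsto (fun q : ℕ × ℝ => |q.2 - m q.1|) (atTop ×ˢ 𝓝 y) atTop →
        Tendsto (fun q : ℕ × ℝ => skewNormalPDF (m q.1) (s q.1) (l q.1) q.2) (atTop ×ˢ 𝓝 y)
          (𝓝 0) := by
      intro h
      refine squeeze_zero
        (g := fun q : ℕ × ℝ => 1 / s q.1 * Real.exp (-((q.2 - m q.1) / s q.1) ^ 2 / 2))
        (fun q => (skewNormalPDF_pos (hs _) _ _ _).le) (fun q => by
        have := extSkewNormalPDF_le (hs q.1) (m q.1) (l q.1) q.2
        rwa [extSkewNormalPDF_coe] at this) ?_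
      have h3 : Tendsto (fun q : ℕ × ℝ => |q.2 - m q.1| * (s q.1)⁻¹) (atTop ×ˢ 𝓝 y) atTop :=
        h.atTop_mul_pos (inv_pos.2 hσ) (hS'.inv₀ hσ.ne')
      have h4 : Tendsto (fun t : ℝ => Real.exp (-t ^ 2 / 2)) atTop (𝓝 0) := by
        refine Real.tendsto_exp_atBot.comp ?_
        have : Tendsto (fun t : ℝ => -(t ^ 2 * (1 / 2))) atTop atBot :=
          tendsto_neg_atTop_atBot.comp
            ((tendsto_pow_atTop two_ne_zero).atTop_mul_const (by norm_num))
        refine this.congr fun t => by ring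
      have h5 := ((hS'.inv₀ hσ.ne').mul (h4.comp h3))
      rw [mul_zero] at h5
      refine h5.congr fun q => ?_
      simp only [Function.comp_apply, mul_pow, sq_abs, one_div, div_pow, inv_pow]
      ring_nf
    induction M with
    | bot =>
      rw [limitSkewNormalPDF, if_neg (by simp)]
      rw [EReal.tendsto_coe_nhds_bot_iff] at hM
      refine hesc (tendsto_abs_atTop_atTop.comp ?_)
      simpa [sub_eq_add_neg] using hsnd.add_atTop (tendsto_neg_atBot_atTop.comp (hM.comp hfst))
    | top =>
      rw [limitSkewNormalPDF, if_neg (by simp)]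
      rw [EReal.tendsto_coe_nhds_top_iff] at hM
      refine hesc (tendsto_abs_atBot_atTop.comp ?_)
      simpa [sub_eq_add_neg] using hsnd.add_atBot (tendsto_neg_atTop_atBot.comp (hM.comp hfst))
    | coe μ =>
      rw [EReal.tendsto_coe] at hM
      rw [limitSkewNormalPDF, if_pos (by simp [hσ])]
      have := tendsto_extSkewNormalPDF hσ (hM.comp hfst) hS' (hL.comp hfst) hsnd hy
      refine this.congr fun q => ?_
      exact extSkewNormalPDF_coe _ _ _ _

open Classical in
-- Treats all limit scales alike: when `S ≠ 0` no point is cut out and C1 alone bounds the penalty.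
lemma MixParam.IsTypicalSample.eventually_component_penalty_le {p : ℕ} {Ψ₀ : MixParam p}
    {x : ℕ → ℝ} (hx : Ψ₀.IsTypicalSample x) {a : ℕ → ℝ → ℝ} (h1 : CondC1 a) (h2 : CondC2 a)
    {N : ℕ → ℕ} (hN : Tendsto N atTop atTop) (hs : ∀ j, 0 < s j)
    (hS : Tendsto (fun j => (s j : EReal)) atTop (𝓝 S)) (ε : ℝ) (hε : 0 < ε) :
    ∀ᶠ j in atTop, 2 * ∑ i ∈ Finset.range (N j), (if S = 0 ∧ |x i - m j| ≤ √(s j) then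
      Real.log (1 / s j) + Real.log (1 + 1 / Ψ₀.pdf (x i)) else 0) + a (N j) (s j) ≤
      ε * N j := by
  by_cases h0 : S = 0
  · subst h0
    rw [← EReal.coe_zero, EReal.tendsto_coe] at hS
    simpa using hx.eventually_sum_window_add_penalty_le h1 h2 hN hs hS ε hε
  · filter_upwards [hN.eventually (h1.2 ε hε)] with j hj
    simp only [h0, false_and, if_false, Finset.sum_const_zero, mul_zero, zero_add]
    exact (le_max_right _ _).trans (hj _ (hs j))

end

/-! ### Pointwise bound on the log-likelihood ratio. -/

lemma log_one_add_add_sum_le {ι : Type*} (t : Finset ι) (b : ι → ℝ) (hb : ∀ i, 0 ≤ b i) {v : ℝ}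
    (hv : 0 ≤ v) :
    Real.log (1 + v + ∑ i ∈ t, b i) ≤ Real.log (1 + v) + ∑ i ∈ t, Real.log (1 + b i) := by
  classical
  induction t using Finset.induction_on with
  | empty => simp
  | insert i t hi ih =>
    rw [Finset.sum_insert hi, Finset.sum_insert hi]
    have h0 : 0 ≤ ∑ i ∈ t, b i := Finset.sum_nonneg fun i _ => hb i
    have h1 := hb i
    have h2 : Real.log (1 + v + (b i + ∑ i ∈ t, b i)) ≤
        Real.log ((1 + v + ∑ i ∈ t, b i) * (1 + b i)) :=
      Real.log_le_log (by positivity) (by nlinarith [mul_nonneg h1 h0, mul_nonneg h1 hv])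
    rw [Real.log_mul (by positivity) (by positivity)] at h2
    linarith

lemma log_le_two_mul_log_one_add {u : ℝ} (hu : 0 < u) :
    Real.log u ≤ 2 * Real.log (1 + u) - 2 * Real.log 2 := by
  have h : Real.log (2 ^ 2 * u) ≤ Real.log ((1 + u) ^ 2) :=
    Real.log_le_log (by positivity) (by nlinarith [sq_nonneg (1 - u)])
  rw [Real.log_mul (by positivity) hu.ne', Real.log_pow, Real.log_pow] at h
  push_cast at h
  linarith

open Classical in
-- Bound the density ratio by its cut part `v` plus peaks `1 / (σ f₀)` on the windows. The
-- subadditivity of `log (1 + ·)` separates the peaks, and `σ ≤ 1` splits `log (1 + 1 / (σ f₀))`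
-- into `log (1/σ) + log (1 + 1/f₀)`.
lemma MixParam.log_pdf_sub_log_pdf_le {p p₀ : ℕ} (Ψ : MixParam p) (Ψ₀ : MixParam p₀)
    (S : Fin p → EReal) (hS : ∀ k, S k = 0 → Ψ.σ k ≤ 1) (y : ℝ) :
    Real.log (Ψ.pdf y) - Real.log (Ψ₀.pdf y) ≤
      2 * Real.log (1 + (∑ k, Ψ.w k * cutSkewNormalPDF (S k) (Ψ.μ k) (Ψ.σ k) (Ψ.l k) y) /
        Ψ₀.pdf y) - 2 * Real.log 2 +
      ∑ k, 2 * (if S k = 0 ∧ |y - Ψ.μ k| ≤ √(Ψ.σ k) then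
        Real.log (1 / Ψ.σ k) + Real.log (1 + 1 / Ψ₀.pdf y) else 0) := by
  set f₀ := Ψ₀.pdf y
  have hf₀ : 0 < f₀ := Ψ₀.pdf_pos y
  have hf := Ψ.pdf_pos y
  set v := (∑ k, Ψ.w k * cutSkewNormalPDF (S k) (Ψ.μ k) (Ψ.σ k) (Ψ.l k) y) / f₀
  have hv : 0 ≤ v := div_nonneg (Finset.sum_nonneg fun k _ => mul_nonneg (Ψ.w_nonneg k)
    (cutSkewNormalPDF_nonneg _ (Ψ.σ_pos k) _ _ _)) hf₀.le
  set b : Fin p → ℝ := fun k =>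
    if S k = 0 ∧ |y - Ψ.μ k| ≤ √(Ψ.σ k) then 1 / Ψ.σ k / f₀ else 0 with hb
  have hb0 : ∀ k, 0 ≤ b k := fun k => by
    have := Ψ.σ_pos k
    simp only [hb]; split_ifs <;> positivity
  have hu : Ψ.pdf y / f₀ ≤ v + ∑ k, b k := by
    simp only [MixParam.pdf, v]
    rw [Finset.sum_div, Finset.sum_div, ← Finset.sum_add_distrib]
    refine Finset.sum_le_sum fun k _ => ?_
    have hpos := skewNormalPDF_pos (Ψ.σ_pos k) (Ψ.μ k) (Ψ.l k) y
    simp only [hb, cutSkewNormalPDF]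
    split_ifs with h
    · rw [mul_zero, zero_div, zero_add]
      refine div_le_div_of_nonneg_right ?_ hf₀.le
      exact (mul_le_of_le_one_left hpos.le (Ψ.w_le_one k)).trans
        (skewNormalPDF_le_inv (Ψ.σ_pos k) _ _ _)
    · rw [add_zero]
  have hblog : ∀ k, Real.log (1 + b k) ≤ if S k = 0 ∧ |y - Ψ.μ k| ≤ √(Ψ.σ k) then
        Real.log (1 / Ψ.σ k) + Real.log (1 + 1 / f₀) else 0 := by
    intro k
    have hσ := Ψ.σ_pos k
    simp only [hb]
    split_ifs with h
    · rw [← Real.log_mul (by positivity) (by positivity)]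
      refine Real.log_le_log (by positivity) ?_
      have : 1 ≤ 1 / Ψ.σ k := (one_le_div hσ).2 (hS k h.1)
      have h2 : 1 / Ψ.σ k * (1 + 1 / f₀) = 1 / Ψ.σ k + 1 / Ψ.σ k / f₀ := by ring
      rw [h2]
      exact add_le_add_left this _
    · simp
  have h1 := log_le_two_mul_log_one_add (div_pos hf hf₀)
  rw [Real.log_div hf.ne' hf₀.ne'] at h1
  have h2 : Real.log (1 + Ψ.pdf y / f₀) ≤ Real.log (1 + v + ∑ k, b k) :=
    Real.log_le_log (by positivity) (by linarith)
  have h3 := log_one_add_add_sum_le Finset.univ b hb0 hv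
  have h4 := Finset.sum_le_sum fun k (_ : k ∈ Finset.univ) => hblog k
  rw [← Finset.mul_sum]
  linarith

/-! ### The limit mixture density equals the true density. -/

lemma integrable_extSkewNormalPDF {σ : ℝ} (hσ : 0 < σ) (μ : ℝ) (l : EReal) :
    Integrable (extSkewNormalPDF μ σ l) ∧ ∫ x, extSkewNormalPDF μ σ l x = 1 := by
  have h := lintegral_extSkewNormalPDF hσ μ l
  have hm := (measurable_extSkewNormalPDF μ σ l).aestronglyMeasurable (μ := volume)
  have h0 : 0 ≤ᵐ[volume] extSkewNormalPDF μ σ l :=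
    Eventually.of_forall (extSkewNormalPDF_nonneg hσ μ l)
  refine ⟨⟨hm, ?_⟩, ?_⟩
  · rw [hasFiniteIntegral_iff_ofReal h0, h]; exact ENNReal.one_lt_top
  · rw [integral_eq_lintegral_of_nonneg_ae h0 hm, h, ENNReal.toReal_one]

lemma limitSkewNormalPDF_nonneg (M S L : EReal) (y : ℝ) : 0 ≤ limitSkewNormalPDF M S L y := by
  unfold limitSkewNormalPDF
  split_ifs with h
  · exact extSkewNormalPDF_nonneg (EReal.toReal_pos h.2.1 h.2.2) _ _ _
  · exact le_rfl

lemma measurable_limitSkewNormalPDF (M S L : EReal) : Measurable (limitSkewNormalPDF M S L) := by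
  unfold limitSkewNormalPDF
  split_ifs with h
  · exact measurable_extSkewNormalPDF _ _ _
  · exact measurable_const

lemma integrable_limitSkewNormalPDF (M S L : EReal) :
    Integrable (limitSkewNormalPDF M S L) ∧ ∫ x, limitSkewNormalPDF M S L x ≤ 1 := by
  unfold limitSkewNormalPDF
  split_ifs with h
  · have := integrable_extSkewNormalPDF (EReal.toReal_pos h.2.1 h.2.2) M.toReal L
    exact ⟨this.1, this.2.le⟩
  · simp

section
variable {p p₀ : ℕ} {Ψ₀ : MixParam p₀} {Ψ : ℕ → MixParam p} {W : Fin p → ℝ}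
  {M S L : Fin p → EReal}

/-- Componentwise convergence of mixture parameters in the extended line. -/
structure MixParamTendsto (Ψ : ℕ → MixParam p) (W : Fin p → ℝ) (M S L : Fin p → EReal) : Prop where
  w : ∀ k, Tendsto (fun j => (Ψ j).w k) atTop (𝓝 (W k))
  μ : ∀ k, Tendsto (fun j => ((Ψ j).μ k : EReal)) atTop (𝓝 (M k))
  σ : ∀ k, Tendsto (fun j => ((Ψ j).σ k : EReal)) atTop (𝓝 (S k))
  l : ∀ k, Tendsto (fun j => ((Ψ j).l k : EReal)) atTop (𝓝 (L k))

lemma MixParamTendsto.W_nonneg (h : MixParamTendsto Ψ W M S L) (k : Fin p) : 0 ≤ W k :=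
  ge_of_tendsto' (h.w k) fun j => (Ψ j).w_nonneg k

lemma MixParamTendsto.sum_W (h : MixParamTendsto Ψ W M S L) : ∑ k, W k = 1 := by
  have := tendsto_finsetSum Finset.univ fun k _ => h.w k
  simp only [(Ψ _).w_sum] at this
  exact (tendsto_nhds_unique this tendsto_const_nhds)

set_option maxHeartbeats 400000 in
/-- The limit mixture density has at least the Kullback-Leibler type score of the truth. -/
lemma MixParamTendsto.two_mul_log_two_le_integral (h : MixParamTendsto Ψ W M S L) {x : ℕ → ℝ}
    (hx : Ψ₀.IsTypicalSample x) {a b : ℕ → ℝ → ℝ} (h1 : CondC1 a) (h2 : CondC2 a) (h3 : CondC3 b)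
    (hb : ∀ l : ℝ, (fun n => b n l) =o[atTop] fun n : ℕ => (n : ℝ)) {N : ℕ → ℕ}
    (hN : Tendsto N atTop atTop)
    (hlik : ∀ ε : ℝ, 0 < ε → ∀ᶠ j in atTop, -(ε * N j) ≤
      (Ψ j).penLogLik (N j) x (a (N j)) (b (N j)) - Ψ₀.penLogLik (N j) x (a (N j)) (b (N j))) :
    Integrable (fun y => 2 * Real.log (1 + (∑ k, W k * limitSkewNormalPDF (M k) (S k) (L k) y) /
      Ψ₀.pdf y)) Ψ₀.law ∧
    2 * Real.log 2 ≤ ∫ y, 2 * Real.log (1 +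
      (∑ k, W k * limitSkewNormalPDF (M k) (S k) (L k) y) / Ψ₀.pdf y) ∂Ψ₀.law := by
  classical
  set g : ℝ → ℝ := fun y => 2 * Real.log (1 +
      (∑ k, W k * limitSkewNormalPDF (M k) (S k) (L k) y) / Ψ₀.pdf y) with hg
  set H : ℕ → ℝ → ℝ := fun j y => 2 * Real.log (1 + (∑ k, (Ψ j).w k *
    cutSkewNormalPDF (S k) ((Ψ j).μ k) ((Ψ j).σ k) ((Ψ j).l k) y) / Ψ₀.pdf y) with hH
  have hNr : Tendsto (fun j => (N j : ℝ)) atTop atTop := tendsto_natCast_atTop_atTop.comp hN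
  have hcut0 : ∀ j y, 0 ≤ ∑ k, (Ψ j).w k *
      cutSkewNormalPDF (S k) ((Ψ j).μ k) ((Ψ j).σ k) ((Ψ j).l k) y := fun j y =>
    Finset.sum_nonneg fun k _ => mul_nonneg ((Ψ j).w_nonneg k)
      (cutSkewNormalPDF_nonneg _ ((Ψ j).σ_pos k) _ _ _)
  have hlim0 : ∀ y, 0 ≤ ∑ k, W k * limitSkewNormalPDF (M k) (S k) (L k) y := fun y =>
    Finset.sum_nonneg fun k _ => mul_nonneg (h.W_nonneg k) (limitSkewNormalPDF_nonneg _ _ _ _)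
  have hH0 : ∀ j y, 0 ≤ H j y := fun j y => mul_nonneg zero_le_two (Real.log_nonneg
    (le_add_of_nonneg_right (div_nonneg (hcut0 j y) (Ψ₀.pdf_pos y).le)))
  have hg0 : ∀ y, 0 ≤ g y := fun y => mul_nonneg zero_le_two (Real.log_nonneg
    (le_add_of_nonneg_right (div_nonneg (hlim0 y) (Ψ₀.pdf_pos y).le)))
  -- a uniform bound
  choose B hB0 hB using fun k => exists_eventually_cutSkewNormalPDF_le
    (m := fun j => (Ψ j).μ k) (l := fun j => (Ψ j).l k) (fun j => (Ψ j).σ_pos k) (h.σ k)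
  obtain ⟨K, hK, hKle⟩ := Ψ₀.exists_log_one_add_div_pdf_le (∑ k, B k)
    (Finset.sum_nonneg fun k _ => hB0 k)
  have hHle : ∀ᶠ j in atTop, ∀ y, H j y ≤ 2 * K * (1 + y ^ 2) := by
    filter_upwards [eventually_all.2 hB] with j hj y
    have e1 : ∑ k, (Ψ j).w k * cutSkewNormalPDF (S k) ((Ψ j).μ k) ((Ψ j).σ k) ((Ψ j).l k) y ≤
        ∑ k, B k := Finset.sum_le_sum fun k _ =>
      (mul_le_of_le_one_left (cutSkewNormalPDF_nonneg _ ((Ψ j).σ_pos k) _ _ _)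
        ((Ψ j).w_le_one k)).trans (hj k y)
    have e2 := Ψ₀.pdf_pos y
    have e3 : 0 ≤ (∑ k, (Ψ j).w k *
        cutSkewNormalPDF (S k) ((Ψ j).μ k) ((Ψ j).σ k) ((Ψ j).l k) y) / Ψ₀.pdf y :=
      div_nonneg (hcut0 j y) e2.le
    have e4 := Real.log_le_log (by linarith)
      (add_le_add_right (div_le_div_of_nonneg_right e1 e2.le) 1)
    have e5 := hKle y
    simp only [hH]
    linarith
  -- continuous convergence
  have hconv : ∀ᵐ y, Tendsto (fun q : ℕ × ℝ => H q.1 q.2) (atTop ×ˢ 𝓝 y) (𝓝 (g y)) := by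
    have : ∀ᵐ y : ℝ, ∀ k, y ≠ (M k).toReal :=
      ae_all_iff.2 fun k => by
        simpa using measure_eq_zero_iff_ae_notMem.1
          (measure_singleton (μ := (volume : Measure ℝ)) (M k).toReal)
    filter_upwards [this] with y hy
    have e1 : Tendsto (fun q : ℕ × ℝ => ∑ k, (Ψ q.1).w k *
        cutSkewNormalPDF (S k) ((Ψ q.1).μ k) ((Ψ q.1).σ k) ((Ψ q.1).l k) q.2) (atTop ×ˢ 𝓝 y)
        (𝓝 (∑ k, W k * limitSkewNormalPDF (M k) (S k) (L k) y)) :=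
      tendsto_finsetSum _ fun k _ => ((h.w k).comp tendsto_fst).mul
        (tendsto_cutSkewNormalPDF (fun j => (Ψ j).σ_pos k) (h.μ k) (h.σ k) (h.l k) (hy k))
    have e2 : Tendsto (fun q : ℕ × ℝ => Ψ₀.pdf q.2) (atTop ×ˢ 𝓝 y) (𝓝 (Ψ₀.pdf y)) :=
      (Ψ₀.continuous_pdf.tendsto y).comp tendsto_snd
    have e3 : (1 + (∑ k, W k * limitSkewNormalPDF (M k) (S k) (L k) y) / Ψ₀.pdf y) ≠ 0 := by
      have := div_nonneg (hlim0 y) (Ψ₀.pdf_pos y).le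
      linarith
    have e4 := e1.div e2 (Ψ₀.pdf_pos y).ne'
    have e5 := ((Real.continuousAt_log e3).tendsto.comp (tendsto_const_nhds.add e4)).const_mul 2
    exact e5
  have hgle : ∀ᵐ y, g y ≤ 2 * K * (1 + y ^ 2) := by
    filter_upwards [hconv] with y hy
    have hpair : Tendsto (fun j : ℕ => (j, y)) atTop (atTop ×ˢ 𝓝 y) :=
      tendsto_id.prodMk tendsto_const_nhds
    have hy' : Tendsto (fun j => H j y) atTop (𝓝 (g y)) :=
      Tendsto.comp (f := fun j : ℕ => (j, y)) (g := fun q : ℕ × ℝ => H q.1 q.2) hy hpair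
    exact le_of_tendsto hy' (hHle.mono fun j hj => hj y)
  have hgm : Measurable g := by
    have m1 : Measurable fun y => ∑ k, W k * limitSkewNormalPDF (M k) (S k) (L k) y :=
      Finset.measurable_fun_sum _ fun k _ =>
        (measurable_limitSkewNormalPDF (M k) (S k) (L k)).const_mul (W k)
    have m2 := m1.div Ψ₀.continuous_pdf.measurable
    exact (Real.measurable_log.comp (m2.const_add 1)).const_mul 2
  have hgint : Integrable g Ψ₀.law := by
    refine (Ψ₀.integrable_one_add_sq_law.const_mul (2 * K)).mono' hgm.aestronglyMeasurable
      (Ψ₀.ae_law_iff.2 ?_)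
    filter_upwards [hgle] with y hy
    rwa [Real.norm_of_nonneg (hg0 y)]
  refine ⟨hgint, ?_⟩
  refine le_of_forall_pos_le_add fun η hη => ?_
  -- The errors total `(p + 4) ε N`: the average on the bounded interval, the tail, the `p`
  -- components, the penalty of `Ψ₀` and the likelihood hypothesis. One further `ε` is slack.
  set ε : ℝ := η / (p + 5) with hε
  have hp5 : (0 : ℝ) < p + 5 := by positivity
  have hεpos : 0 < ε := by positivity
  obtain ⟨R, hR⟩ := hx.tail (ε / (2 * K + 1)) (by positivity)
  have hIco : ∀ᶠ j in atTop, ∀ y ∈ Set.Ico (-(R : ℝ)) R, H j y ≤ 2 * K * (1 + (R : ℝ) ^ 2) := by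
    filter_upwards [hHle] with j hj y hy
    refine (hj y).trans (mul_le_mul_of_nonneg_left ?_ (by positivity))
    have : y ^ 2 ≤ (R : ℝ) ^ 2 := sq_le_sq' hy.1 hy.2.le
    linarith
  have f1 := eventually_average_le_integral_of_cells Ψ₀.law x hx.cell N hN H g hH0 R _ hIco
    (Ψ₀.ae_law_iff.2 hconv) ε hεpos
  have f2 : ∀ᶠ j in atTop, ∀ k, 2 * ∑ i ∈ Finset.range (N j),
      (if S k = 0 ∧ |x i - (Ψ j).μ k| ≤ √((Ψ j).σ k) then
      Real.log (1 / (Ψ j).σ k) + Real.log (1 + 1 / Ψ₀.pdf (x i)) else 0) + a (N j) ((Ψ j).σ k) ≤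
      ε * N j :=
    eventually_all.2 fun k => hx.eventually_component_penalty_le (m := fun j => (Ψ j).μ k)
      (s := fun j => (Ψ j).σ k) h1 h2 hN (fun j => (Ψ j).σ_pos k) (h.σ k) ε hεpos
  have f3 : ∀ᶠ j in atTop, ∀ k, S k = 0 → (Ψ j).σ k ≤ 1 := by
    refine eventually_all.2 fun k => ?_
    by_cases hk : S k = 0
    · have := h.σ k
      rw [hk, ← EReal.coe_zero, EReal.tendsto_coe] at this
      filter_upwards [this.eventually_le_const one_pos] with j hj _ using hj
    · exact Eventually.of_forall fun j hj => absurd hj hk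
  have f4 : ∀ᶠ j in atTop, -(ε * N j) ≤
      (∑ k, a (N j) (Ψ₀.σ k)) + ∑ k, b (N j) (Ψ₀.l k) := by
    have e1 : (fun n : ℕ => (∑ k, a n (Ψ₀.σ k)) + ∑ k, b n (Ψ₀.l k)) =o[atTop]
        fun n : ℕ => (n : ℝ) :=
      (IsLittleO.fun_sum fun k _ => h1.1 _ (Ψ₀.σ_pos k)).add
        (IsLittleO.fun_sum fun k _ => hb _)
    filter_upwards [hN.eventually (e1.bound hεpos)] with j hj
    simp only [Real.norm_eq_abs, Nat.abs_cast] at hj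
    exact (abs_le.1 hj).1
  obtain ⟨j, g1, g2, g3, g4, g5, g6, g7, g8, g9⟩ := (f1.and (f2.and (f3.and (f4.and
    ((hN.eventually h3).and ((hN.eventually (hR R le_rfl)).and (hHle.and
    ((hlik ε hεpos).and (hNr.eventually_gt_atTop 0))))))))).exists
  rw [div_le_iff₀ g9] at g1
  -- By C3 the shape penalties are nonpositive, so diverging shapes need no lower control.
  have hb0 : ∑ k, b (N j) ((Ψ j).l k) ≤ 0 := Finset.sum_nonpos fun k _ => by
    rw [← g5.2.2.2]; exact g5.2.1 _
  have hlog : (Ψ j).logLik (N j) x - Ψ₀.logLik (N j) x ≤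
      ∑ i ∈ Finset.range (N j), H j (x i) - 2 * Real.log 2 * N j +
      ∑ k, 2 * ∑ i ∈ Finset.range (N j),
      (if S k = 0 ∧ |x i - (Ψ j).μ k| ≤ √((Ψ j).σ k) then
      Real.log (1 / (Ψ j).σ k) + Real.log (1 + 1 / Ψ₀.pdf (x i)) else 0) := by
    rw [MixParam.logLik, MixParam.logLik, ← Finset.sum_sub_distrib]
    refine (Finset.sum_le_sum fun i _ =>
      (Ψ j).log_pdf_sub_log_pdf_le Ψ₀ S g3 (x i)).trans_eq ?_
    rw [Finset.sum_add_distrib, Finset.sum_sub_distrib, Finset.sum_comm]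
    simp only [hH, Finset.sum_const, Finset.card_range, nsmul_eq_mul, Finset.mul_sum]
    ring
  have hHsum : ∑ i ∈ Finset.range (N j), H j (x i) ≤
      (∑ i ∈ Finset.range (N j), if x i ∈ Set.Ico (-(R : ℝ)) R then H j (x i) else 0) +
      2 * K * ∑ i ∈ Finset.range (N j), (if (R : ℝ) ≤ |x i| then 1 + x i ^ 2 else 0) := by
    rw [Finset.mul_sum, ← Finset.sum_add_distrib]
    refine Finset.sum_le_sum fun i _ => ?_
    have hpos : 0 ≤ 2 * K * (1 + x i ^ 2) := by positivity
    split_ifs with c1 c2 c2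
    · linarith
    · simp
    · simpa using g7 (x i)
    · refine absurd ?_ c1
      have := abs_lt.1 (not_le.1 c2)
      exact ⟨this.1.le, this.2⟩
  have htail : 2 * K * ∑ i ∈ Finset.range (N j), (if (R : ℝ) ≤ |x i| then 1 + x i ^ 2 else 0) ≤
      ε * N j := by
    refine (mul_le_mul_of_nonneg_left g6 (by positivity)).trans ?_
    have : 2 * K / (2 * K + 1) ≤ 1 := (div_le_one (by positivity)).2 (by linarith)
    calc _ = ε * N j * (2 * K / (2 * K + 1)) := by ring
      _ ≤ _ := mul_le_of_le_one_right (by positivity) this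
  have hcomp : ∑ k, (2 * ∑ i ∈ Finset.range (N j),
      (if S k = 0 ∧ |x i - (Ψ j).μ k| ≤ √((Ψ j).σ k) then
      Real.log (1 / (Ψ j).σ k) + Real.log (1 + 1 / Ψ₀.pdf (x i)) else 0) +
      a (N j) ((Ψ j).σ k)) ≤ p * (ε * N j) := by
    refine (Finset.sum_le_sum fun k _ => g2 k).trans_eq ?_
    simp
  rw [Finset.sum_add_distrib] at hcomp
  have hint : ∫ y in Set.Ico (-(R : ℝ)) R, g y ∂Ψ₀.law ≤ ∫ y, g y ∂Ψ₀.law :=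
    setIntegral_le_integral hgint (Eventually.of_forall hg0)
  rw [MixParam.penLogLik, MixParam.penLogLik] at g8
  have hfin : 2 * Real.log 2 * N j ≤ (∫ y, g y ∂Ψ₀.law + η) * N j := by
    have e1 := mul_le_mul_of_nonneg_right hint g9.le
    have e2 : η = ε * (p + 5) := by rw [hε]; field_simp
    have e3 : 0 < ε * N j := by positivity
    rw [e2]
    nlinarith
  exact le_of_mul_le_mul_right hfin g9

/-- The limit mixture density is the true density. -/
lemma MixParamTendsto.ae_limit_eq_pdf (h : MixParamTendsto Ψ W M S L) {x : ℕ → ℝ}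
    (hx : Ψ₀.IsTypicalSample x) {a b : ℕ → ℝ → ℝ} (h1 : CondC1 a) (h2 : CondC2 a) (h3 : CondC3 b)
    (hb : ∀ l : ℝ, (fun n => b n l) =o[atTop] fun n : ℕ => (n : ℝ)) {N : ℕ → ℕ}
    (hN : Tendsto N atTop atTop)
    (hlik : ∀ ε : ℝ, 0 < ε → ∀ᶠ j in atTop, -(ε * N j) ≤
      (Ψ j).penLogLik (N j) x (a (N j)) (b (N j)) - Ψ₀.penLogLik (N j) x (a (N j)) (b (N j))) :
    ∀ᵐ y, ∑ k, W k * limitSkewNormalPDF (M k) (S k) (L k) y = Ψ₀.pdf y := by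
  obtain ⟨hgint, hge⟩ := h.two_mul_log_two_le_integral hx h1 h2 h3 hb hN hlik
  set G : ℝ → ℝ := fun y => ∑ k, W k * limitSkewNormalPDF (M k) (S k) (L k) y with hG
  have hG0 : ∀ y, 0 ≤ G y := fun y =>
    Finset.sum_nonneg fun k _ => mul_nonneg (h.W_nonneg k) (limitSkewNormalPDF_nonneg _ _ _ _)
  have hGint : Integrable G := integrable_finsetSum _ fun k _ =>
    (integrable_limitSkewNormalPDF (M k) (S k) (L k)).1.const_mul _
  have hG1 : ∫ y, G y ≤ 1 := by
    rw [hG, integral_finsetSum _ fun k _ =>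
      (integrable_limitSkewNormalPDF (M k) (S k) (L k)).1.const_mul _, ← h.sum_W]
    refine Finset.sum_le_sum fun k _ => ?_
    rw [integral_const_mul]
    exact mul_le_of_le_one_right (h.W_nonneg k) (integrable_limitSkewNormalPDF _ _ _).2
  have hcancel : (fun y => Ψ₀.pdf y * (G y / Ψ₀.pdf y)) = G := by
    ext y; rw [mul_div_cancel₀ _ (Ψ₀.pdf_pos y).ne']
  have hvint : Integrable (fun y => G y / Ψ₀.pdf y) Ψ₀.law := by
    rw [MixParam.integrable_law_iff, hcancel]; exact hGint
  have hv1 : ∫ y, G y / Ψ₀.pdf y ∂Ψ₀.law ≤ 1 := by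
    rw [MixParam.integral_law, hcancel]; exact hG1
  -- The gap between `2 log (1 + v)` and its tangent at `v = 1`, where `v = G / f₀`. It is
  -- nonnegative, vanishes only at `v = 1`, and its integral is at most `0` by the score bound and
  -- `∫ v ≤ 1`.
  set φ : ℝ → ℝ := fun y => (G y / Ψ₀.pdf y + (2 * Real.log 2 - 1)) -
    2 * Real.log (1 + G y / Ψ₀.pdf y) with hφ
  have hφeq : ∀ y, φ y = 2 * (((1 + G y / Ψ₀.pdf y) / 2 - 1) -
      Real.log ((1 + G y / Ψ₀.pdf y) / 2)) := by
    intro y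
    have := div_nonneg (hG0 y) (Ψ₀.pdf_pos y).le
    rw [Real.log_div (by positivity) two_ne_zero, hφ]; ring
  have hφ0 : ∀ y, 0 ≤ φ y := by
    intro y
    have := div_nonneg (hG0 y) (Ψ₀.pdf_pos y).le
    rw [hφeq]
    have := Real.log_le_sub_one_of_pos (x := (1 + G y / Ψ₀.pdf y) / 2) (by positivity)
    linarith
  have hφint : Integrable φ Ψ₀.law := (hvint.add (integrable_const _)).sub hgint
  have hφle : ∫ y, φ y ∂Ψ₀.law ≤ 0 := by
    have e1 : ∫ y, (G y / Ψ₀.pdf y + (2 * Real.log 2 - 1)) ∂Ψ₀.law =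
        ∫ y, G y / Ψ₀.pdf y ∂Ψ₀.law + (2 * Real.log 2 - 1) := by
      rw [integral_add hvint (integrable_const _)]; simp
    have e2 : ∫ y, φ y ∂Ψ₀.law = ∫ y, (G y / Ψ₀.pdf y + (2 * Real.log 2 - 1)) ∂Ψ₀.law -
        ∫ y, 2 * Real.log (1 + G y / Ψ₀.pdf y) ∂Ψ₀.law :=
      integral_sub (hvint.add (integrable_const _)) hgint
    rw [e2, e1]
    linarith
  have hzero : ∫ y, φ y ∂Ψ₀.law = 0 := le_antisymm hφle (integral_nonneg hφ0)
  have hae := (integral_eq_zero_iff_of_nonneg hφ0 hφint).1 hzero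
  have hae' := Ψ₀.ae_law_iff.1 hae
  filter_upwards [hae'] with y hy
  have hv := div_nonneg (hG0 y) (Ψ₀.pdf_pos y).le
  have hone : (1 + G y / Ψ₀.pdf y) / 2 = 1 := by
    by_contra hne
    have := Real.log_lt_sub_one_of_pos (x := (1 + G y / Ψ₀.pdf y) / 2) (by positivity) hne
    rw [hφeq] at hy
    simp only [Pi.zero_apply] at hy
    linarith
  have : G y / Ψ₀.pdf y = 1 := by linarith
  exact (div_eq_one_iff_eq (Ψ₀.pdf_pos y).ne').1 this

end

/-! ### Identification of the mixing distribution and convergence of the distance. -/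

section
variable {p p₀ : ℕ} {Ψ₀ : MixParam p₀} {Ψ : ℕ → MixParam p} {W : Fin p → ℝ}
  {M S L : Fin p → EReal}

open Classical in
/-- If a limit mixture density agrees with the density of `Ψ₀`, their mixing weights differ by
the same amount at opposite shapes. -/
lemma fiber_weights_sub_eq (hae : ∀ᵐ y, ∑ k, W k * limitSkewNormalPDF (M k) (S k) (L k) y =
    Ψ₀.pdf y) {c σ : Fin p → ℝ} (hσ : ∀ k, 0 < σ k)
    (hc : ∀ k y, W k * limitSkewNormalPDF (M k) (S k) (L k) y =
      c k * extSkewNormalPDF (M k).toReal (σ k) (L k) y) (m s r : ℝ) (hs : 0 < s) (hr : r ≠ 0) :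
    ∑ k with (M k).toReal = m ∧ σ k = s ∧ L k = (r : EReal), c k -
      ∑ k with Ψ₀.μ k = m ∧ Ψ₀.σ k = s ∧ Ψ₀.l k = r, Ψ₀.w k =
    ∑ k with (M k).toReal = m ∧ σ k = s ∧ L k = ((-r : ℝ) : EReal), c k -
      ∑ k with Ψ₀.μ k = m ∧ Ψ₀.σ k = s ∧ Ψ₀.l k = -r, Ψ₀.w k := by
  -- To the right of all limit locations both densities are continuous, so almost everywhere
  -- equality becomes equality.
  obtain ⟨A, hA⟩ := (Set.finite_range fun k => (M k).toReal).bddAbove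
  have hA' : ∀ k, (M k).toReal ≤ A := fun k => hA ⟨k, rfl⟩
  simp only [hc] at hae
  have hcont : ContinuousOn (fun y => ∑ k, c k * extSkewNormalPDF (M k).toReal (σ k) (L k) y)
      (Set.Ioi A) := by
    refine continuousOn_finsetSum _ fun k _ => continuousOn_const.mul fun y hy => ?_
    exact (tendsto_extSkewNormalPDF (hσ k) tendsto_const_nhds tendsto_const_nhds
      tendsto_const_nhds tendsto_id ((hA' k).trans_lt hy).ne').mono_left nhdsWithin_le_nhds
  have heq := Measure.eqOn_open_of_ae_eq (μ := volume) (ae_restrict_of_ae hae) isOpen_Ioi hcont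
    Ψ₀.continuous_pdf.continuousOn
  have key := fiber_sum_eq_of_sum_extSkewNormalPDF_eq_zero (ι := Fin p ⊕ Fin p₀)
    (Sum.elim c fun k => -Ψ₀.w k) (Sum.elim (fun k => (M k).toReal) Ψ₀.μ) (Sum.elim σ Ψ₀.σ)
    (Sum.elim L fun k => (Ψ₀.l k : EReal)) (by
      rintro (k | k)
      · exact hσ k
      · exact Ψ₀.σ_pos k) (by
      filter_upwards [eventually_gt_atTop A] with y hy
      have := heq hy
      simp only at this
      simp only [Fintype.sum_sum_type, Sum.elim_inl, Sum.elim_inr, this, MixParam.pdf,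
        extSkewNormalPDF_coe, neg_mul, Finset.sum_neg_distrib, add_neg_cancel]) m s r hs hr
  simp only [Finset.sum_filter, Fintype.sum_sum_type, Sum.elim_inl, Sum.elim_inr,
    EReal.coe_eq_coe_iff] at key ⊢
  have hneg : ∀ (q : Fin p₀ → Prop) [DecidablePred q], ∑ k, (if q k then -Ψ₀.w k else 0) =
      -∑ k, if q k then Ψ₀.w k else 0 := by
    intro q _
    rw [← Finset.sum_neg_distrib]
    exact Finset.sum_congr rfl fun k _ => by split_ifs <;> simp
  have key' : (∑ k, if (M k).toReal = m ∧ σ k = s ∧ L k = (r : EReal) then c k else 0) +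
      (∑ k, if Ψ₀.μ k = m ∧ Ψ₀.σ k = s ∧ Ψ₀.l k = r then -Ψ₀.w k else 0) =
      (∑ k, if (M k).toReal = m ∧ σ k = s ∧ L k = ((-r : ℝ) : EReal) then c k else 0) +
      ∑ k, if Ψ₀.μ k = m ∧ Ψ₀.σ k = s ∧ Ψ₀.l k = -r then -Ψ₀.w k else 0 := by
    convert! key
  rw [hneg, hneg] at key'
  linarith

open Classical in
/-- Without mirror pairs, the true mixing weights are dominated by those of a limit mixture with
the same density. -/
lemma fiber_weights_le (hΨ₀ : Ψ₀.NoMirrorPair)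
    (hae : ∀ᵐ y, ∑ k, W k * limitSkewNormalPDF (M k) (S k) (L k) y =
    Ψ₀.pdf y) {c σ : Fin p → ℝ} (hσ : ∀ k, 0 < σ k) (hc0 : ∀ k, 0 ≤ c k)
    (hc : ∀ k y, W k * limitSkewNormalPDF (M k) (S k) (L k) y =
      c k * extSkewNormalPDF (M k).toReal (σ k) (L k) y) (m s r : ℝ) :
    ∑ k with Ψ₀.μ k = m ∧ Ψ₀.σ k = s ∧ Ψ₀.l k = r, Ψ₀.w k ≤
      ∑ k with (M k).toReal = m ∧ σ k = s ∧ L k = (r : EReal), c k := by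
  have hA0 : ∀ r : ℝ, 0 ≤ ∑ k with (M k).toReal = m ∧ σ k = s ∧ L k = (r : EReal), c k :=
    fun r => Finset.sum_nonneg fun k _ => hc0 k
  by_cases hz : ∀ k, Ψ₀.μ k = m ∧ Ψ₀.σ k = s ∧ Ψ₀.l k = r → Ψ₀.w k = 0
  · rw [Finset.sum_eq_zero fun k hk => hz k (Finset.mem_filter.1 hk).2]
    exact hA0 r
  push Not at hz
  obtain ⟨k, ⟨rfl, rfl, rfl⟩, hwk⟩ := hz
  have hwk' : 0 < Ψ₀.w k := lt_of_le_of_ne (Ψ₀.w_nonneg k) hwk.symm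
  have hl : Ψ₀.l k ≠ 0 := fun h0 => hΨ₀ k k hwk' hwk' ⟨rfl, rfl, by rw [h0, neg_zero]⟩
  have h1 := fiber_weights_sub_eq hae hσ hc (Ψ₀.μ k) (Ψ₀.σ k) (Ψ₀.l k) (Ψ₀.σ_pos k) hl
  have h2 : ∑ j with Ψ₀.μ j = Ψ₀.μ k ∧ Ψ₀.σ j = Ψ₀.σ k ∧ Ψ₀.l j = -Ψ₀.l k, Ψ₀.w j = 0 := by
    refine Finset.sum_eq_zero fun j hj => ?_
    obtain ⟨e1, e2, e3⟩ := (Finset.mem_filter.1 hj).2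
    by_contra hne
    exact hΨ₀ k j hwk' (lt_of_le_of_ne (Ψ₀.w_nonneg j) (Ne.symm hne))
      ⟨e1.symm, e2.symm, by rw [e3, neg_neg]⟩
  -- At `-l` the true mass is `0` and the limit mass is nonnegative, which turns the equality of
  -- differences into domination at `l`.
  have h3 := hA0 (-Ψ₀.l k)
  linarith

open Classical in
-- Domination of point masses, integrated against an arbitrary nonnegative `F`. Infinite shapes can
-- be dropped on the right, because no atom of `Ψ₀` sits there.
lemma sum_weights_mul_le (hΨ₀ : Ψ₀.NoMirrorPair)
    (hae : ∀ᵐ y, ∑ k, W k * limitSkewNormalPDF (M k) (S k) (L k) y =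
    Ψ₀.pdf y) {c σ : Fin p → ℝ} (hσ : ∀ k, 0 < σ k) (hc0 : ∀ k, 0 ≤ c k)
    (hc : ∀ k y, W k * limitSkewNormalPDF (M k) (S k) (L k) y =
      c k * extSkewNormalPDF (M k).toReal (σ k) (L k) y) (F : ℝ × ℝ × ℝ → ℝ)
    (hF : ∀ t, 0 ≤ F t) :
    ∑ k, Ψ₀.w k * F (Ψ₀.μ k, Ψ₀.σ k, Ψ₀.l k) ≤
      ∑ k, if L k ≠ ⊤ ∧ L k ≠ ⊥ then c k * F ((M k).toReal, σ k, (L k).toReal) else 0 := by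
  set τ : Fin p₀ → ℝ × ℝ × ℝ := fun k => (Ψ₀.μ k, Ψ₀.σ k, Ψ₀.l k) with hτ
  set T := Finset.univ.image τ
  calc ∑ k, Ψ₀.w k * F (τ k) = ∑ t ∈ T, (∑ k with τ k = t, Ψ₀.w k) * F t := by
        rw [← Finset.sum_fiberwise_of_maps_to (g := τ) (t := T)
          fun k _ => Finset.mem_image_of_mem τ (Finset.mem_univ k)]
        refine Finset.sum_congr rfl fun t _ => ?_
        rw [Finset.sum_mul]
        exact Finset.sum_congr rfl fun k hk => by rw [(Finset.mem_filter.1 hk).2]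
    _ ≤ ∑ t ∈ T, (∑ k with (M k).toReal = t.1 ∧ σ k = t.2.1 ∧ L k = (t.2.2 : EReal), c k) *
          F t := by
        refine Finset.sum_le_sum fun t _ => mul_le_mul_of_nonneg_right ?_ (hF t)
        obtain ⟨m, s, r⟩ := t
        simpa only [hτ, Prod.mk.injEq] using fiber_weights_le hΨ₀ hae hσ hc0 hc m s r
    _ = ∑ k, ∑ t ∈ T, if (M k).toReal = t.1 ∧ σ k = t.2.1 ∧ L k = (t.2.2 : EReal) then
          c k * F t else 0 := by
        rw [Finset.sum_comm]
        refine Finset.sum_congr rfl fun t _ => ?_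
        rw [Finset.sum_filter, Finset.sum_mul]
        exact Finset.sum_congr rfl fun k _ => by split_ifs <;> simp
    _ ≤ _ := by
        refine Finset.sum_le_sum fun k _ => ?_
        generalize hL : L k = ℓ
        induction ℓ with
        | bot => simp
        | top => simp
        | coe r =>
          rw [if_pos (by simp), EReal.toReal_coe]
          have : ∀ t : ℝ × ℝ × ℝ, ((M k).toReal = t.1 ∧ σ k = t.2.1 ∧ (r : EReal) = t.2.2) ↔
              ((M k).toReal, σ k, r) = t := by
            rintro ⟨a, b, d⟩
            simp [Prod.ext_iff]
          simp only [this, Finset.sum_ite_eq]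
          split_ifs
          · exact le_rfl
          · exact mul_nonneg (hc0 k) (hF _)

open Classical in
/-- Identifiability: a limit mixture whose density is that of `Ψ₀` has the mixing distribution
of `Ψ₀`, and no mass at infinite parameters or at vanishing scales. -/
lemma MixParamTendsto.weights_of_ae_eq (h : MixParamTendsto Ψ W M S L) (hΨ₀ : Ψ₀.NoMirrorPair)
    (hae : ∀ᵐ y, ∑ k, W k * limitSkewNormalPDF (M k) (S k) (L k) y = Ψ₀.pdf y) :
    (∀ k, W k = 0 ∨ ((M k ≠ ⊥ ∧ M k ≠ ⊤) ∧ (S k ≠ ⊥ ∧ S k ≠ ⊤) ∧ (L k ≠ ⊥ ∧ L k ≠ ⊤))) ∧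
    ∀ θ : ℝ × ℝ × ℝ, ∑ k, (if (M k).toReal ≤ θ.1 ∧ (S k).toReal ^ 2 ≤ θ.2.1 ∧
      (L k).toReal ≤ θ.2.2 then W k else 0) = Ψ₀.mixCDF θ := by
  set reg : Fin p → Prop := fun k => (M k ≠ ⊥ ∧ M k ≠ ⊤) ∧ (0 < S k ∧ S k ≠ ⊤) with hreg
  -- Components whose limit density is zero get weight `0` and the arbitrary scale `1`, so that
  -- every scale is positive.
  set σ : Fin p → ℝ := fun k => if reg k then (S k).toReal else 1 with hσdef
  set c : Fin p → ℝ := fun k => if reg k then W k else 0 with hcdef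
  have hσ : ∀ k, 0 < σ k := by
    intro k
    simp only [hσdef]
    split_ifs with hk
    · exact EReal.toReal_pos hk.2.1 hk.2.2
    · exact one_pos
  have hc0 : ∀ k, 0 ≤ c k := by
    intro k
    simp only [hcdef]
    split_ifs
    · exact h.W_nonneg k
    · exact le_rfl
  have hc : ∀ k y, W k * limitSkewNormalPDF (M k) (S k) (L k) y =
      c k * extSkewNormalPDF (M k).toReal (σ k) (L k) y := by
    intro k y
    by_cases hk : reg k
    · simp only [hcdef, hσdef, if_pos hk, limitSkewNormalPDF]
      rw [if_pos hk]
    · simp only [hcdef, if_neg hk, limitSkewNormalPDF]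
      rw [if_neg hk]; simp
  set d : Fin p → ℝ := fun k => if L k ≠ ⊤ ∧ L k ≠ ⊥ then c k else 0 with hd
  have hdW : ∀ k, d k ≤ W k := by
    intro k
    have := h.W_nonneg k
    simp only [hd, hcdef]
    split_ifs <;> first | exact le_rfl | exact this
  have key : ∀ F : ℝ × ℝ × ℝ → ℝ, (∀ t, 0 ≤ F t) →
      ∑ k, Ψ₀.w k * F (Ψ₀.μ k, Ψ₀.σ k, Ψ₀.l k) ≤
      ∑ k, d k * F ((M k).toReal, σ k, (L k).toReal) := by
    intro F hF
    refine (sum_weights_mul_le hΨ₀ hae hσ hc0 hc F hF).trans_eq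
      (Finset.sum_congr rfl fun k _ => ?_)
    simp only [hd]
    split_ifs <;> simp
  -- Testing with `F = 1`: the regular weights `d ≤ W` already have total mass at least `1`, while
  -- `W` has total exactly `1`.
  have hWd : ∀ k, W k = d k := by
    have h1 := key (fun _ => 1) fun _ => zero_le_one
    simp only [mul_one, Ψ₀.w_sum] at h1
    have h2 : ∑ k, (W k - d k) = 0 := by
      refine le_antisymm ?_ (Finset.sum_nonneg fun k _ => sub_nonneg.2 (hdW k))
      rw [Finset.sum_sub_distrib, h.sum_W]; linarith
    intro k
    have := (Finset.sum_eq_zero_iff_of_nonneg fun k _ => sub_nonneg.2 (hdW k)).1 h2 k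
      (Finset.mem_univ k)
    linarith
  refine ⟨fun k => ?_, fun θ => ?_⟩
  · by_cases hk : reg k ∧ L k ≠ ⊤ ∧ L k ≠ ⊥
    · exact Or.inr ⟨hk.1.1, ⟨(bot_lt_iff_ne_bot.1 (bot_le.trans_lt hk.1.2.1)), hk.1.2.2⟩,
        hk.2.2, hk.2.1⟩
    · left
      rw [hWd]
      simp only [hd, hcdef]
      split_ifs with q1 q2
      · exact absurd ⟨q2, q1⟩ hk
      · rfl
      · rfl
  · set F : ℝ × ℝ × ℝ → ℝ := fun t => if t.1 ≤ θ.1 ∧ t.2.1 ^ 2 ≤ θ.2.1 ∧ t.2.2 ≤ θ.2.2 then 1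
      else 0 with hFdef
    have hF0 : ∀ t, 0 ≤ F t := fun t => by simp only [hFdef]; split_ifs <;> norm_num
    have hF1 : ∀ t, 0 ≤ 1 - F t := fun t => by simp only [hFdef]; split_ifs <;> norm_num
    have h1 := key F hF0
    -- Equal total masses make the inequality for `1 - F` the reverse of that for `F`.
    have h2 := key (fun t => 1 - F t) hF1
    simp only [mul_sub, mul_one, Finset.sum_sub_distrib, Ψ₀.w_sum] at h2
    have h3 : ∑ k, d k = 1 := by
      rw [← h.sum_W]; exact Finset.sum_congr rfl fun k _ => (hWd k).symm
    rw [h3] at h2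
    have h4 : ∑ k, Ψ₀.w k * F (Ψ₀.μ k, Ψ₀.σ k, Ψ₀.l k) = Ψ₀.mixCDF θ := by
      rw [MixParam.mixCDF]
      refine Finset.sum_congr rfl fun k _ => ?_
      simp only [hFdef]
      split_ifs <;> simp
    rw [← h4]
    refine Eq.trans (Finset.sum_congr rfl fun k _ => ?_) (le_antisymm (by linarith) h1 :
      ∑ k, d k * F ((M k).toReal, σ k, (L k).toReal) = _)
    rw [hWd]
    by_cases hk : reg k
    · simp only [hFdef, hσdef, if_pos hk]
      split_ifs <;> simp
    · have : d k = 0 := by simp [hd, hcdef, hk]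
      simp [this]

lemma MixParam.measurable_mixCDF {p : ℕ} (Ψ : MixParam p) : Measurable Ψ.mixCDF := by
  unfold MixParam.mixCDF
  refine Finset.measurable_fun_sum _ fun k _ => Measurable.ite ?_ measurable_const measurable_const
  exact (measurableSet_le measurable_const measurable_fst).inter
    ((measurableSet_le measurable_const measurable_snd.fst).inter
      (measurableSet_le measurable_const measurable_snd.snd))

lemma MixParam.mixCDF_nonneg {p : ℕ} (Ψ : MixParam p) (θ : ℝ × ℝ × ℝ) : 0 ≤ Ψ.mixCDF θ :=
  Finset.sum_nonneg fun k _ => by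
    split_ifs
    · exact Ψ.w_nonneg k
    · exact le_rfl

lemma MixParam.mixCDF_le_one {p : ℕ} (Ψ : MixParam p) (θ : ℝ × ℝ × ℝ) : Ψ.mixCDF θ ≤ 1 := by
  rw [← Ψ.w_sum]
  refine Finset.sum_le_sum fun k _ => ?_
  split_ifs
  · exact le_rfl
  · exact Ψ.w_nonneg k

lemma eventually_le_iff_of_tendsto {u : ℕ → ℝ} {c t : ℝ} (hu : Tendsto u atTop (𝓝 c))
    (hct : t ≠ c) : ∀ᶠ j in atTop, (u j ≤ t ↔ c ≤ t) := by
  rcases lt_or_gt_of_ne hct with h | h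
  · filter_upwards [hu.eventually_const_lt h] with j hj
    exact ⟨fun h1 => absurd hj (not_lt.2 h1), fun h1 => absurd h (not_lt.2 h1)⟩
  · filter_upwards [hu.eventually_lt_const h] with j hj
    exact ⟨fun _ => h.le, fun _ => hj.le⟩

lemma integrable_exp_neg_abs : Integrable fun x : ℝ => Real.exp (-|x|) := by
  have h1 : IntegrableOn (fun x : ℝ => Real.exp (-|x|)) (Set.Ioi 0) := by
    refine (exp_neg_integrableOn_Ioi 0 one_pos).congr_fun (fun x hx => ?_) measurableSet_Ioi
    simp [abs_of_pos (show (0 : ℝ) < x from hx)]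
  have h2 : IntegrableOn (fun x : ℝ => Real.exp (-|x|)) (Set.Iic 0) := by
    refine (integrableOn_exp_Iic 0).congr_fun (fun x hx => ?_) measurableSet_Iic
    simp [abs_of_nonpos (show x ≤ 0 from hx)]
  rw [← integrableOn_univ, ← Set.Iic_union_Ioi (a := (0 : ℝ))]
  exact h2.union h1

lemma MixParamTendsto.tendsto_dist (h : MixParamTendsto Ψ W M S L) (hΨ₀ : Ψ₀.NoMirrorPair)
    (hae : ∀ᵐ y, ∑ k, W k * limitSkewNormalPDF (M k) (S k) (L k) y = Ψ₀.pdf y) :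
    Tendsto (fun j => (Ψ j).dist Ψ₀) atTop (𝓝 0) := by
  classical
  obtain ⟨hfin, hcdf⟩ := h.weights_of_ae_eq hΨ₀ hae
  -- Pointwise convergence can fail only where a coordinate of `θ` equals one of the finitely many
  -- limit values. Components that lose their weight are harmless wherever their parameters go.
  have hptw : ∀ᵐ θ : ℝ × ℝ × ℝ, Tendsto (fun j => (Ψ j).mixCDF θ) atTop (𝓝 (Ψ₀.mixCDF θ)) := by
    have hne : ∀ c : ℝ, ∀ᵐ y : ℝ, y ≠ c := fun c => by
      simpa using measure_eq_zero_iff_ae_notMem.1 (measure_singleton (μ := (volume : Measure ℝ)) c)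
    have q1 : ∀ᵐ θ : ℝ × ℝ × ℝ, ∀ k, θ.1 ≠ (M k).toReal :=
      ae_all_iff.2 fun k => Measure.quasiMeasurePreserving_fst.ae (hne _)
    have q2 : ∀ᵐ θ : ℝ × ℝ × ℝ, ∀ k, θ.2.1 ≠ (S k).toReal ^ 2 :=
      ae_all_iff.2 fun k => Measure.quasiMeasurePreserving_snd.ae
        (Measure.quasiMeasurePreserving_fst.ae (hne _))
    have q3 : ∀ᵐ θ : ℝ × ℝ × ℝ, ∀ k, θ.2.2 ≠ (L k).toReal :=
      ae_all_iff.2 fun k => Measure.quasiMeasurePreserving_snd.ae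
        (Measure.quasiMeasurePreserving_snd.ae (hne _))
    filter_upwards [q1, q2, q3] with θ h1 h2 h3
    rw [← hcdf θ]
    refine tendsto_finsetSum _ fun k _ => ?_
    rcases hfin k with hW | ⟨hM, hS, hL⟩
    · have hw := h.w k
      rw [hW] at hw ⊢
      rw [ite_self]
      refine squeeze_zero (fun j => ?_) (fun j => ?_) hw
      · split_ifs
        · exact (Ψ j).w_nonneg k
        · exact le_rfl
      · split_ifs
        · exact le_rfl
        · exact (Ψ j).w_nonneg k
    · have e1 : Tendsto (fun j => (Ψ j).μ k) atTop (𝓝 (M k).toReal) :=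
        (EReal.tendsto_toReal hM.2 hM.1).comp (h.μ k)
      have e2 : Tendsto (fun j => (Ψ j).σ k) atTop (𝓝 (S k).toReal) :=
        (EReal.tendsto_toReal hS.2 hS.1).comp (h.σ k)
      have e3 : Tendsto (fun j => (Ψ j).l k) atTop (𝓝 (L k).toReal) :=
        (EReal.tendsto_toReal hL.2 hL.1).comp (h.l k)
      have hw : Tendsto (fun j => if (M k).toReal ≤ θ.1 ∧ (S k).toReal ^ 2 ≤ θ.2.1 ∧
          (L k).toReal ≤ θ.2.2 then (Ψ j).w k else 0) atTop
          (𝓝 (if (M k).toReal ≤ θ.1 ∧ (S k).toReal ^ 2 ≤ θ.2.1 ∧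
          (L k).toReal ≤ θ.2.2 then W k else 0)) := by
        split_ifs
        · exact h.w k
        · exact tendsto_const_nhds
      refine hw.congr' ?_
      filter_upwards [eventually_le_iff_of_tendsto e1 (h1 k),
        eventually_le_iff_of_tendsto (e2.pow 2) (h2 k),
        eventually_le_iff_of_tendsto e3 (h3 k)] with j g1 g2 g3
      simp only [g1, g2, g3]
  have hms : MeasurableSet {θ : ℝ × ℝ × ℝ | 0 < θ.2.1} :=
    measurableSet_lt measurable_const (by fun_prop)
  have hbound : Integrable fun θ : ℝ × ℝ × ℝ =>
      Real.exp (-|θ.1|) * (Real.exp (-|θ.2.1|) * Real.exp (-|θ.2.2|)) :=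
    integrable_exp_neg_abs.mul_prod (integrable_exp_neg_abs.mul_prod integrable_exp_neg_abs)
  have hdct := tendsto_integral_of_dominated_convergence
    (μ := volume.restrict {θ : ℝ × ℝ × ℝ | 0 < θ.2.1})
    (F := fun j θ => |(Ψ j).mixCDF θ - Ψ₀.mixCDF θ| * Real.exp (-(|θ.1| + θ.2.1 + |θ.2.2|)))
    (f := fun _ => 0)
    (fun θ => Real.exp (-|θ.1|) * (Real.exp (-|θ.2.1|) * Real.exp (-|θ.2.2|)))
    (fun j => by
      refine ((((Ψ j).measurable_mixCDF.sub Ψ₀.measurable_mixCDF).abs).mul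
        ?_).aestronglyMeasurable
      fun_prop) hbound.integrableOn (fun j => by
      refine (ae_restrict_iff' hms).2 (Eventually.of_forall fun θ hθ => ?_)
      have hθ' : 0 < θ.2.1 := hθ
      rw [← Real.exp_add, ← Real.exp_add, abs_of_pos hθ', norm_mul, Real.norm_eq_abs, abs_abs,
        Real.norm_of_nonneg (Real.exp_nonneg _)]
      have e1 : |(Ψ j).mixCDF θ - Ψ₀.mixCDF θ| ≤ 1 := by
        rw [abs_le]
        have := (Ψ j).mixCDF_nonneg θ
        have := (Ψ j).mixCDF_le_one θ
        have := Ψ₀.mixCDF_nonneg θ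
        have := Ψ₀.mixCDF_le_one θ
        constructor <;> linarith
      refine (mul_le_of_le_one_left (Real.exp_nonneg _) e1).trans_eq ?_
      ring_nf) (by
      refine ae_restrict_of_ae ?_
      filter_upwards [hptw] with θ hθ
      have e1 := ((hθ.sub_const (Ψ₀.mixCDF θ)).abs).mul_const
        (Real.exp (-(|θ.1| + θ.2.1 + |θ.2.2|)))
      simpa using e1)
  simpa [MixParam.dist] using hdct

end

/-! ### Compactness, comparison with the padded truth, and the theorem. -/

/-- Consistency along a typical sample: parameters whose penalized log-likelihood is at least that
of the truth, up to `o(n)`, converge to the truth. -/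
lemma MixParam.IsTypicalSample.tendsto_dist {p p₀ : ℕ} {Ψ₀ : MixParam p₀} {x : ℕ → ℝ}
    (hx : Ψ₀.IsTypicalSample x) (hΨ₀ : Ψ₀.NoMirrorPair) {a b : ℕ → ℝ → ℝ} (h1 : CondC1 a)
    (h2 : CondC2 a) (h3 : CondC3 b)
    (hb : ∀ l : ℝ, (fun n => b n l) =o[atTop] fun n : ℕ => (n : ℝ)) (Ψ : ℕ → MixParam p)
    (hlik : ∀ ε : ℝ, 0 < ε → ∀ᶠ n : ℕ in atTop, -(ε * n) ≤
      (Ψ n).penLogLik n x (a n) (b n) - Ψ₀.penLogLik n x (a n) (b n)) :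
    Tendsto (fun n => (Ψ n).dist Ψ₀) atTop (𝓝 0) := by
  refine tendsto_of_subseq_tendsto fun ns hns => ?_
  -- All parameters are placed in the compact space `[0,1] × EReal³` for each component, so a
  -- convergent subsequence exists without any a priori bound.
  let z : ℕ → Fin p → Set.Icc (0 : ℝ) 1 × EReal × EReal × EReal := fun j k =>
    (⟨(Ψ (ns j)).w k, (Ψ (ns j)).w_nonneg k, (Ψ (ns j)).w_le_one k⟩,
      ((Ψ (ns j)).μ k : EReal), ((Ψ (ns j)).σ k : EReal), ((Ψ (ns j)).l k : EReal))
  obtain ⟨z₀, ms, hms, hz⟩ := CompactSpace.tendsto_subseq z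
  refine ⟨ms, ?_⟩
  have hzk : ∀ k, Tendsto (fun j => z (ms j) k) atTop (𝓝 (z₀ k)) := fun k =>
    (tendsto_pi_nhds.1 hz) k
  have hN : Tendsto (fun j => ns (ms j)) atTop atTop := hns.comp hms.tendsto_atTop
  have h : MixParamTendsto (fun j => Ψ (ns (ms j))) (fun k => ((z₀ k).1 : ℝ))
      (fun k => (z₀ k).2.1) (fun k => (z₀ k).2.2.1) (fun k => (z₀ k).2.2.2) :=
    ⟨fun k => (continuous_subtype_val.tendsto _).comp ((continuous_fst.tendsto _).comp (hzk k)),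
      fun k => ((continuous_fst.comp continuous_snd).tendsto _).comp (hzk k),
      fun k => ((continuous_fst.comp (continuous_snd.comp continuous_snd)).tendsto _).comp (hzk k),
      fun k => ((continuous_snd.comp (continuous_snd.comp continuous_snd)).tendsto _).comp (hzk k)⟩
  exact h.tendsto_dist hΨ₀ (h.ae_limit_eq_pdf hx h1 h2 h3 hb hN
    fun ε hε => hN.eventually (hlik ε hε))

/-- A mixture with `p₀` components as one with `p₀ + q` components, of which `q` are copies of the
`i`-th one with proportion `0`. -/
def MixParam.pad {p₀ : ℕ} (Ψ : MixParam p₀) (i : Fin p₀) (q : ℕ) : MixParam (p₀ + q) where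
  w := Fin.append Ψ.w fun _ => 0
  μ := Fin.append Ψ.μ fun _ => Ψ.μ i
  σ := Fin.append Ψ.σ fun _ => Ψ.σ i
  l := Fin.append Ψ.l fun _ => Ψ.l i
  w_nonneg := by
    intro k
    refine Fin.addCases (fun j => ?_) (fun j => ?_) k
    · simpa using Ψ.w_nonneg j
    · simp
  w_sum := by simp [Fin.sum_univ_add, Ψ.w_sum]
  σ_pos := by
    intro k
    refine Fin.addCases (fun j => ?_) (fun j => ?_) k
    · simpa using Ψ.σ_pos j
    · simpa using Ψ.σ_pos i

lemma MixParam.penLogLik_pad {p₀ : ℕ} (Ψ : MixParam p₀) (i : Fin p₀) (q n : ℕ) (x : ℕ → ℝ)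
    (a b : ℝ → ℝ) : (Ψ.pad i q).penLogLik n x a b =
      Ψ.penLogLik n x a b + q * (a (Ψ.σ i) + b (Ψ.l i)) := by
  have hpdf : (Ψ.pad i q).pdf = Ψ.pdf := by
    ext y
    simp [MixParam.pdf, MixParam.pad, Fin.sum_univ_add]
  simp only [MixParam.penLogLik, MixParam.logLik, hpdf]
  simp only [MixParam.pad, Fin.sum_univ_add, Fin.append_left, Fin.append_right, Finset.sum_const,
    Finset.card_univ, Fintype.card_fin, nsmul_eq_mul]
  ring

/-- The maximizer competes with `Ψ₀` padded to `p` components. Padding leaves the density unchanged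
but adds penalties of order `o(n)`, which is why consistency is proved under a lower bound `-ε n`
rather than a constant. -/
lemma MixParam.eventually_le_penLogLik_sub_of_isPMLE {p p₀ : ℕ} (hp : p₀ < p) (Ψ₀ : MixParam p₀)
    {x : ℕ → ℝ} {a b : ℕ → ℝ → ℝ} (h1 : CondC1 a)
    (hb : ∀ l : ℝ, (fun n => b n l) =o[atTop] fun n : ℕ => (n : ℝ)) (Ψ : ℕ → MixParam p)
    (hΨ : ∀ᶠ n in atTop, (Ψ n).IsPMLE n x (a n) (b n)) (ε : ℝ) (hε : 0 < ε) :
    ∀ᶠ n : ℕ in atTop, -(ε * n) ≤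
      (Ψ n).penLogLik n x (a n) (b n) - Ψ₀.penLogLik n x (a n) (b n) := by
  obtain ⟨q, rfl⟩ := Nat.exists_eq_add_of_le hp.le
  obtain ⟨i, -⟩ := Ψ₀.exists_w_pos
  have e1 : (fun n : ℕ => q * (a n (Ψ₀.σ i) + b n (Ψ₀.l i))) =o[atTop] fun n : ℕ => (n : ℝ) :=
    ((h1.1 _ (Ψ₀.σ_pos i)).add (hb _)).const_mul_left _
  filter_upwards [hΨ, e1.bound hε] with n hn hbd
  have h2 := hn (Ψ₀.pad i q)
  rw [MixParam.penLogLik_pad] at h2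
  simp only [Real.norm_eq_abs, Nat.abs_cast] at hbd
  linarith [(abs_le.1 hbd).1]

theorem theorem6 {Ω : Type*} [MeasurableSpace Ω] (P : Measure Ω) [IsProbabilityMeasure P]
    (p₀ p : ℕ) (hp : p₀ < p) (Ψ₀ : MixParam p₀) (hΨ₀ : Ψ₀.NoMirrorPair)
    (X : ℕ → Ω → ℝ) (hindep : iIndepFun X P) (hlaw : ∀ i, HasLaw (X i) Ψ₀.law P)
    (a b : ℕ → Ω → ℝ → ℝ)
    (hC1 : ∀ᵐ ω ∂P, CondC1 fun n => a n ω)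
    (hC2 : ∀ᵐ ω ∂P, CondC2 fun n => a n ω)
    (hC3 : ∀ᵐ ω ∂P, CondC3 fun n => b n ω)
    (hb : ∀ᵐ ω ∂P, ∀ l : ℝ, (fun n => b n ω l) =o[atTop] fun n : ℕ => (n : ℝ)) :
    ∀ᵐ ω ∂P,
      (∀ (c : ℝ) (Ψ : ℕ → MixParam p),
        (∀ᶠ n in atTop, c ≤ (Ψ n).penLogLik n (fun i => X i ω) (a n ω) (b n ω)
          - Ψ₀.penLogLik n (fun i => X i ω) (a n ω) (b n ω)) →
        Tendsto (fun n => (Ψ n).dist Ψ₀) atTop (𝓝 0)) ∧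
      (∀ Ψ : ℕ → MixParam p,
        (∀ᶠ n in atTop, (Ψ n).IsPMLE n (fun i => X i ω) (a n ω) (b n ω)) →
        Tendsto (fun n => (Ψ n).dist Ψ₀) atTop (𝓝 0)) := by
  filter_upwards [hC1, hC2, hC3, hb, Ψ₀.ae_isTypicalSample hindep hlaw] with ω h1 h2 h3 h4 hx
  refine ⟨fun c Ψ hc => hx.tendsto_dist hΨ₀ h1 h2 h3 h4 Ψ fun ε hε => ?_,
    fun Ψ hΨ => hx.tendsto_dist hΨ₀ h1 h2 h3 h4 Ψ
      (MixParam.eventually_le_penLogLik_sub_of_isPMLE hp Ψ₀ h1 h4 Ψ hΨ)⟩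
  have hlim : Tendsto (fun n : ℕ => -(ε * n)) atTop atBot :=
    tendsto_neg_atTop_atBot.comp (tendsto_natCast_atTop_atTop.const_mul_atTop hε)
  filter_upwards [hc, hlim.eventually_le_atBot c] with n hn hn2
  exact hn2.trans hn

end
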